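/- Let $Z\in\mathbb R$, $\mu\in\mathbb C$, $\alpha,\beta\in[0,\pi)$. For $k\in\mathbb C\setminus\{0\}$ consider the radial equation $$\big((x+1)u'(x)\big)'+\Big[\tfrac{k^2}{4}\big(x+1+2(x+1)^{-1}+(x+1)^{-3}\big)+\tfrac{Z}{2}\big(1+(x+1)^{-2}\big)-\tfrac{\mu}{x+1}\Big]u(x)=0,\qquad x\in\mathbb C\setminus(-\infty,-1],$$ which is $v''(\xi)+(k^2\cosh^2\xi+Z\cosh\xi-\mu)v(\xi)=0$ in the variable $x=e^\xi-1$, and the Wronskian $W(f,g)=(x+1)(fg'-f'g)$. *Phase function.* A global phase function is a function $\phi(\xi,k)$ ($\xi\in\mathbb R$, $k\in\mathbb C\setminus\{0\}$) with $\phi(\xi,-k)=-\phi(\xi,k)$ such that for every integer $j\ge1$ there are a real function $l_j\in C^2((0,\infty))$ with $|l_j|\le 1/j$, with $l_j(\tau)=-Z/\sqrt{1+\tau^2}$ for all large $\tau$ and with $\frac{\mu}{1+\tau^2}-\frac{Z}{\sqrt{1+\tau^2}}-l_j(\tau)\in L^1((0,\infty))$, and an analytic function $g_j$ on $\Omega_j=\{|k|^2>1/j\}$,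 with $$\phi(\xi,k)=\int_0^{\sinh\xi}\sqrt{k^2-l_j(\tau)}\,d\tau+g_j(k)$$ for all $k\in\Omega_j$ and all $\xi$ larger than a constant depending only on $j$; here $\sqrt{k^2-l}:=k\sqrt{1-l/k^2}$ with the principal root. Fix a global phase function. For each $k\neq0$ the function $x\mapsto\phi(\log(x+1),k)$, $x$ real and large, continues analytically to $\{x\in\mathbb C\setminus(-\infty,0]:|x|>R\}$ for some $R=R(k)>0$; write $\phi(x,k)$ for the continuation. *Solutions.* Let $\tilde v_0(\cdot,k)$ be the solution with $\tilde v_0(0,k)=1$, $\tilde v_0'(0,k)=0$. Let $D_\pm(\alpha,\beta)=\{k\ne0:-\beta<\arg(\pm k)<\pi+\alpha\}$, considered as a (possibly two-sheeted) domain on the Riemann surface of the logarithm of $\pm k$. For $k\in D_\pm(\alpha,\beta)$ with $0\le\arg(\pm k)\le\pi$ let $\tilde v_\pm(\cdot,k)$ be the solution with $$\tilde v_\pm(x,k)=\frac{1}{\sqrt{x+1}}\,e^{\pm i\phi(x,k)}(1+o(1))\qquad(x\to+\infty).$$ Then $\tilde v_0$ and $\tilde v_\pm$ exist and are analytic in $x\in\mathbb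 C\setminus(-\infty,-1]$; $\tilde v_\pm(x,\cdot)$ extends to an analytic family of solutions for $k\in D_\pm(\alpha,\beta)$; and the Jost functions $$f_\pm(k):=W\big(\tilde v_\pm(\cdot,k),\tilde v_0(\cdot,k)\big)$$ (which do not depend on $x$) are analytic on $D_\pm(\alpha,\beta)$. Moreover, for every $k\in D_\pm(\alpha,\beta)$ and every $\gamma\in(-\alpha,\beta)$ with $0<\gamma+\arg(\pm k)<\pi$, $$f_\pm(k)=\mp\, ik\lim_{x\to+\infty}e^{i\gamma/2}\sqrt{x}\;\exp\!\big(\pm i\phi(e^{i\gamma}x,k)\big)\,\tilde v_0(e^{i\gamma}x,k).$$ -/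

import Mathlib

open Filter Topology

noncomputable section

namespace TwoCenters

/-- The slit plane `ℂ ∖ (-∞, -1]`, on which the coefficients of the radial equation, in the
variable `x = exp ξ - 1`, are analytic. -/
def radialDomain : Set ℂ := {x | x + 1 ∈ Complex.slitPlane}

/-- The potential `q(x, k, Z, μ)` of the radial equation in the variable `x = exp ξ - 1`. -/
def radialPotential (Z : ℝ) (μ k x : ℂ) : ℂ :=
  k ^ 2 / 4 * (x + 1 + 2 * (x + 1)⁻¹ + ((x + 1) ^ 3)⁻¹)
    + (Z : ℂ) / 2 * (1 + ((x + 1) ^ 2)⁻¹) - μ / (x + 1)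

/-- `u` is an analytic solution on `ℂ ∖ (-∞, -1]` of the radial equation
`((x + 1) u')' + q(x, k, Z, μ) u = 0`. -/
structure IsRadialSolution (Z : ℝ) (μ k : ℂ) (u : ℂ → ℂ) : Prop where
  analytic : AnalyticOnNhd ℂ u radialDomain
  ode : ∀ x ∈ radialDomain,
    deriv (fun y => (y + 1) * deriv u y) x + radialPotential Z μ k x * u x = 0

/-- The regular solution: `u(0) = 1`, `u'(0) = 0`. -/
structure IsRegularSolution (Z : ℝ) (μ k : ℂ) (u : ℂ → ℂ) : Prop where
  solution : IsRadialSolution Z μ k u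
  value_zero : u 0 = 1
  deriv_zero : deriv u 0 = 0

/-- The generalised Wronskian `W_x(f, g) = (x + 1) (f(x) g'(x) - f'(x) g(x))` of the radial
equation. -/
def wronskian (f g : ℂ → ℂ) (x : ℂ) : ℂ :=
  (x + 1) * (f x * deriv g x - deriv f x * g x)

/-- The exterior region `Ω_j = {k ∈ ℂ : |k|² > 1/j}`. -/
def phaseRegion (j : ℕ) : Set ℂ := {k | 1 / (j : ℝ) < ‖k‖ ^ 2}

/-- `l` is an admissible long range part, at level `j`, of
`q(τ) = μ / (1 + τ²) - Z / √(1 + τ²)`. -/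
structure IsLongRangePart (Z : ℝ) (μ : ℂ) (j : ℕ) (l : ℝ → ℝ) : Prop where
  contDiffOn : ContDiffOn ℝ 2 l (Set.Ioi 0)
  bound : ∀ τ > 0, |l τ| ≤ 1 / (j : ℝ)
  eq_far : ∃ R : ℝ, ∀ τ > R, l τ = -Z / √(1 + τ ^ 2)
  short_integrable : MeasureTheory.IntegrableOn
    (fun τ : ℝ => μ / (1 + (τ : ℂ) ^ 2) - ((Z / √(1 + τ ^ 2) : ℝ) : ℂ) - (l τ : ℂ)) (Set.Ioi 0)

/-- The local phase function `∫₀^{sinh ξ} √(k² - l(τ)) dτ`. The branch of `√(k² - l)` is the one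
that is analytic in `{|k|² > sup |l|}` and asymptotic to `k` for large `k`, that is
`k √(1 - l / k²)` with the principal square root. -/
def localPhase (l : ℝ → ℝ) (ξ : ℝ) (k : ℂ) : ℂ :=
  ∫ τ in (0 : ℝ)..Real.sinh ξ, k * (1 - (l τ : ℂ) / k ^ 2) ^ (1 / 2 : ℂ)

/-- `φ(ξ, k)` is a global phase function: it is odd in `k` and, for every `j ≥ 1`, for all large
`ξ` it differs on `Ω_j` from a local phase function of level `j` by an analytic function of `k`
alone. -/
structure IsGlobalPhase (Z : ℝ) (μ : ℂ) (φ : ℝ → ℂ → ℂ) : Prop where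
  eq_local : ∀ j : ℕ, 1 ≤ j → ∃ (l : ℝ → ℝ) (g : ℂ → ℂ) (R : ℝ),
    IsLongRangePart Z μ j l ∧ AnalyticOnNhd ℂ g (phaseRegion j) ∧
    ∀ ξ > R, ∀ k ∈ phaseRegion j, φ ξ k = localPhase l ξ k + g k
  odd : ∀ ξ : ℝ, ∀ k : ℂ, k ≠ 0 → φ ξ (-k) = -φ ξ k

/-- `Φ(x, k)` is, for every `k ≠ 0`, the analytic continuation in `x` of the germ at `+∞` of
`x ↦ φ(log(x + 1), k)` to a neighbourhood of infinity in the plane slit along the negative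
half-line. -/
def IsPhaseContinuation (φ : ℝ → ℂ → ℂ) (Φ : ℂ → ℂ → ℂ) : Prop :=
  ∀ k : ℂ, k ≠ 0 → ∃ R > 0,
    AnalyticOnNhd ℂ (fun x => Φ x k) {x | x ∈ Complex.slitPlane ∧ R < ‖x‖} ∧
    ∀ x : ℝ, R < x → Φ (x : ℂ) k = φ (Real.log (x + 1)) k

/-- The possibly two-sheeted domain `D_±(α, β) = {-β < arg(± k) < π + α}` in the logarithmic
coordinate `κ = log(± k)`, that is `k = ± exp κ` and `arg(± k) = Im κ`. As `exp` is a local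
biholomorphism, analyticity on `D_±(α, β)` is analyticity in `κ`. -/
def jostDomain (α β : ℝ) : Set ℂ := {κ | -β < κ.im ∧ κ.im < Real.pi + α}

/-- For `σ = 1` (`σ = -1`): `v κ` is the outgoing solution `ṽ₊(·, k)` (incoming solution
`ṽ₋(·, k)`) at the point `k = σ exp κ`. On the closed upper (lower) half-plane, `0 ≤ Im κ ≤ π`,
it is the solution of the radial equation with the asymptotics
`(x + 1)^{-1/2} exp(± i φ) (1 + o(1))` as `x → +∞`, and elsewhere it is the analytic continuation
in `k` of that family. -/
structure IsJostSolution (Z : ℝ) (μ : ℂ) (φ : ℝ → ℂ → ℂ) (α β : ℝ) (σ : ℂ)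
    (v : ℂ → ℂ → ℂ) : Prop where
  solution : ∀ κ ∈ jostDomain α β, IsRadialSolution Z μ (σ * Complex.exp κ) (v κ)
  analytic : ∀ x ∈ radialDomain, AnalyticOnNhd ℂ (fun κ => v κ x) (jostDomain α β)
  asymptotics : ∀ κ ∈ jostDomain α β, 0 ≤ κ.im → κ.im ≤ Real.pi →
    Tendsto (fun x : ℝ => (√(x + 1) : ℂ)
        * Complex.exp (-(σ * Complex.I * φ (Real.log (x + 1)) (σ * Complex.exp κ))) * v κ x)
      atTop (𝓝 1)

end TwoCenters

end

/-!
The long-range part of the momentum is a function of `1 / sinh ξ` near infinity, so a global phase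
is, up to a constant `c k`, an explicit normal form that continues analytically to the slit plane
and differs by `o(1)` from the leading phase `k (x + 1) / 2 + (Z / (2 k)) log (x + 1)`.

In the variable `z = k (x + 1)` the radial equation becomes, after extraction of the leading factor,
a perturbation that decays like `z⁻²`. Its Volterra series, integrated along vertical lines,
converges above the wedge `Im z + |Re z| > R` and yields a solution with the Jost asymptotics along
every ray on which `k x` stays in the closed upper half-plane. In the entire fundamental system at
`x = 0` this solution has coefficients that are entire in `κ = log k`, so it continues to all sheets
at once.

Where the Jost solution `u` decays along a ray, any solution `s` satisfies
`(s / u)' = W(u, s) / ((x + 1) u²)`, and l'Hôpital's rule against the growing exponential of `u⁻²`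
gives the limit formula.
-/

namespace TwoCenters

open MeasureTheory Set Metric
open scoped Interval

/-! ### Holomorphic families and the Picard series -/

section ParametricIntegral

variable {E : Type*} [NormedAddCommGroup E] [NormedSpace ℂ E]

section Measure

variable {A : Type*} [MeasurableSpace A] {ν : Measure A} {F : ℂ → A → E} {z₀ : ℂ} {r : ℝ}

theorem aestronglyMeasurable_deriv_of_differentiableOn (hr : 0 < r)
    (hd : ∀ᵐ a ∂ν, DifferentiableOn ℂ (F · a) (ball z₀ r))
    (hm : ∀ z ∈ ball z₀ r, AEStronglyMeasurable (F z) ν) :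
    AEStronglyMeasurable (fun a => deriv (F · a) z₀) ν := by
  classical
  refine aestronglyMeasurable_of_tendsto_ae (𝓝[≠] z₀)
    (f := fun z a => if z ∈ ball z₀ r then slope (F · a) z₀ z else 0) (fun z => ?_) ?_
  · split_ifs with hz
    · exact ((hm z hz).sub (hm z₀ (mem_ball_self hr))).const_smul _
    · exact aestronglyMeasurable_const
  · filter_upwards [hd] with a ha
    have hslope := hasDerivAt_iff_tendsto_slope.1
      (ha.differentiableAt (ball_mem_nhds z₀ hr)).hasDerivAt
    refine hslope.congr' ?_
    filter_upwards [mem_nhdsWithin_of_mem_nhds (ball_mem_nhds z₀ hr)] with z hz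
    rw [if_pos hz]

theorem hasDerivAt_integral_of_dominated_of_differentiableOn {bound : A → ℝ} (hr : 0 < r)
    (hd : ∀ᵐ a ∂ν, DifferentiableOn ℂ (F · a) (ball z₀ r))
    (hm : ∀ z ∈ ball z₀ r, AEStronglyMeasurable (F z) ν)
    (hb : ∀ᵐ a ∂ν, ∀ z ∈ ball z₀ r, ‖F z a‖ ≤ bound a) (hi : Integrable bound ν) :
    Integrable (fun a => deriv (F · a) z₀) ν ∧
      HasDerivAt (fun z => ∫ a, F z a ∂ν) (∫ a, deriv (F · a) z₀ ∂ν) z₀ := by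
  have hsub : ball z₀ (r / 2) ⊆ ball z₀ r := ball_subset_ball (by linarith)
  refine hasDerivAt_integral_of_dominated_loc_of_deriv_le (s := ball z₀ (r / 2))
    (F' := fun z a => deriv (F · a) z) (bound := fun a => bound a / (r / 4))
    (ball_mem_nhds _ (by positivity)) (eventually_of_mem (ball_mem_nhds _ hr) hm)
    (hi.mono' (hm _ (mem_ball_self hr)) (hb.mono fun a ha => ha _ (mem_ball_self hr)))
    (aestronglyMeasurable_deriv_of_differentiableOn hr hd hm) ?_ (hi.div_const _) ?_
  · filter_upwards [hd, hb] with a hda hba z hz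
    have hclosed : closedBall z (r / 4) ⊆ ball z₀ r :=
      closedBall_subset_ball' (by rw [mem_ball] at hz; linarith)
    exact Complex.norm_deriv_le_of_forall_mem_sphere_norm_le (by positivity)
      ((hda.mono hclosed).diffContOnCl_ball subset_rfl)
      fun w hw => hba w (hclosed (sphere_subset_closedBall hw))
  · filter_upwards [hd] with a hda z hz
    exact (hda.differentiableAt (isOpen_ball.mem_nhds (hsub hz))).hasDerivAt

theorem hasDerivAt_integral_of_locally_dominated {U : Set ℂ} (hU : IsOpen U) {c : ℂ → ℝ}
    (hc : ContinuousOn c U) {b : A → ℝ} (hb : Integrable b ν)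
    (hd : ∀ᵐ a ∂ν, DifferentiableOn ℂ (F · a) U)
    (hm : ∀ z ∈ U, AEStronglyMeasurable (F z) ν)
    (hbound : ∀ᵐ a ∂ν, ∀ z ∈ U, ‖F z a‖ ≤ c z * b a) (hz₀ : z₀ ∈ U) :
    Integrable (fun a => deriv (F · a) z₀) ν ∧
      HasDerivAt (fun z => ∫ a, F z a ∂ν) (∫ a, deriv (F · a) z₀ ∂ν) z₀ := by
  have hcloc : ∀ᶠ z in 𝓝 z₀, |c z| < |c z₀| + 1 :=
    (hc.continuousAt (hU.mem_nhds hz₀)).abs.eventually_lt continuousAt_const (lt_add_one _)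
  obtain ⟨r, hr, hball⟩ := Metric.eventually_nhds_iff_ball.1 ((hU.eventually_mem hz₀).and hcloc)
  refine hasDerivAt_integral_of_dominated_of_differentiableOn
    (bound := fun a => (|c z₀| + 1) * |b a|) hr
    (hd.mono fun a ha => ha.mono fun z hz => (hball z hz).1) (fun z hz => hm z (hball z hz).1)
    (hbound.mono fun a ha z hz => ?_) (hb.abs.const_mul _)
  calc ‖F z a‖ ≤ |c z * b a| := (ha z (hball z hz).1).trans (le_abs_self _)
    _ ≤ (|c z₀| + 1) * |b a| := by
      rw [abs_mul]
      exact mul_le_mul_of_nonneg_right (hball z hz).2.le (abs_nonneg _)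

end Measure

theorem differentiableOn_intervalIntegral_of_norm_le {F : ℂ → ℝ → E} {U : Set ℂ} {c : ℂ → ℝ}
    {a b : ℝ} (hU : IsOpen U) (hc : ContinuousOn c U)
    (hd : ∀ t ∈ Ι a b, DifferentiableOn ℂ (F · t) U)
    (hm : ∀ z ∈ U, IntervalIntegrable (F z) volume a b)
    (hb : ∀ t ∈ Ι a b, ∀ z ∈ U, ‖F z t‖ ≤ c z) :
    DifferentiableOn ℂ (fun z => ∫ t in a..b, F z t) U := by
  intro z hz
  simp only [intervalIntegral.intervalIntegral_eq_integral_uIoc]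
  refine ((hasDerivAt_integral_of_locally_dominated hU hc (b := fun _ => 1) ?_
    (ae_restrict_of_forall_mem measurableSet_uIoc hd)
    (fun z hz => (hm z hz).def'.aestronglyMeasurable)
    (ae_restrict_of_forall_mem measurableSet_uIoc fun t ht z hz => ?_)
    hz).2.differentiableAt.const_smul _).differentiableWithinAt
  · exact integrableOn_const (by simp [uIoc])
  · rw [mul_one]
    exact hb t ht z hz

theorem differentiableAt_circleIntegral_of_norm_le {F : ℂ → ℂ → E} {c t₀ : ℂ} {R r M : ℝ}
    (hR : 0 ≤ R) (hr : 0 < r)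
    (hd : ∀ z ∈ sphere c R, DifferentiableOn ℂ (F · z) (ball t₀ r))
    (hc : ∀ t ∈ ball t₀ r, ContinuousOn (F t) (sphere c R))
    (hb : ∀ t ∈ ball t₀ r, ∀ z ∈ sphere c R, ‖F t z‖ ≤ M) :
    DifferentiableAt ℂ (fun t => ∮ z in C(c, R), F t z) t₀ := by
  have hmem := circleMap_mem_sphere c hR
  refine (differentiableOn_intervalIntegral_of_norm_le isOpen_ball (c := fun _ => R * M)
    continuousOn_const (fun θ _ => (hd _ (hmem θ)).const_smul _) (fun t ht => ?_)
    fun θ _ t ht => ?_).differentiableAt (ball_mem_nhds t₀ hr)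
  · exact ((hc t ht).circleIntegrable hR).out
  · rw [Pi.smul_apply, norm_smul, deriv_circleMap, norm_mul, Complex.norm_I, mul_one,
      norm_circleMap_zero, abs_of_nonneg hR]
    exact mul_le_mul_of_nonneg_left (hb t ht _ (hmem θ)) hR

end ParametricIntegral

section MovingPoint

variable {E : Type*} [NormedAddCommGroup E] [NormedSpace ℂ E]
  {F : ℂ → ℂ → E} {ψ : ℂ → ℂ} {t₀ : ℂ} {d r M : ℝ}

theorem differentiableAt_cauchyKernel_integral (hd : 0 < d) (hr : 0 < r)
    (hF₁ : ∀ z ∈ sphere (ψ t₀) r, DifferentiableOn ℂ (F · z) (ball t₀ d))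
    (hF₂ : ∀ t ∈ ball t₀ d, ContinuousOn (F t) (sphere (ψ t₀) r))
    (hM : ∀ t ∈ ball t₀ d, ∀ z ∈ sphere (ψ t₀) r, ‖F t z‖ ≤ M)
    (hψ : DifferentiableOn ℂ ψ (ball t₀ d))
    (hψr : MapsTo ψ (ball t₀ d) (ball (ψ t₀) (r / 2))) (n : ℕ) :
    DifferentiableAt ℂ (fun t => ∮ z in C(ψ t₀, r), ((z - ψ t) ^ n)⁻¹ • F t z) t₀ := by
  have hfar : ∀ t ∈ ball t₀ d, ∀ z ∈ sphere (ψ t₀) r, r / 2 ≤ ‖z - ψ t‖ := fun t ht z hz => by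
    have hψt := hψr ht
    rw [mem_ball, dist_comm] at hψt
    rw [mem_sphere] at hz
    rw [← dist_eq_norm]
    linarith [dist_triangle_right z (ψ t₀) (ψ t)]
  have hne : ∀ t ∈ ball t₀ d, ∀ z ∈ sphere (ψ t₀) r, (z - ψ t) ^ n ≠ 0 := fun t ht z hz =>
    pow_ne_zero n (norm_pos_iff.1 ((half_pos hr).trans_le (hfar t ht z hz)))
  refine differentiableAt_circleIntegral_of_norm_le (M := ((r / 2) ^ n)⁻¹ * M) hr.le hd
    (fun z hz => ?_) (fun t ht => ?_) fun t ht z hz => ?_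
  · exact (((hψ.const_sub z).fun_pow n).fun_inv fun t ht => hne t ht z hz).fun_smul (hF₁ z hz)
  · exact (((continuousOn_id.sub continuousOn_const).pow n).inv₀ (hne t ht)).smul (hF₂ t ht)
  · rw [norm_smul, norm_inv, norm_pow]
    have := hfar t ht z hz
    have := hM t ht z hz
    gcongr

theorem differentiableAt_comp_moving_point [CompleteSpace E] (hr : 0 < r)
    (hF₁ : ∀ z ∈ ball (ψ t₀) r, DifferentiableOn ℂ (F · z) (ball t₀ r))
    (hF₂ : ∀ t ∈ ball t₀ r, DifferentiableOn ℂ (F t) (ball (ψ t₀) r))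
    (hM : ∀ t ∈ ball t₀ r, ∀ z ∈ ball (ψ t₀) r, ‖F t z‖ ≤ M)
    (hψ : ∀ᶠ t in 𝓝 t₀, DifferentiableAt ℂ ψ t) :
    DifferentiableAt ℂ (fun t => F t (ψ t)) t₀ ∧
      DifferentiableAt ℂ (fun t => deriv (F t) (ψ t)) t₀ := by
  obtain ⟨d, hd, hψd⟩ := Metric.eventually_nhds_iff_ball.1
    (((hψ.and (hψ.self_of_nhds.continuousAt (ball_mem_nhds _ (by positivity : 0 < r / 2 / 2))))).and
      (ball_mem_nhds t₀ hr))
  have hclosed : closedBall (ψ t₀) (r / 2) ⊆ ball (ψ t₀) r := closedBall_subset_ball (by linarith)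
  have hsphere := sphere_subset_closedBall.trans hclosed
  have hkernel := differentiableAt_cauchyKernel_integral (F := F) hd (half_pos hr)
    (fun z hz => (hF₁ z (hsphere hz)).mono fun t ht => (hψd t ht).2)
    (fun t ht => (hF₂ t (hψd t ht).2).continuousOn.mono hsphere)
    (fun t ht z hz => hM t (hψd t ht).2 z (hsphere hz))
    (fun t ht => (hψd t ht).1.1.differentiableWithinAt) (fun t ht => (hψd t ht).1.2)
  have hmem : ∀ t ∈ ball t₀ d, ψ t ∈ ball (ψ t₀) (r / 2) := fun t ht =>
    ball_subset_ball (by linarith) (hψd t ht).1.2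
  constructor
  · refine ((hkernel 1).const_smul (2 * Real.pi * Complex.I : ℂ)⁻¹).congr_of_eventuallyEq ?_
    filter_upwards [ball_mem_nhds t₀ hd] with t ht
    simpa only [pow_one, Pi.smul_apply] using (((hF₂ t (hψd t ht).2).diffContOnCl_ball
      hclosed).two_pi_i_inv_smul_circleIntegral_sub_inv_smul (hmem t ht)).symm
  · refine ((hkernel 2).const_smul (2 * Real.pi * Complex.I : ℂ)⁻¹).congr_of_eventuallyEq ?_
    filter_upwards [ball_mem_nhds t₀ hd] with t ht
    exact (Complex.two_pi_I_inv_smul_circleIntegral_sub_sq_inv_smul_of_differentiable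
      isOpen_ball hclosed (hF₂ t (hψd t ht).2) (hmem t ht)).symm

end MovingPoint

section RadialPrimitive

/-- The primitive of `F` vanishing at the origin, as an integral along the segment from `0`. -/
noncomputable def radialPrimitive (F : ℂ → ℂ) (z : ℂ) : ℂ := z * ∫ t in (0 : ℝ)..1, F (t * z)

@[simp]
theorem radialPrimitive_zero (F : ℂ → ℂ) : radialPrimitive F 0 = 0 := zero_mul _

theorem ofReal_mul_mem_ball {R t : ℝ} {z : ℂ} (hz : z ∈ ball (0 : ℂ) R) (ht : t ∈ Icc (0 : ℝ) 1) :
    (t : ℂ) * z ∈ ball (0 : ℂ) R := by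
  rw [← Complex.real_smul]
  exact (convex_ball 0 R).starConvex (mem_ball_self (pos_of_mem_ball hz)) |>.smul_mem hz ht.1 ht.2

theorem hasDerivAt_radialPrimitive {R : ℝ} {F : ℂ → ℂ} (hF : DifferentiableOn ℂ F (ball 0 R))
    {z : ℂ} (hz : z ∈ ball (0 : ℂ) R) : HasDerivAt (radialPrimitive F) (F z) z := by
  obtain ⟨G, hG₀, hG⟩ := hF.isExactOn_ball.with_val_at 0 0
  refine (hG z hz).congr_of_eventuallyEq ?_
  filter_upwards [isOpen_ball.mem_nhds hz] with y hy
  have hmem : ∀ t ∈ uIcc (0 : ℝ) 1, (t : ℂ) * y ∈ ball (0 : ℂ) R := fun t ht =>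
    ofReal_mul_mem_ball hy (by rwa [uIcc_of_le zero_le_one] at ht)
  have hray : ∀ t ∈ uIcc (0 : ℝ) 1, HasDerivAt (fun t : ℝ => G (t * y)) (y * F (t * y)) t :=
    fun t ht => (hG _ (hmem t ht)).scomp t
      (by simpa using (Complex.ofRealCLM.hasDerivAt (x := t)).mul_const y)
  have hcont : ContinuousOn (fun t : ℝ => y * F (t * y)) (uIcc 0 1) :=
    continuousOn_const.mul (hF.continuousOn.comp (by fun_prop) hmem)
  rw [radialPrimitive, ← intervalIntegral.integral_const_mul,
    intervalIntegral.integral_eq_sub_of_hasDerivAt hray hcont.intervalIntegrable]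
  simp [hG₀]

theorem differentiableOn_radialPrimitive_param {F : ℂ → ℂ → ℂ} {U : Set ℂ} {c : ℂ → ℝ} {R : ℝ}
    {z : ℂ} (hU : IsOpen U) (hc : ContinuousOn c U)
    (hF₁ : ∀ k ∈ U, ContinuousOn (F k) (ball 0 R))
    (hF₂ : ∀ y ∈ ball 0 R, DifferentiableOn ℂ (F · y) U)
    (hb : ∀ k ∈ U, ∀ y ∈ ball 0 R, ‖F k y‖ ≤ c k) (hz : z ∈ ball (0 : ℂ) R) :
    DifferentiableOn ℂ (fun k => radialPrimitive (F k) z) U := by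
  have hmem : ∀ t ∈ Ι (0 : ℝ) 1, (t : ℂ) * z ∈ ball (0 : ℂ) R := fun t ht =>
    ofReal_mul_mem_ball hz (Ioc_subset_Icc_self (by rwa [uIoc_of_le zero_le_one] at ht))
  refine (differentiableOn_intervalIntegral_of_norm_le hU hc (fun t ht => hF₂ _ (hmem t ht))
    (fun k hk => ContinuousOn.intervalIntegrable ?_)
    fun t ht k hk => hb k hk _ (hmem t ht)).const_mul z
  refine (hF₁ k hk).comp (by fun_prop) fun t ht => ofReal_mul_mem_ball hz ?_
  rwa [uIcc_of_le zero_le_one] at ht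

theorem norm_radialPrimitive_le {F : ℂ → ℂ} {z : ℂ} {A : ℝ} {m : ℕ}
    (hF : ∀ y, ‖y‖ ≤ ‖z‖ → ‖F y‖ ≤ A * (‖y‖ ^ m / m.factorial)) :
    ‖radialPrimitive F z‖ ≤ A * (‖z‖ ^ (m + 1) / (m + 1).factorial) := by
  have hint : ‖∫ t in (0 : ℝ)..1, F (t * z)‖ ≤
      ∫ t in (0 : ℝ)..1, t ^ m * (A * (‖z‖ ^ m / m.factorial)) := by
    refine intervalIntegral.norm_integral_le_of_norm_le zero_le_one
      (Eventually.of_forall fun t ht => ?_) (Continuous.intervalIntegrable (by fun_prop) _ _)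
    have hn : ‖(t : ℂ) * z‖ = t * ‖z‖ := by
      rw [norm_mul, Complex.norm_real, Real.norm_eq_abs, abs_of_pos ht.1]
    refine (hF _ (hn.trans_le (mul_le_of_le_one_left (norm_nonneg z) ht.2))).trans_eq ?_
    rw [hn]
    ring
  rw [intervalIntegral.integral_mul_const, integral_pow] at hint
  rw [radialPrimitive, norm_mul]
  refine (mul_le_mul_of_nonneg_left hint (norm_nonneg z)).trans_eq ?_
  rw [Nat.factorial_succ]
  push_cast
  simp only [one_pow, zero_pow m.succ_ne_zero, sub_zero]
  field_simp
  ring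

end RadialPrimitive

/-- A family of entire functions depending holomorphically on a parameter: `F k z` is holomorphic
in `k` and in `z` and bounded on bounded sets. By Osgood's lemma this is joint holomorphy; separate
holomorphy is what integrals and series hand us directly. -/
structure IsEntireFamily (F : ℂ → ℂ → ℂ) : Prop where
  differentiable : ∀ k, Differentiable ℂ (F k)
  differentiable_param : ∀ z, Differentiable ℂ (F · z)
  bounded : ∀ r : ℝ, ∃ M : ℝ, ∀ k z, ‖k‖ ≤ r → ‖z‖ ≤ r → ‖F k z‖ ≤ M

namespace IsEntireFamily

variable {F G : ℂ → ℂ → ℂ}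

theorem of_uncurry (hF : Differentiable ℂ fun p : ℂ × ℂ => F p.1 p.2) : IsEntireFamily F where
  differentiable k := hF.comp ((differentiable_const k).prodMk differentiable_id)
  differentiable_param z := hF.comp (differentiable_id.prodMk (differentiable_const z))
  bounded r := by
    obtain ⟨M, hM⟩ := ((isCompact_closedBall (0 : ℂ) r).prod
      (isCompact_closedBall (0 : ℂ) r)).exists_bound_of_continuousOn hF.continuous.continuousOn
    exact ⟨M, fun k z hk hz => hM (k, z) ⟨by simpa using hk, by simpa using hz⟩⟩

theorem bounded_nonneg (hF : IsEntireFamily F) (r : ℝ) :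
    ∃ M, 0 ≤ M ∧ ∀ k z, ‖k‖ ≤ r → ‖z‖ ≤ r → ‖F k z‖ ≤ M := by
  obtain ⟨M, hM⟩ := hF.bounded r
  exact ⟨|M|, abs_nonneg M, fun k z hk hz => (hM k z hk hz).trans (le_abs_self M)⟩

theorem neg (hF : IsEntireFamily F) : IsEntireFamily fun k z => -F k z where
  differentiable k := (hF.differentiable k).fun_neg
  differentiable_param z := (hF.differentiable_param z).fun_neg
  bounded r := by simpa only [norm_neg] using hF.bounded r

theorem mul (hF : IsEntireFamily F) (hG : IsEntireFamily G) :
    IsEntireFamily fun k z => F k z * G k z where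
  differentiable k := (hF.differentiable k).fun_mul (hG.differentiable k)
  differentiable_param z := (hF.differentiable_param z).fun_mul (hG.differentiable_param z)
  bounded r := by
    obtain ⟨M, hM₀, hM⟩ := hF.bounded_nonneg r
    obtain ⟨N, hN⟩ := hG.bounded r
    exact ⟨M * N, fun k z hk hz => (norm_mul _ _).trans_le
      (mul_le_mul (hM k z hk hz) (hN k z hk hz) (norm_nonneg _) hM₀)⟩

theorem hasDerivAt_radialPrimitive (hF : IsEntireFamily F) (k z : ℂ) :
    HasDerivAt (radialPrimitive (F k)) (F k z) z :=
  TwoCenters.hasDerivAt_radialPrimitive (R := ‖z‖ + 1) (hF.differentiable k).differentiableOn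
    (by simp)

theorem radialPrimitive (hF : IsEntireFamily F) :
    IsEntireFamily fun k => radialPrimitive (F k) where
  differentiable k z := (hF.hasDerivAt_radialPrimitive k z).differentiableAt
  differentiable_param z k₀ := by
    obtain ⟨M, hM⟩ := hF.bounded (‖k₀‖ + ‖z‖ + 1)
    refine (differentiableOn_radialPrimitive_param (R := ‖z‖ + 1) (c := fun _ => M) isOpen_ball
      continuousOn_const (fun k _ => (hF.differentiable k).continuous.continuousOn)
      (fun y _ => (hF.differentiable_param y).differentiableOn) (fun k hk y hy => hM k y ?_ ?_)
      (by simp)).differentiableAt (ball_mem_nhds k₀ one_pos)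
    · rw [mem_ball_iff_norm] at hk
      linarith [norm_le_norm_add_norm_sub' k k₀, norm_nonneg z]
    · rw [mem_ball_zero_iff] at hy
      linarith [norm_nonneg k₀]
  bounded r := by
    obtain ⟨M, hM₀, hM⟩ := hF.bounded_nonneg r
    refine ⟨M * r, fun k z hk hz => (norm_radialPrimitive_le (A := M) (m := 0) fun y hy => ?_).trans
      ?_⟩
    · simpa using hM k y hk (hy.trans hz)
    · simpa using mul_le_mul_of_nonneg_left hz hM₀

theorem tsum {f : ℕ → ℂ → ℂ → ℂ} (hf : ∀ n, IsEntireFamily (f n))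
    (hb : ∀ r : ℝ, ∃ u : ℕ → ℝ, Summable u ∧
      ∀ n k z, ‖k‖ ≤ r → ‖z‖ ≤ r → ‖f n k z‖ ≤ u n) :
    IsEntireFamily fun k z => ∑' n, f n k z where
  differentiable k z := by
    obtain ⟨u, hu, hfu⟩ := hb (‖k‖ + ‖z‖ + 1)
    refine (Complex.differentiableOn_tsum_of_summable_norm hu
      (fun n => ((hf n).differentiable k).differentiableOn) (isOpen_ball (x := 0))
      fun n y hy => hfu n k y ?_ (mem_ball_zero_iff.1 hy).le).differentiableAt
        (isOpen_ball.mem_nhds ?_)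
    · linarith [norm_nonneg z]
    · rw [mem_ball_zero_iff]
      linarith [norm_nonneg k]
  differentiable_param z k := by
    obtain ⟨u, hu, hfu⟩ := hb (‖k‖ + ‖z‖ + 1)
    refine (Complex.differentiableOn_tsum_of_summable_norm hu
      (fun n => ((hf n).differentiable_param z).differentiableOn) (isOpen_ball (x := 0))
      fun n y hy => hfu n y z (mem_ball_zero_iff.1 hy).le ?_).differentiableAt
        (isOpen_ball.mem_nhds ?_)
    · linarith [norm_nonneg k]
    · rw [mem_ball_zero_iff]
      linarith [norm_nonneg z]
  bounded r := by
    obtain ⟨u, hu, hfu⟩ := hb r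
    exact ⟨∑' n, u n, fun k z hk hz => tsum_of_norm_bounded hu.hasSum fun n => hfu n k z hk hz⟩

theorem differentiableAt_comp {φ ψ : ℂ → ℂ} (hF : IsEntireFamily F) (hφ : Differentiable ℂ φ)
    (hψ : Differentiable ℂ ψ) (κ₀ : ℂ) :
    DifferentiableAt ℂ (fun κ => F (φ κ) (ψ κ)) κ₀ ∧
      DifferentiableAt ℂ (fun κ => deriv (F (φ κ)) (ψ κ)) κ₀ := by
  obtain ⟨r, hr⟩ := (isCompact_closedBall κ₀ 1).exists_bound_of_continuousOn
    hφ.continuous.continuousOn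
  obtain ⟨M, hM⟩ := hF.bounded (max r (‖ψ κ₀‖ + 1))
  refine differentiableAt_comp_moving_point (F := fun κ => F (φ κ)) one_pos
    (fun z _ => ((hF.differentiable_param z).comp hφ).differentiableOn)
    (fun κ _ => (hF.differentiable (φ κ)).differentiableOn)
    (fun κ hκ z hz => hM _ _ ((hr κ (ball_subset_closedBall hκ)).trans (le_max_left _ _))
      (le_max_of_le_right ?_)) (.of_forall fun κ => hψ κ)
  exact (norm_le_norm_add_norm_sub' z (ψ κ₀)).trans
    (add_le_add_right (mem_ball_iff_norm.1 hz).le _)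

end IsEntireFamily

theorem hasSum_deriv_deriv_of_summable_norm {ι E : Type*} [NormedAddCommGroup E] [NormedSpace ℂ E]
    [CompleteSpace E] {F : ι → ℂ → E} {U : Set ℂ} {u : ι → ℝ}
    (hu : Summable u) (hF : ∀ n, DifferentiableOn ℂ (F n) U) (hU : IsOpen U)
    (hb : ∀ n, ∀ z ∈ U, ‖F n z‖ ≤ u n) {z : ℂ} (hz : z ∈ U) :
    HasSum (fun n => deriv (deriv (F n)) z) (deriv (deriv fun w => ∑' n, F n w) z) := by
  have hsum : ∀ s : Finset ι, DifferentiableOn ℂ (fun w => ∑ n ∈ s, F n w) U :=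
    fun s => DifferentiableOn.fun_sum fun n _ => hF n
  have hlim := ((tendstoUniformlyOn_tsum hu hb).tendstoLocallyUniformlyOn.deriv
    (Eventually.of_forall hsum) hU).deriv (Eventually.of_forall fun s => (hsum s).deriv hU) hU
  refine (hlim.tendsto_at hz).congr fun s => ?_
  have hderiv : deriv (fun w => ∑ n ∈ s, F n w) =ᶠ[𝓝 z] fun y => ∑ n ∈ s, deriv (F n) y :=
    eventually_of_mem (hU.mem_nhds hz) fun y hy =>
      deriv_fun_sum fun n _ => (hF n).differentiableAt (hU.mem_nhds hy)
  exact hderiv.deriv_eq.trans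
    (deriv_fun_sum fun n _ => ((hF n).deriv hU).differentiableAt (hU.mem_nhds hz))

section Picard

/-- The Picard iterates for the initial value problem `v'' = -q v`, `v(0) = a`, `v'(0) = b`; the
sum of all of them solves it. -/
noncomputable def picardTerm (q : ℂ → ℂ → ℂ) (a b : ℂ) : ℕ → ℂ → ℂ → ℂ
  | 0, _ => fun z => a + b * z
  | n + 1, k => fun z =>
      -radialPrimitive (radialPrimitive fun y => q k y * picardTerm q a b n k y) z

variable {q : ℂ → ℂ → ℂ} {a b : ℂ}

theorem isEntireFamily_picardTerm (hq : IsEntireFamily q) :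
    ∀ n, IsEntireFamily (picardTerm q a b n)
  | 0 => .of_uncurry (by unfold picardTerm; fun_prop)
  | n + 1 => (hq.mul (isEntireFamily_picardTerm hq n)).radialPrimitive.radialPrimitive.neg

theorem deriv_picardTerm_zero (k z : ℂ) : deriv (picardTerm q a b 0 k) z = b := by
  simp [picardTerm]

theorem deriv_picardTerm_succ (hq : IsEntireFamily q) (n : ℕ) (k : ℂ) :
    deriv (picardTerm q a b (n + 1) k) =
      fun z => -radialPrimitive (fun y => q k y * picardTerm q a b n k y) z :=
  funext fun z => ((hq.mul (isEntireFamily_picardTerm hq n)).radialPrimitive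
    |>.hasDerivAt_radialPrimitive k z).neg.deriv

theorem deriv_deriv_picardTerm_succ (hq : IsEntireFamily q) (n : ℕ) (k z : ℂ) :
    deriv (deriv (picardTerm q a b (n + 1) k)) z = -(q k z * picardTerm q a b n k z) := by
  rw [deriv_picardTerm_succ hq]
  exact ((hq.mul (isEntireFamily_picardTerm hq n)).hasDerivAt_radialPrimitive k z).neg.deriv

theorem norm_picardTerm_le {r A N : ℝ} {k : ℂ} (hA : ∀ z, ‖z‖ ≤ r → ‖a + b * z‖ ≤ A) (hN₀ : 0 ≤ N)
    (hN : ∀ z, ‖z‖ ≤ r → ‖q k z‖ ≤ N) (n : ℕ) {z : ℂ} (hz : ‖z‖ ≤ r) :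
    ‖picardTerm q a b n k z‖ ≤ A * N ^ n * (‖z‖ ^ (2 * n) / (2 * n).factorial) := by
  induction n generalizing z with
  | zero => simpa [picardTerm] using hA z hz
  | succ n ih =>
    rw [picardTerm, norm_neg]
    refine norm_radialPrimitive_le fun y hy => norm_radialPrimitive_le fun x hx => ?_
    have hxr : ‖x‖ ≤ r := hx.trans (hy.trans hz)
    calc ‖q k x * picardTerm q a b n k x‖
        ≤ N * (A * N ^ n * (‖x‖ ^ (2 * n) / (2 * n).factorial)) :=
          (norm_mul _ _).trans_le (mul_le_mul (hN x hxr) (ih hxr) (norm_nonneg _) hN₀)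
      _ = A * N ^ (n + 1) * (‖x‖ ^ (2 * n) / (2 * n).factorial) := by ring

theorem summable_mul_pow_div_factorial_two_mul (A r : ℝ) {N : ℝ} (hN : 0 ≤ N) :
    Summable fun n : ℕ => A * N ^ n * (r ^ (2 * n) / (2 * n).factorial) := by
  have hexp := (Real.summable_pow_div_factorial (√N * r)).comp_injective
    (mul_right_injective₀ (two_ne_zero' ℕ))
  refine (hexp.mul_left A).congr fun n => ?_
  simp only [Function.comp, mul_pow, pow_mul, Real.sq_sqrt hN]
  ring

theorem exists_summable_bound_picardTerm (hq : IsEntireFamily q) (r : ℝ) :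
    ∃ u : ℕ → ℝ, Summable u ∧ ∀ n k z, ‖k‖ ≤ r → ‖z‖ ≤ r → ‖picardTerm q a b n k z‖ ≤ u n := by
  obtain ⟨N, hN₀, hN⟩ := hq.bounded_nonneg r
  obtain ⟨A, hA₀, hA⟩ :=
    (isEntireFamily_picardTerm (a := a) (b := b) hq 0).bounded_nonneg r
  refine ⟨_, summable_mul_pow_div_factorial_two_mul A r hN₀, fun n k z hk hz => ?_⟩
  refine (norm_picardTerm_le (fun y hy => hA k y hk hy) hN₀ (fun y hy => hN k y hk hy) n hz).trans
    ?_
  gcongr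

/-- The solution of `v'' = -q v`, `v(0) = a`, `v'(0) = b`. -/
noncomputable def picardSum (q : ℂ → ℂ → ℂ) (a b k z : ℂ) : ℂ := ∑' n, picardTerm q a b n k z

theorem isEntireFamily_picardSum (hq : IsEntireFamily q) (a b : ℂ) :
    IsEntireFamily (picardSum q a b) :=
  .tsum (isEntireFamily_picardTerm hq) (exists_summable_bound_picardTerm hq)

theorem picardSum_zero (k : ℂ) : picardSum q a b k 0 = a := by
  rw [picardSum, tsum_eq_single 0]
  · simp [picardTerm]
  · rintro (_ | n) hn
    · exact absurd rfl hn
    · simp [picardTerm]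

theorem deriv_picardSum_zero (hq : IsEntireFamily q) (k : ℂ) : deriv (picardSum q a b k) 0 = b := by
  obtain ⟨u, hu, hb⟩ := exists_summable_bound_picardTerm (a := a) (b := b) hq (‖k‖ + 1)
  have hsum := Complex.hasSum_deriv_of_summable_norm hu
    (fun n => ((isEntireFamily_picardTerm hq n).differentiable k).differentiableOn)
    (isOpen_ball (x := 0) (ε := 1)) (fun n y hy => hb n k y (by linarith)
      ((mem_ball_zero_iff.1 hy).le.trans (by linarith [norm_nonneg k]))) (mem_ball_self one_pos)
  refine hsum.unique ?_
  convert hasSum_single 0 fun n hn => ?_ using 1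
  · exact (deriv_picardTerm_zero k 0).symm
  · obtain ⟨m, rfl⟩ := Nat.exists_eq_succ_of_ne_zero hn
    simp only [deriv_picardTerm_succ hq, radialPrimitive_zero, neg_zero]

theorem deriv_deriv_picardSum (hq : IsEntireFamily q) (k z : ℂ) :
    deriv (deriv (picardSum q a b k)) z = -(q k z * picardSum q a b k z) := by
  obtain ⟨u, hu, hb⟩ := exists_summable_bound_picardTerm (a := a) (b := b) hq (‖k‖ + ‖z‖ + 1)
  have hz : z ∈ ball (0 : ℂ) (‖k‖ + ‖z‖ + 1) := by
    rw [mem_ball_zero_iff]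
    linarith [norm_nonneg k]
  have hk : ‖k‖ ≤ ‖k‖ + ‖z‖ + 1 := by linarith [norm_nonneg z]
  have hderiv := hasSum_deriv_deriv_of_summable_norm hu
    (fun n => ((isEntireFamily_picardTerm hq n).differentiable k).differentiableOn) isOpen_ball
    (fun n y hy => hb n k y hk (mem_ball_zero_iff.1 hy).le) hz
  have hsum : HasSum (fun n => picardTerm q a b n k z) (picardSum q a b k z) :=
    (hu.of_norm_bounded fun n => hb n k z hk (mem_ball_zero_iff.1 hz).le).hasSum
  have htail : HasSum (fun n => deriv (deriv (picardTerm q a b (n + 1) k)) z)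
      (-(q k z * picardSum q a b k z)) :=
    (hsum.mul_left (q k z)).neg.congr_fun fun n => deriv_deriv_picardTerm_succ hq n k z
  have hzero : deriv (deriv (picardTerm q a b 0 k)) z = 0 := by
    rw [funext (deriv_picardTerm_zero k), deriv_const]
  have hall := (hasSum_nat_add_iff (f := fun n => deriv (deriv (picardTerm q a b n k)) z) 1).1 htail
  rw [Finset.sum_range_one, hzero, add_zero] at hall
  exact hderiv.unique hall

end Picard

/-! ### Volterra series above a wedge -/

/-- The height `Im z + |Re z|`, which grows at unit speed in the upward direction. -/
def height (z : ℂ) : ℝ := z.im + |z.re|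

/-- The region above the wedge `Im z = R - |Re z|`. It is stable under upward translations and
contains the far part of every ray `arg z = θ` with `-π/4 < θ < 5π/4`. -/
def aboveWedge (R : ℝ) : Set ℂ := {z | R < height z}

theorem continuous_height : Continuous height := by unfold height; fun_prop

theorem isOpen_aboveWedge (R : ℝ) : IsOpen (aboveWedge R) :=
  isOpen_lt continuous_const continuous_height

theorem height_add_mul_I (z : ℂ) (s : ℝ) : height (z + s * Complex.I) = height z + s := by
  simp [height]
  ring

theorem add_mul_I_mem_aboveWedge {R : ℝ} {z : ℂ} (hz : z ∈ aboveWedge R) {s : ℝ} (hs : 0 ≤ s) :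
    z + s * Complex.I ∈ aboveWedge R := by
  change R < height _
  rw [height_add_mul_I]
  exact lt_add_of_lt_of_nonneg hz hs

theorem height_le_two_mul_norm (z : ℂ) : height z ≤ 2 * ‖z‖ := by
  unfold height
  linarith [Complex.abs_re_le_norm z, Complex.im_le_norm z]

theorem ne_zero_of_height_pos {z : ℂ} (hz : 0 < height z) : z ≠ 0 := by
  rintro rfl
  simp [height] at hz

section UpwardIntegral

/-- The integral of `G` along the vertical half-line from `z` to `z + i∞`. -/
noncomputable def upwardIntegral (G : ℂ → ℂ) (z : ℂ) : ℂ :=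
  Complex.I * ∫ s in Ioi (0 : ℝ), G (z + s * Complex.I)

theorem hasDerivAt_add_ofReal_mul_I (z : ℂ) (s : ℝ) :
    HasDerivAt (fun s : ℝ => z + s * Complex.I) Complex.I s := by
  simpa using ((Complex.ofRealCLM.hasDerivAt (x := s)).mul_const Complex.I).const_add z

theorem hasDerivAt_upwardIntegral {U : Set ℂ} (hU : IsOpen U)
    (hup : ∀ z ∈ U, ∀ s : ℝ, 0 ≤ s → z + s * Complex.I ∈ U) {G : ℂ → ℂ}
    (hG : DifferentiableOn ℂ G U) {c : ℂ → ℝ} (hc : ContinuousOn c U) {b : ℝ → ℝ}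
    (hb : IntegrableOn b (Ioi 0)) (hb₀ : Tendsto b atTop (𝓝 0))
    (hbound : ∀ z ∈ U, ∀ s : ℝ, 0 ≤ s → ‖G (z + s * Complex.I)‖ ≤ c z * b s) {z : ℂ} (hz : z ∈ U) :
    HasDerivAt (upwardIntegral G) (-G z) z := by
  have hGat : ∀ {y}, y ∈ U → ∀ {s : ℝ}, 0 ≤ s →
      HasDerivAt G (deriv G (y + s * Complex.I)) (y + s * Complex.I) := fun hy _ hs =>
    (hG.differentiableAt (hU.mem_nhds (hup _ hy _ hs))).hasDerivAt
  have hcont : ∀ y ∈ U, ContinuousOn (fun s : ℝ => G (y + s * Complex.I)) (Ici 0) :=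
    fun y hy => hG.continuousOn.comp (by fun_prop) fun s hs => hup y hy s hs
  obtain ⟨hint, hderiv⟩ := hasDerivAt_integral_of_locally_dominated
    (ν := volume.restrict (Ioi (0 : ℝ))) (F := fun y s => G (y + s * Complex.I)) hU hc hb
    (ae_restrict_of_forall_mem measurableSet_Ioi fun s hs y hy =>
      ((hGat hy (le_of_lt hs)).comp_add_const y _).differentiableAt.differentiableWithinAt)
    (fun y hy => ((hcont y hy).mono Ioi_subset_Ici_self).aestronglyMeasurable measurableSet_Ioi)
    (ae_restrict_of_forall_mem measurableSet_Ioi fun s hs y hy => hbound y hy s (le_of_lt hs)) hz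
  refine (hderiv.const_mul Complex.I).congr_deriv ?_
  rw [← integral_const_mul]
  have hpath : ∀ s ∈ Ioi (0 : ℝ), HasDerivAt (fun s : ℝ => G (z + s * Complex.I))
      (Complex.I * deriv (fun y => G (y + s * Complex.I)) z) s := fun s hs => by
    rw [((hGat hz (le_of_lt hs)).comp_add_const z _).deriv]
    exact (hGat hz (le_of_lt hs)).scomp s (hasDerivAt_add_ofReal_mul_I z s)
  have hlim : Tendsto (fun s : ℝ => G (z + s * Complex.I)) atTop (𝓝 0) := by
    refine squeeze_zero_norm' (a := fun s => c z * b s) ?_ (by simpa using hb₀.const_mul (c z))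
    exact (eventually_ge_atTop 0).mono fun s hs => hbound z hz s hs
  rw [integral_Ioi_of_hasDerivAt_of_tendsto (hcont z hz 0 self_mem_Ici) hpath
    (hint.const_mul _) hlim]
  simp

theorem norm_upwardIntegral_le {G : ℂ → ℂ} {z : ℂ} {b : ℝ → ℝ} {c : ℝ}
    (hb : IntegrableOn b (Ioi 0)) (h : ∀ s : ℝ, 0 ≤ s → ‖G (z + s * Complex.I)‖ ≤ c * b s) :
    ‖upwardIntegral G z‖ ≤ c * ∫ s in Ioi (0 : ℝ), b s := by
  rw [upwardIntegral, norm_mul, Complex.norm_I, one_mul, ← integral_const_mul]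
  exact norm_integral_le_of_norm_le (hb.const_mul c)
    (ae_restrict_of_forall_mem measurableSet_Ioi fun s hs => h s (le_of_lt hs))

theorem differentiableOn_upwardIntegral_param {K : Set ℂ} (hK : IsOpen K) {F : ℂ → ℂ → ℂ} {z : ℂ}
    {c : ℂ → ℝ} (hc : ContinuousOn c K) {b : ℝ → ℝ} (hb : IntegrableOn b (Ioi 0))
    (hF₁ : ∀ κ ∈ K, ContinuousOn (fun s : ℝ => F κ (z + s * Complex.I)) (Ioi 0))
    (hF₂ : ∀ s : ℝ, 0 ≤ s → DifferentiableOn ℂ (fun κ => F κ (z + s * Complex.I)) K)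
    (hbound : ∀ κ ∈ K, ∀ s : ℝ, 0 ≤ s → ‖F κ (z + s * Complex.I)‖ ≤ c κ * b s) :
    DifferentiableOn ℂ (fun κ => upwardIntegral (F κ) z) K := fun _ hκ₀ =>
  ((hasDerivAt_integral_of_locally_dominated hK hc hb
    (ae_restrict_of_forall_mem measurableSet_Ioi fun s hs => hF₂ s (le_of_lt hs))
    (fun κ hκ => (hF₁ κ hκ).aestronglyMeasurable measurableSet_Ioi)
    (ae_restrict_of_forall_mem measurableSet_Ioi fun s hs κ hκ => hbound κ hκ s (le_of_lt hs))
    hκ₀).2.differentiableAt.const_mul _).differentiableWithinAt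

theorem integrableOn_inv_add_sq {r : ℝ} (hr : 0 < r) :
    IntegrableOn (fun s : ℝ => ((r + s) ^ 2)⁻¹) (Ioi 0) ∧
      ∫ s in Ioi (0 : ℝ), ((r + s) ^ 2)⁻¹ = r⁻¹ := by
  have hd : ∀ s ∈ Ici (0 : ℝ), HasDerivAt (fun s : ℝ => -(r + s)⁻¹) ((r + s) ^ 2)⁻¹ s :=
    fun s hs => by
    have hne : r + s ≠ 0 := (add_pos_of_pos_of_nonneg hr hs).ne'
    refine (((hasDerivAt_id s).const_add r).inv hne).neg.congr_deriv ?_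
    simp [neg_div]
  have hlim : Tendsto (fun s : ℝ => -(r + s)⁻¹) atTop (𝓝 0) := by
    simpa using (tendsto_inv_atTop_zero.comp (tendsto_atTop_add_const_left _ r tendsto_id)).neg
  refine ⟨integrableOn_Ioi_deriv_of_nonneg' hd (fun s _ => by positivity) hlim, ?_⟩
  rw [integral_Ioi_of_hasDerivAt_of_nonneg' hd (fun s _ => by positivity) hlim]
  simp

theorem integrableOn_exp_neg_half :
    IntegrableOn (fun s : ℝ => Real.exp (-(1 / 2) * s)) (Ioi 0) :=
  integrableOn_exp_mul_Ioi (by norm_num) 0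

theorem integral_exp_neg_half : ∫ s in Ioi (0 : ℝ), Real.exp (-(1 / 2) * s) = 2 := by
  rw [integral_exp_mul_Ioi (by norm_num)]
  norm_num

end UpwardIntegral

/-- The derivative of `jostStep p V m`. -/
noncomputable def jostStepDeriv (p V m : ℂ → ℂ) (z : ℂ) : ℂ :=
  (p z)⁻¹ * upwardIntegral (fun y => p y * (V y * m y)) z

/-- The Volterra operator `m ↦ -∫_z^{z+i∞} p(y)⁻¹ ∫_y^{y+i∞} p V m`. A solution of
`m = 1 + jostStep p V m` solves `(p m')' + p V m = 0`. -/
noncomputable def jostStep (p V m : ℂ → ℂ) (z : ℂ) : ℂ := -upwardIntegral (jostStepDeriv p V m) z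

/-- The equation `(p m')' + p V m = 0` on `aboveWedge R` has a weight `p` decaying exponentially
upwards and a potential `V` small enough to make `jostStep p V` a contraction. -/
structure IsVolterraPair (R B : ℝ) (p V : ℂ → ℂ) : Prop where
  pos : 0 < R
  nonneg : 0 ≤ B
  four_mul_le : 4 * B ≤ R
  differentiableOn_weight : DifferentiableOn ℂ p (aboveWedge R)
  weight_ne_zero : ∀ z ∈ aboveWedge R, p z ≠ 0
  norm_weight_le : ∀ z ∈ aboveWedge R, ∀ s : ℝ, 0 ≤ s →
    ‖p (z + s * Complex.I)‖ ≤ ‖p z‖ * Real.exp (-(1 / 2) * s)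
  differentiableOn_potential : DifferentiableOn ℂ V (aboveWedge R)
  norm_potential_le : ∀ z ∈ aboveWedge R, ‖V z‖ ≤ B / height z ^ 2

namespace IsVolterraPair

variable {R B N : ℝ} {p V m : ℂ → ℂ} {z : ℂ}

theorem height_pos (h : IsVolterraPair R B p V) (hz : z ∈ aboveWedge R) : 0 < height z :=
  h.pos.trans hz

theorem norm_jostStepDeriv_integrand_le (h : IsVolterraPair R B p V)
    (hmN : ∀ z ∈ aboveWedge R, ‖m z‖ ≤ N) (hz : z ∈ aboveWedge R) {s : ℝ} (hs : 0 ≤ s) :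
    ‖p (z + s * Complex.I) * (V (z + s * Complex.I) * m (z + s * Complex.I))‖ ≤
      ‖p z‖ * (B * N / height z ^ 2) * Real.exp (-(1 / 2) * s) := by
  have hzs := add_mul_I_mem_aboveWedge hz hs
  have hpos := h.height_pos hz
  have hB := h.nonneg
  have hV : ‖V (z + s * Complex.I)‖ ≤ B / height z ^ 2 := by
    refine (h.norm_potential_le _ hzs).trans ?_
    rw [height_add_mul_I]
    gcongr
    exact le_add_of_nonneg_right hs
  rw [norm_mul, norm_mul]
  calc ‖p (z + s * Complex.I)‖ * (‖V (z + s * Complex.I)‖ * ‖m (z + s * Complex.I)‖)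
      ≤ ‖p z‖ * Real.exp (-(1 / 2) * s) * (B / height z ^ 2 * N) := by
        gcongr
        exacts [h.norm_weight_le z hz s hs, hmN _ hzs]
    _ = ‖p z‖ * (B * N / height z ^ 2) * Real.exp (-(1 / 2) * s) := by ring

theorem hasDerivAt_jostStepDeriv (h : IsVolterraPair R B p V)
    (hm : DifferentiableOn ℂ m (aboveWedge R)) (hmN : ∀ z ∈ aboveWedge R, ‖m z‖ ≤ N)
    (hz : z ∈ aboveWedge R) :
    HasDerivAt (jostStepDeriv p V m)
      (-(deriv p z / p z) * jostStepDeriv p V m z - V z * m z) z := by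
  have hp := (h.differentiableOn_weight.differentiableAt
    ((isOpen_aboveWedge R).mem_nhds hz)).hasDerivAt
  have hint := hasDerivAt_upwardIntegral (G := fun y => p y * (V y * m y)) (isOpen_aboveWedge R)
    (fun _ hy _ hs => add_mul_I_mem_aboveWedge hy hs)
    (h.differentiableOn_weight.mul (h.differentiableOn_potential.mul hm))
    (c := fun z => ‖p z‖ * (B * N / height z ^ 2))
    (h.differentiableOn_weight.continuousOn.norm.mul (continuousOn_const.div
      (continuous_height.continuousOn.pow 2) fun y hy => (pow_pos (h.height_pos hy) 2).ne'))
    integrableOn_exp_neg_half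
    (Real.tendsto_exp_atBot.comp (tendsto_id.const_mul_atTop_of_neg (by norm_num)))
    (fun y hy s hs => h.norm_jostStepDeriv_integrand_le hmN hy hs) hz
  have hne := h.weight_ne_zero z hz
  refine ((hp.fun_inv hne).fun_mul hint).congr_deriv ?_
  simp only [jostStepDeriv]
  field_simp
  ring

theorem norm_jostStepDeriv_le (h : IsVolterraPair R B p V) (hmN : ∀ z ∈ aboveWedge R, ‖m z‖ ≤ N)
    (hz : z ∈ aboveWedge R) : ‖jostStepDeriv p V m z‖ ≤ 2 * B * N / height z ^ 2 := by
  have hint := norm_upwardIntegral_le (z := z) (G := fun y => p y * (V y * m y))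
    integrableOn_exp_neg_half fun s hs => h.norm_jostStepDeriv_integrand_le hmN hz hs
  rw [integral_exp_neg_half] at hint
  have hne := norm_ne_zero_iff.2 (h.weight_ne_zero z hz)
  calc ‖jostStepDeriv p V m z‖ ≤ ‖p z‖⁻¹ * (‖p z‖ * (B * N / height z ^ 2) * 2) := by
        rw [jostStepDeriv, norm_mul, norm_inv]
        gcongr
    _ = 2 * B * N / height z ^ 2 := by field_simp

theorem norm_jostStepDeriv_add_mul_I_le (h : IsVolterraPair R B p V)
    (hmN : ∀ z ∈ aboveWedge R, ‖m z‖ ≤ N) (hz : z ∈ aboveWedge R) {s : ℝ} (hs : 0 ≤ s) :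
    ‖jostStepDeriv p V m (z + s * Complex.I)‖ ≤ 2 * B * N * ((height z + s) ^ 2)⁻¹ := by
  simpa only [height_add_mul_I, div_eq_mul_inv] using
    h.norm_jostStepDeriv_le hmN (add_mul_I_mem_aboveWedge hz hs)

theorem hasDerivAt_jostStep (h : IsVolterraPair R B p V)
    (hm : DifferentiableOn ℂ m (aboveWedge R)) (hN : 0 ≤ N)
    (hmN : ∀ z ∈ aboveWedge R, ‖m z‖ ≤ N) (hz : z ∈ aboveWedge R) :
    HasDerivAt (jostStep p V m) (jostStepDeriv p V m z) z := by
  have hint := hasDerivAt_upwardIntegral (isOpen_aboveWedge R)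
    (fun _ hy _ hs => add_mul_I_mem_aboveWedge hy hs)
    (fun y hy => (h.hasDerivAt_jostStepDeriv hm hmN hy).differentiableAt.differentiableWithinAt)
    (c := fun _ => 2 * B * N) continuousOn_const (integrableOn_inv_add_sq h.pos).1
    (tendsto_inv_atTop_zero.comp ((tendsto_pow_atTop two_ne_zero).comp
      (tendsto_atTop_add_const_left _ R tendsto_id)))
    (fun y hy s hs => (h.norm_jostStepDeriv_add_mul_I_le hmN hy hs).trans ?_) hz
  · exact hint.fun_neg.congr_deriv (neg_neg _)
  · have hy' : R < height y := hy
    have := h.nonneg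
    have := h.pos
    gcongr

theorem norm_jostStep_le (h : IsVolterraPair R B p V) (hmN : ∀ z ∈ aboveWedge R, ‖m z‖ ≤ N)
    (hz : z ∈ aboveWedge R) : ‖jostStep p V m z‖ ≤ 2 * B * N / height z := by
  have hint := norm_upwardIntegral_le (integrableOn_inv_add_sq (h.height_pos hz)).1
    fun s hs => h.norm_jostStepDeriv_add_mul_I_le hmN hz hs
  rwa [(integrableOn_inv_add_sq (h.height_pos hz)).2, ← norm_neg] at hint

end IsVolterraPair

/-- The terms of the Neumann series of the Volterra equation `m = 1 + jostStep p V m`. -/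
noncomputable def jostTerm (p V : ℂ → ℂ) : ℕ → ℂ → ℂ
  | 0 => fun _ => 1
  | n + 1 => jostStep p V (jostTerm p V n)

/-- The solution of `(p m')' + p V m = 0` that tends to `1` in the upward direction. -/
noncomputable def jostAmplitude (p V : ℂ → ℂ) (z : ℂ) : ℂ := ∑' n, jostTerm p V n z

namespace IsVolterraPair

section Amplitude

variable {R B : ℝ} {p V : ℂ → ℂ} {z : ℂ}

theorem differentiableOn_jostTerm_and_norm_le (h : IsVolterraPair R B p V) (n : ℕ) :
    DifferentiableOn ℂ (jostTerm p V n) (aboveWedge R) ∧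
      ∀ z ∈ aboveWedge R, ‖jostTerm p V n z‖ ≤ (1 / 2) ^ n := by
  induction n with
  | zero => exact ⟨differentiableOn_const _, fun z _ => by simp [jostTerm]⟩
  | succ n ih =>
    obtain ⟨hdiff, hnorm⟩ := ih
    refine ⟨fun z hz => (h.hasDerivAt_jostStep hdiff (by positivity) hnorm
      hz).differentiableAt.differentiableWithinAt, fun z hz => ?_⟩
    refine (h.norm_jostStep_le hnorm hz).trans ?_
    have hz' : R < height z := hz
    have hsmall : 2 * B / height z ≤ 1 / 2 := by
      rw [div_le_div_iff₀ (h.height_pos hz) two_pos]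
      linarith [h.four_mul_le]
    calc 2 * B * (1 / 2) ^ n / height z = (1 / 2) ^ n * (2 * B / height z) := by ring
      _ ≤ (1 / 2) ^ (n + 1) := by
        rw [pow_succ]
        gcongr

theorem differentiableOn_jostTerm (h : IsVolterraPair R B p V) (n : ℕ) :
    DifferentiableOn ℂ (jostTerm p V n) (aboveWedge R) :=
  (h.differentiableOn_jostTerm_and_norm_le n).1

theorem norm_jostTerm_le (h : IsVolterraPair R B p V) (n : ℕ) :
    ∀ z ∈ aboveWedge R, ‖jostTerm p V n z‖ ≤ (1 / 2) ^ n :=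
  (h.differentiableOn_jostTerm_and_norm_le n).2

theorem hasSum_jostTerm (h : IsVolterraPair R B p V) (hz : z ∈ aboveWedge R) :
    HasSum (fun n => jostTerm p V n z) (jostAmplitude p V z) :=
  (summable_geometric_two.of_norm_bounded fun n => h.norm_jostTerm_le n z hz).hasSum

theorem differentiableOn_jostAmplitude (h : IsVolterraPair R B p V) :
    DifferentiableOn ℂ (jostAmplitude p V) (aboveWedge R) :=
  Complex.differentiableOn_tsum_of_summable_norm summable_geometric_two
    h.differentiableOn_jostTerm (isOpen_aboveWedge R) h.norm_jostTerm_le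

theorem norm_jostAmplitude_le (h : IsVolterraPair R B p V) (hz : z ∈ aboveWedge R) :
    ‖jostAmplitude p V z‖ ≤ 2 :=
  tsum_of_norm_bounded hasSum_geometric_two fun n => h.norm_jostTerm_le n z hz

theorem norm_jostAmplitude_sub_one_le (h : IsVolterraPair R B p V) (hz : z ∈ aboveWedge R) :
    ‖jostAmplitude p V z - 1‖ ≤ 4 * B / height z := by
  have htail : jostAmplitude p V z - 1 = ∑' n, jostTerm p V (n + 1) z := by
    rw [jostAmplitude, (h.hasSum_jostTerm hz).summable.tsum_eq_zero_add]
    simp [jostTerm]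
  rw [htail]
  refine (tsum_of_norm_bounded (hasSum_geometric_two.mul_left (2 * B / height z))
    fun n => ?_).trans_eq (by ring)
  exact (h.norm_jostStep_le (h.norm_jostTerm_le n) hz).trans_eq (by ring)

theorem deriv_jostTerm_succ (h : IsVolterraPair R B p V) (n : ℕ) (hz : z ∈ aboveWedge R) :
    deriv (jostTerm p V (n + 1)) z = jostStepDeriv p V (jostTerm p V n) z :=
  (h.hasDerivAt_jostStep (h.differentiableOn_jostTerm n) (by positivity) (h.norm_jostTerm_le n)
    hz).deriv

theorem deriv_deriv_jostTerm_succ (h : IsVolterraPair R B p V) (n : ℕ) (hz : z ∈ aboveWedge R) :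
    deriv (deriv (jostTerm p V (n + 1))) z =
      -(deriv p z / p z) * deriv (jostTerm p V (n + 1)) z - V z * jostTerm p V n z := by
  have hderiv : deriv (jostTerm p V (n + 1)) =ᶠ[𝓝 z] jostStepDeriv p V (jostTerm p V n) :=
    eventually_of_mem ((isOpen_aboveWedge R).mem_nhds hz) fun y hy => h.deriv_jostTerm_succ n hy
  rw [hderiv.deriv_eq, h.deriv_jostTerm_succ n hz]
  exact (h.hasDerivAt_jostStepDeriv (h.differentiableOn_jostTerm n) (h.norm_jostTerm_le n) hz).deriv

theorem deriv_deriv_jostAmplitude (h : IsVolterraPair R B p V) (hz : z ∈ aboveWedge R) :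
    deriv (deriv (jostAmplitude p V)) z =
      -(deriv p z / p z) * deriv (jostAmplitude p V) z - V z * jostAmplitude p V z := by
  have hderiv := (hasSum_nat_add_iff' (f := fun n => deriv (jostTerm p V n) z) 1).2
    (Complex.hasSum_deriv_of_summable_norm summable_geometric_two h.differentiableOn_jostTerm
      (isOpen_aboveWedge R) h.norm_jostTerm_le hz)
  have hderiv₂ := (hasSum_nat_add_iff' (f := fun n => deriv (deriv (jostTerm p V n)) z) 1).2
    (hasSum_deriv_deriv_of_summable_norm summable_geometric_two h.differentiableOn_jostTerm
      (isOpen_aboveWedge R) h.norm_jostTerm_le hz)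
  have hzero : deriv (jostTerm p V 0) = fun _ => 0 := funext fun y => by simp [jostTerm]
  simp only [Finset.sum_range_one, hzero, deriv_const, sub_zero] at hderiv hderiv₂
  exact hderiv₂.unique (((hderiv.mul_left _).sub ((h.hasSum_jostTerm hz).mul_left _)).congr_fun
    fun n => h.deriv_deriv_jostTerm_succ n hz)

end Amplitude

section Parameter

variable {K : Set ℂ} {R B N : ℝ} {p V m : ℂ → ℂ → ℂ} {z : ℂ}

theorem differentiableOn_jostStepDeriv_param (hK : IsOpen K)
    (h : ∀ κ ∈ K, IsVolterraPair R B (p κ) (V κ))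
    (hp : ∀ z ∈ aboveWedge R, DifferentiableOn ℂ (p · z) K)
    (hV : ∀ z ∈ aboveWedge R, DifferentiableOn ℂ (V · z) K)
    (hm : ∀ z ∈ aboveWedge R, DifferentiableOn ℂ (m · z) K)
    (hm' : ∀ κ ∈ K, DifferentiableOn ℂ (m κ) (aboveWedge R))
    (hmN : ∀ κ ∈ K, ∀ z ∈ aboveWedge R, ‖m κ z‖ ≤ N) (hz : z ∈ aboveWedge R) :
    DifferentiableOn ℂ (fun κ => jostStepDeriv (p κ) (V κ) (m κ) z) K := by
  refine ((hp z hz).fun_inv fun κ hκ => (h κ hκ).weight_ne_zero z hz).fun_mul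
    (differentiableOn_upwardIntegral_param hK (c := fun κ => ‖p κ z‖ * (B * N / height z ^ 2))
      ((hp z hz).continuousOn.norm.mul continuousOn_const) integrableOn_exp_neg_half
      (fun κ hκ => ?_) (fun s hs => ?_)
      fun κ hκ s hs => (h κ hκ).norm_jostStepDeriv_integrand_le (hmN κ hκ) hz hs)
  · exact ((h κ hκ).differentiableOn_weight.mul
      ((h κ hκ).differentiableOn_potential.mul (hm' κ hκ))).continuousOn.comp (by fun_prop)
        fun s hs => add_mul_I_mem_aboveWedge hz (le_of_lt hs)
  · have hzs := add_mul_I_mem_aboveWedge hz hs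
    exact (hp _ hzs).mul ((hV _ hzs).mul (hm _ hzs))

theorem differentiableOn_jostStep_param (hK : IsOpen K)
    (h : ∀ κ ∈ K, IsVolterraPair R B (p κ) (V κ))
    (hp : ∀ z ∈ aboveWedge R, DifferentiableOn ℂ (p · z) K)
    (hV : ∀ z ∈ aboveWedge R, DifferentiableOn ℂ (V · z) K)
    (hm : ∀ z ∈ aboveWedge R, DifferentiableOn ℂ (m · z) K)
    (hm' : ∀ κ ∈ K, DifferentiableOn ℂ (m κ) (aboveWedge R))
    (hmN : ∀ κ ∈ K, ∀ z ∈ aboveWedge R, ‖m κ z‖ ≤ N) (hz : z ∈ aboveWedge R) :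
    DifferentiableOn ℂ (fun κ => jostStep (p κ) (V κ) (m κ) z) K := by
  rcases K.eq_empty_or_nonempty with rfl | ⟨κ₀, hκ₀⟩
  · exact differentiableOn_empty
  refine (differentiableOn_upwardIntegral_param hK (c := fun _ => 2 * B * N) continuousOn_const
    (integrableOn_inv_add_sq ((h κ₀ hκ₀).height_pos hz)).1 (fun κ hκ => ?_) (fun s hs => ?_)
    fun κ hκ s hs => (h κ hκ).norm_jostStepDeriv_add_mul_I_le (hmN κ hκ) hz hs).fun_neg
  · have hcont : ContinuousOn (jostStepDeriv (p κ) (V κ) (m κ)) (aboveWedge R) := fun y hy =>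
      ((h κ hκ).hasDerivAt_jostStepDeriv (hm' κ hκ) (hmN κ hκ) hy).continuousAt.continuousWithinAt
    exact hcont.comp (by fun_prop) fun s hs => add_mul_I_mem_aboveWedge hz (le_of_lt hs)
  · exact differentiableOn_jostStepDeriv_param hK h hp hV hm hm' hmN
      (add_mul_I_mem_aboveWedge hz hs)

theorem differentiableOn_jostTerm_param (hK : IsOpen K)
    (h : ∀ κ ∈ K, IsVolterraPair R B (p κ) (V κ))
    (hp : ∀ z ∈ aboveWedge R, DifferentiableOn ℂ (p · z) K)
    (hV : ∀ z ∈ aboveWedge R, DifferentiableOn ℂ (V · z) K) (n : ℕ) (hz : z ∈ aboveWedge R) :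
    DifferentiableOn ℂ (fun κ => jostTerm (p κ) (V κ) n z) K := by
  induction n generalizing z with
  | zero => exact differentiableOn_const _
  | succ n ih =>
    exact differentiableOn_jostStep_param hK h hp hV (fun z hz => ih hz)
      (fun κ hκ => (h κ hκ).differentiableOn_jostTerm n)
      (fun κ hκ => (h κ hκ).norm_jostTerm_le n) hz

theorem differentiableOn_jostAmplitude_param (hK : IsOpen K)
    (h : ∀ κ ∈ K, IsVolterraPair R B (p κ) (V κ))
    (hp : ∀ z ∈ aboveWedge R, DifferentiableOn ℂ (p · z) K)
    (hV : ∀ z ∈ aboveWedge R, DifferentiableOn ℂ (V · z) K) (hz : z ∈ aboveWedge R) :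
    DifferentiableOn ℂ (fun κ => jostAmplitude (p κ) (V κ) z) K :=
  Complex.differentiableOn_tsum_of_summable_norm summable_geometric_two
    (fun n => differentiableOn_jostTerm_param hK h hp hV n hz) hK
    fun n κ hκ => (h κ hκ).norm_jostTerm_le n z hz

end Parameter

end IsVolterraPair

section UpperLog

/-- The branch of the logarithm on the plane slit along the negative imaginary half-line, with
imaginary part in `(-π/2, 3π/2]`. -/
noncomputable def upperLog (z : ℂ) : ℂ := Complex.log (-Complex.I * z) + Real.pi / 2 * Complex.I

theorem exp_half_pi_mul_I : Complex.exp (Real.pi / 2 * Complex.I) = Complex.I := by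
  rw [Complex.exp_mul_I, Complex.cos_pi_div_two, Complex.sin_pi_div_two, zero_add, one_mul]

theorem neg_I_mul_mem_slitPlane {z : ℂ} (hz : 0 < height z) :
    -Complex.I * z ∈ Complex.slitPlane := by
  have him : 0 < z.im ∨ z.re ≠ 0 := by
    by_contra! h
    simp only [height, h.2, abs_zero, add_zero] at hz
    exact h.1.not_gt hz
  simpa [Complex.mem_slitPlane_iff] using him

theorem hasDerivAt_upperLog {z : ℂ} (hz : 0 < height z) : HasDerivAt upperLog z⁻¹ z := by
  refine ((((hasDerivAt_id z).const_mul (-Complex.I)).clog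
    (neg_I_mul_mem_slitPlane hz)).add_const _).congr_deriv ?_
  rw [mul_one, div_mul_cancel_left₀ (neg_ne_zero.2 Complex.I_ne_zero)]
  rfl

theorem exp_upperLog {z : ℂ} (hz : z ≠ 0) : Complex.exp (upperLog z) = z := by
  rw [upperLog, Complex.exp_add, Complex.exp_log (by simpa using hz), exp_half_pi_mul_I]
  linear_combination -z * Complex.I_mul_I

theorem upperLog_exp {ζ : ℂ} (h₁ : -(Real.pi / 2) < ζ.im) (h₂ : ζ.im ≤ 3 * Real.pi / 2) :
    upperLog (Complex.exp ζ) = ζ := by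
  have hrot : -Complex.I * Complex.exp ζ = Complex.exp (ζ - Real.pi / 2 * Complex.I) := by
    rw [Complex.exp_sub, exp_half_pi_mul_I, Complex.div_I]
    ring
  have him : (ζ - Real.pi / 2 * Complex.I).im = ζ.im - Real.pi / 2 := by
    simp [← Complex.ofReal_ofNat, ← Complex.ofReal_div]
  rw [upperLog, hrot, Complex.log_exp (by rw [him]; linarith) (by rw [him]; linarith)]
  ring

theorem norm_upperLog_add_mul_I_sub_le {z : ℂ} (hz : 0 < height z) {s : ℝ} (hs : 0 ≤ s) :
    ‖upperLog (z + s * Complex.I) - upperLog z‖ ≤ 2 / height z * s := by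
  have hpath : ∀ t ∈ Icc 0 s, HasDerivWithinAt (fun t : ℝ => upperLog (z + t * Complex.I))
      (Complex.I * (z + t * Complex.I)⁻¹) (Icc 0 s) t := fun t ht =>
    ((hasDerivAt_upperLog (by rw [height_add_mul_I]; linarith [ht.1])).scomp t
      (hasDerivAt_add_ofReal_mul_I z t)).hasDerivWithinAt
  have hspeed : ∀ t ∈ Ico 0 s, ‖Complex.I * (z + t * Complex.I)⁻¹‖ ≤ 2 / height z := fun t ht => by
    have hnorm := height_le_two_mul_norm (z + t * Complex.I)
    rw [height_add_mul_I] at hnorm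
    have hpos : 0 < ‖z + t * Complex.I‖ := by linarith [ht.1]
    rw [norm_mul, Complex.norm_I, one_mul, norm_inv, inv_eq_one_div, div_le_div_iff₀ hpos hz]
    linarith [ht.1]
  simpa using norm_image_sub_le_of_norm_deriv_le_segment' hpath hspeed s (right_mem_Icc.2 hs)

end UpperLog

/-! ### The normal form of the phase -/

section Momentum

/-- The branch `k √(1 - w / k²)` of `√(k² - w)`, analytic for `|w| < |k|²`. -/
noncomputable def momentum (k w : ℂ) : ℂ := k * (1 - w / k ^ 2) ^ (1 / 2 : ℂ)

variable {k w : ℂ}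

theorem momentum_neg (k w : ℂ) : momentum (-k) w = -momentum k w := by
  rw [momentum, momentum, neg_sq, neg_mul]

theorem momentum_sq (hk : k ≠ 0) (w : ℂ) : momentum k w ^ 2 = k ^ 2 - w := by
  have hroot : ((1 - w / k ^ 2) ^ (1 / 2 : ℂ)) ^ 2 = 1 - w / k ^ 2 := by
    simpa only [one_div, Nat.cast_ofNat] using Complex.cpow_nat_inv_pow (1 - w / k ^ 2) two_ne_zero
  rw [momentum, mul_pow, hroot]
  field_simp

theorem ne_zero_of_norm_lt_sq (h : ‖w‖ < ‖k‖ ^ 2) : k ≠ 0 := by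
  rintro rfl
  rw [norm_zero, zero_pow two_ne_zero] at h
  exact (norm_nonneg w).not_gt h

theorem one_sub_div_sq_mem_slitPlane (h : ‖w‖ < ‖k‖ ^ 2) : 1 - w / k ^ 2 ∈ Complex.slitPlane := by
  refine Complex.mem_slitPlane_of_norm_lt_one ?_ |> (sub_eq_add_neg 1 (w / k ^ 2) ▸ ·)
  have hk := norm_pos_iff.2 (ne_zero_of_norm_lt_sq h)
  rwa [norm_neg, norm_div, norm_pow, div_lt_one (by positivity)]

theorem norm_momentum_le (h : ‖w‖ < ‖k‖ ^ 2) : ‖momentum k w‖ ≤ 2 * ‖k‖ := by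
  refine abs_le_of_sq_le_sq' ?_ (by positivity) |>.2
  calc ‖momentum k w‖ ^ 2 = ‖k ^ 2 - w‖ := by
        rw [← norm_pow, momentum_sq (ne_zero_of_norm_lt_sq h)]
    _ ≤ ‖k‖ ^ 2 + ‖w‖ := (norm_sub_le _ _).trans_eq (by rw [norm_pow])
    _ ≤ (2 * ‖k‖) ^ 2 := by nlinarith

theorem cpow_half_re_pos (hw : w ∈ Complex.slitPlane) : 0 < (w ^ (1 / 2 : ℂ)).re := by
  rw [Complex.cpow_def_of_ne_zero (Complex.slitPlane_ne_zero hw), Complex.exp_re]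
  have him : (Complex.log w * (1 / 2)).im = w.arg / 2 := by
    rw [mul_one_div, Complex.div_ofNat_im, Complex.log_im]
  have hlower := Complex.neg_pi_lt_arg w
  have hupper := (Complex.arg_le_pi w).lt_of_ne (Complex.mem_slitPlane_iff_arg.1 hw).1
  refine mul_pos (Real.exp_pos _) (Real.cos_pos_of_mem_Ioo ?_)
  rw [him]
  constructor <;> linarith

theorem norm_le_norm_add_momentum (h : ‖w‖ < ‖k‖ ^ 2) : ‖k‖ ≤ ‖k + momentum k w‖ := by
  have hre := cpow_half_re_pos (one_sub_div_sq_mem_slitPlane h)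
  have hone : 1 ≤ ‖1 + (1 - w / k ^ 2) ^ (1 / 2 : ℂ)‖ :=
    le_trans (by rw [Complex.add_re, Complex.one_re]; linarith) (Complex.re_le_norm _)
  rw [momentum, ← mul_one_add, norm_mul]
  exact le_mul_of_one_le_right (norm_nonneg k) hone

theorem add_momentum_ne_zero (h : ‖w‖ < ‖k‖ ^ 2) : k + momentum k w ≠ 0 :=
  norm_pos_iff.1 ((norm_pos_iff.2 (ne_zero_of_norm_lt_sq h)).trans_le
    (norm_le_norm_add_momentum h))

theorem momentum_eq (h : ‖w‖ < ‖k‖ ^ 2) :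
    momentum k w = k - w / (2 * k) - w ^ 2 / (2 * k * (k + momentum k w) ^ 2) := by
  have hk := ne_zero_of_norm_lt_sq h
  have hsum := add_momentum_ne_zero h
  have hsq : w = k ^ 2 - momentum k w ^ 2 := by rw [momentum_sq hk]; ring
  generalize momentum k w = m at *
  subst hsq
  field_simp
  ring

theorem differentiableAt_momentum {f g : ℂ → ℂ} {z : ℂ} (hf : DifferentiableAt ℂ f z)
    (hg : DifferentiableAt ℂ g z) (h : ‖g z‖ < ‖f z‖ ^ 2) :
    DifferentiableAt ℂ (fun z => momentum (f z) (g z)) z :=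
  hf.fun_mul (((hg.fun_div (hf.fun_pow 2) (pow_ne_zero 2 (ne_zero_of_norm_lt_sq h))).const_sub
    1).cpow (differentiableAt_const _) (one_sub_div_sq_mem_slitPlane h))

end Momentum

section PhaseRegion

variable {j : ℕ} {k w : ℂ}

theorem isOpen_phaseRegion (j : ℕ) : IsOpen (phaseRegion j) :=
  isOpen_lt continuous_const (by fun_prop)

theorem ne_zero_of_mem_phaseRegion (hk : k ∈ phaseRegion j) : k ≠ 0 :=
  ne_zero_of_norm_lt_sq (w := 0) <| by
    rw [norm_zero]
    exact lt_of_le_of_lt (by positivity) hk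

theorem exists_mem_phaseRegion (hk : k ≠ 0) : ∃ j : ℕ, 1 ≤ j ∧ k ∈ phaseRegion j := by
  obtain ⟨n, hn⟩ := exists_nat_one_div_lt (pow_pos (norm_pos_iff.2 hk) 2)
  exact ⟨n + 1, by omega, by simpa [phaseRegion] using hn⟩

end PhaseRegion

section PhaseTail

/-- The far part `-Z / cosh ξ` of the potential in the variable `s = exp (-ξ)`. -/
noncomputable def farPotential (Z : ℝ) (s : ℂ) : ℂ := -(2 * Z * s) / (1 + s ^ 2)

/-- A radius below which `|farPotential Z| ≤ 1 / j`. -/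
noncomputable def tailRadius (Z : ℝ) (j : ℕ) : ℝ := 1 / (4 * (|Z| + 1) * j)

/-- The derivative of `phaseTail` in `s = exp (-ξ)`: the remainder of order two of
`cosh ξ √(k² - w)` in the far potential `w`, divided by `-s`. -/
noncomputable def phaseTailDeriv (Z : ℝ) (k s : ℂ) : ℂ :=
  Z ^ 2 / (k * (1 + s ^ 2) * (k + momentum k (farPotential Z s)) ^ 2)

/-- The part of the phase that decays at infinity, in the variable `s = exp (-ξ)`. -/
noncomputable def phaseTail (Z : ℝ) (k : ℂ) : ℂ → ℂ := radialPrimitive (phaseTailDeriv Z k)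

variable {Z : ℝ} {j : ℕ} {k s : ℂ}

theorem tailRadius_pos (hj : 1 ≤ j) : 0 < tailRadius Z j := by
  have : (0 : ℝ) < j := by exact_mod_cast hj
  unfold tailRadius
  positivity

theorem mul_norm_lt_of_mem_ball_tailRadius (hj : 1 ≤ j) (hs : s ∈ ball 0 (tailRadius Z j)) :
    4 * (|Z| + 1) * j * ‖s‖ < 1 := by
  have hj' : (0 : ℝ) < j := by exact_mod_cast hj
  rw [mem_ball_zero_iff, tailRadius, lt_div_iff₀ (by positivity)] at hs
  linarith

theorem half_le_norm_one_add_sq (hj : 1 ≤ j) (hs : s ∈ ball 0 (tailRadius Z j)) :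
    1 / 2 ≤ ‖1 + s ^ 2‖ := by
  have hj' : (1 : ℝ) ≤ j := by exact_mod_cast hj
  have hs4 : 4 * ‖s‖ ≤ 1 := by
    refine le_trans ?_ (mul_norm_lt_of_mem_ball_tailRadius hj hs).le
    gcongr
    nlinarith [abs_nonneg Z]
  have htri := norm_sub_le_norm_add (1 : ℂ) (s ^ 2)
  rw [norm_one, norm_pow] at htri
  nlinarith [norm_nonneg s]

theorem one_add_sq_ne_zero (hj : 1 ≤ j) (hs : s ∈ ball 0 (tailRadius Z j)) : 1 + s ^ 2 ≠ 0 :=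
  norm_pos_iff.1 (one_half_pos.trans_le (half_le_norm_one_add_sq hj hs))

theorem norm_farPotential_lt (hj : 1 ≤ j) (hk : k ∈ phaseRegion j)
    (hs : s ∈ ball 0 (tailRadius Z j)) : ‖farPotential Z s‖ < ‖k‖ ^ 2 := by
  refine lt_of_le_of_lt ?_ hk
  have hj' : (0 : ℝ) < j := by exact_mod_cast hj
  have hsmall := mul_norm_lt_of_mem_ball_tailRadius hj hs
  calc ‖farPotential Z s‖ = 2 * |Z| * ‖s‖ / ‖1 + s ^ 2‖ := by simp [farPotential]
    _ ≤ 2 * |Z| * ‖s‖ / (1 / 2) := by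
        gcongr
        exact half_le_norm_one_add_sq hj hs
    _ ≤ 1 / j := by
        rw [le_div_iff₀ hj']
        nlinarith [mul_nonneg hj'.le (norm_nonneg s)]

theorem differentiableAt_farPotential (hs : 1 + s ^ 2 ≠ 0) :
    DifferentiableAt ℂ (farPotential Z) s := by
  unfold farPotential
  exact DifferentiableAt.div (by fun_prop) (by fun_prop) hs

theorem phaseTailDeriv_denominator_ne_zero (hj : 1 ≤ j) (hk : k ∈ phaseRegion j)
    (hs : s ∈ ball 0 (tailRadius Z j)) :
    k * (1 + s ^ 2) * (k + momentum k (farPotential Z s)) ^ 2 ≠ 0 :=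
  mul_ne_zero (mul_ne_zero (ne_zero_of_mem_phaseRegion hk) (one_add_sq_ne_zero hj hs))
    (pow_ne_zero 2 (add_momentum_ne_zero (norm_farPotential_lt hj hk hs)))

theorem differentiableOn_phaseTailDeriv (hj : 1 ≤ j) (hk : k ∈ phaseRegion j) :
    DifferentiableOn ℂ (phaseTailDeriv Z k) (ball 0 (tailRadius Z j)) := fun s hs =>
  ((differentiableAt_const _).fun_div
    (DifferentiableAt.fun_mul (by fun_prop) (((differentiableAt_momentum
      (differentiableAt_const k) (differentiableAt_farPotential (one_add_sq_ne_zero hj hs))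
      (norm_farPotential_lt hj hk hs)).const_add k).fun_pow 2))
    (phaseTailDeriv_denominator_ne_zero hj hk hs)).differentiableWithinAt

theorem differentiableOn_phaseTailDeriv_param (hj : 1 ≤ j) (hs : s ∈ ball 0 (tailRadius Z j)) :
    DifferentiableOn ℂ (phaseTailDeriv Z · s) (phaseRegion j) := fun _ hk =>
  ((differentiableAt_const _).fun_div
    (DifferentiableAt.fun_mul (by fun_prop) ((differentiableAt_id.fun_add
      (differentiableAt_momentum differentiableAt_id (differentiableAt_const _)
        (norm_farPotential_lt hj hk hs))).fun_pow 2))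
    (phaseTailDeriv_denominator_ne_zero hj hk hs)).differentiableWithinAt

theorem norm_phaseTailDeriv_le (hj : 1 ≤ j) (hk : k ∈ phaseRegion j)
    (hs : s ∈ ball 0 (tailRadius Z j)) :
    ‖phaseTailDeriv Z k s‖ ≤ Z ^ 2 / (‖k‖ * (1 / 2) * ‖k‖ ^ 2) := by
  have hk0 : 0 < ‖k‖ := norm_pos_iff.2 (ne_zero_of_mem_phaseRegion hk)
  simp only [phaseTailDeriv, norm_div, norm_mul, norm_pow, Complex.norm_real, Real.norm_eq_abs,
    sq_abs]
  gcongr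
  · exact half_le_norm_one_add_sq hj hs
  · exact norm_le_norm_add_momentum (norm_farPotential_lt hj hk hs)

theorem phaseTail_zero (Z : ℝ) (k : ℂ) : phaseTail Z k 0 = 0 := radialPrimitive_zero _

theorem phaseTail_neg (Z : ℝ) (k s : ℂ) : phaseTail Z (-k) s = -phaseTail Z k s := by
  have hderiv : ∀ y, phaseTailDeriv Z (-k) y = -phaseTailDeriv Z k y := fun y => by
    rw [phaseTailDeriv, phaseTailDeriv, momentum_neg, ← neg_add, neg_sq, neg_mul, neg_mul, div_neg]
  simp only [phaseTail, radialPrimitive, hderiv, intervalIntegral.integral_neg, mul_neg]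

theorem hasDerivAt_phaseTail (hj : 1 ≤ j) (hk : k ∈ phaseRegion j)
    (hs : s ∈ ball 0 (tailRadius Z j)) : HasDerivAt (phaseTail Z k) (phaseTailDeriv Z k s) s :=
  hasDerivAt_radialPrimitive (differentiableOn_phaseTailDeriv hj hk) hs

theorem differentiableOn_phaseTail_param (hj : 1 ≤ j) (hs : s ∈ ball 0 (tailRadius Z j)) :
    DifferentiableOn ℂ (phaseTail Z · s) (phaseRegion j) := by
  refine differentiableOn_radialPrimitive_param (isOpen_phaseRegion j)
    (continuousOn_const.div (by fun_prop) fun k hk => ?_)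
    (fun k hk => (differentiableOn_phaseTailDeriv hj hk).continuousOn)
    (fun y hy => differentiableOn_phaseTailDeriv_param hj hy)
    (fun k hk y hy => norm_phaseTailDeriv_le hj hk hy) hs
  have := norm_pos_iff.2 (ne_zero_of_mem_phaseRegion hk)
  positivity

end PhaseTail

section NormalPhase

/-- The normal form of the phase for large `ξ`, up to a constant: a primitive of
`cosh ξ √(k² + Z / cosh ξ)`. -/
noncomputable def normalPhase (Z : ℝ) (k ξ : ℂ) : ℂ :=
  k * Complex.sinh ξ + Z * ξ / (2 * k) + phaseTail Z k (Complex.exp (-ξ))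

variable {Z : ℝ} {j : ℕ} {k ξ : ℂ}

theorem normalPhase_neg (Z : ℝ) (k ξ : ℂ) : normalPhase Z (-k) ξ = -normalPhase Z k ξ := by
  simp only [normalPhase, phaseTail_neg, mul_neg, div_neg, neg_mul]
  ring

theorem one_add_exp_neg_sq (ξ : ℂ) :
    1 + Complex.exp (-ξ) ^ 2 = 2 * Complex.cosh ξ * Complex.exp (-ξ) := by
  have hinv : Complex.exp ξ * Complex.exp (-ξ) = 1 := by
    rw [← Complex.exp_add, add_neg_cancel, Complex.exp_zero]
  rw [Complex.cosh]
  linear_combination -hinv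

theorem farPotential_exp_neg (Z : ℝ) (ξ : ℂ) :
    farPotential Z (Complex.exp (-ξ)) = -Z / Complex.cosh ξ := by
  rw [farPotential, one_add_exp_neg_sq, mul_assoc 2, mul_assoc 2, ← mul_neg,
    mul_div_mul_left _ _ two_ne_zero, ← neg_mul, mul_div_mul_right _ _ (Complex.exp_ne_zero _)]

theorem hasDerivAt_normalPhase (hj : 1 ≤ j) (hk : k ∈ phaseRegion j)
    (hξ : Complex.exp (-ξ) ∈ ball 0 (tailRadius Z j)) :
    HasDerivAt (normalPhase Z k) (Complex.cosh ξ * momentum k (-Z / Complex.cosh ξ)) ξ := by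
  have hexp : HasDerivAt (fun ξ => Complex.exp (-ξ)) (Complex.exp (-ξ) * -1) ξ :=
    (hasDerivAt_neg ξ).cexp
  have htail := (hasDerivAt_phaseTail hj hk hξ).comp ξ hexp
  refine ((((Complex.hasDerivAt_sinh ξ).const_mul k).fun_add
    (((hasDerivAt_id ξ).const_mul (Z : ℂ)).div_const (2 * k))).fun_add htail).congr_deriv ?_
  have hsmall := norm_farPotential_lt hj hk hξ
  have hq := one_add_sq_ne_zero hj hξ
  rw [phaseTailDeriv]
  rw [farPotential_exp_neg] at hsmall ⊢
  rw [one_add_exp_neg_sq] at hq ⊢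
  have hk0 := ne_zero_of_mem_phaseRegion hk
  have _hsum := add_momentum_ne_zero hsmall
  have hcosh : Complex.cosh ξ ≠ 0 := right_ne_zero_of_mul (left_ne_zero_of_mul hq)
  have hE := Complex.exp_ne_zero (-ξ)
  conv_rhs => rw [momentum_eq hsmall]
  field_simp
  ring

theorem differentiableOn_normalPhase_param (hj : 1 ≤ j)
    (hξ : Complex.exp (-ξ) ∈ ball 0 (tailRadius Z j)) :
    DifferentiableOn ℂ (normalPhase Z · ξ) (phaseRegion j) :=
  (DifferentiableOn.fun_add (by fun_prop) ((differentiableOn_const _).fun_div (by fun_prop)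
    fun _ hk => mul_ne_zero two_ne_zero (ne_zero_of_mem_phaseRegion hk))).fun_add
    (differentiableOn_phaseTail_param hj hξ)

end NormalPhase

section LocalPhase

variable {Z : ℝ} {μ k : ℂ} {j : ℕ} {l : ℝ → ℝ}

theorem localPhase_eq_integral (l : ℝ → ℝ) (ξ : ℝ) (k : ℂ) :
    localPhase l ξ k = ∫ τ in (0 : ℝ)..Real.sinh ξ, momentum k (l τ) := rfl

namespace IsLongRangePart

theorem norm_lt_sq (hl : IsLongRangePart Z μ j l) (hk : k ∈ phaseRegion j) {τ : ℝ} (hτ : 0 < τ) :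
    ‖(l τ : ℂ)‖ < ‖k‖ ^ 2 := by
  rw [Complex.norm_real]
  exact (hl.bound τ hτ).trans_lt hk

theorem continuousOn_momentum (hl : IsLongRangePart Z μ j l) (hk : k ∈ phaseRegion j) :
    ContinuousOn (fun τ => momentum k (l τ)) (Ioi 0) := by
  intro τ hτ
  have hl' : ContinuousAt (fun τ => (l τ : ℂ)) τ := Complex.continuous_ofReal.continuousAt.comp
    (hl.contDiffOn.continuousOn.continuousAt (Ioi_mem_nhds hτ))
  have hroot : ContinuousAt (momentum k) (l τ) := (differentiableAt_momentum
    (differentiableAt_const k) differentiableAt_id (hl.norm_lt_sq hk hτ)).continuousAt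
  exact (hroot.comp (f := fun τ => (l τ : ℂ)) hl').continuousWithinAt

theorem intervalIntegrable_momentum (hl : IsLongRangePart Z μ j l) (hk : k ∈ phaseRegion j)
    {a b : ℝ} (ha : 0 ≤ a) (hb : 0 ≤ b) :
    IntervalIntegrable (fun τ => momentum k (l τ)) volume a b := by
  have hsub : Ι a b ⊆ Ioi 0 := fun τ hτ => (le_min ha hb).trans_lt hτ.1
  rw [intervalIntegrable_iff]
  refine (integrableOn_const (C := 2 * ‖k‖) (by simp [uIoc])).mono'
    ((hl.continuousOn_momentum hk).mono hsub |>.aestronglyMeasurable measurableSet_uIoc) ?_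
  exact ae_restrict_of_forall_mem measurableSet_uIoc fun τ hτ =>
    norm_momentum_le (hl.norm_lt_sq hk (hsub hτ))

theorem differentiableOn_integral_momentum (hl : IsLongRangePart Z μ j l) {b : ℝ} (hb : 0 ≤ b) :
    DifferentiableOn ℂ (fun k => ∫ τ in (0 : ℝ)..b, momentum k (l τ)) (phaseRegion j) := by
  have hpos : ∀ τ ∈ Ι 0 b, 0 < τ := fun τ hτ => (le_min le_rfl hb).trans_lt hτ.1
  refine differentiableOn_intervalIntegral_of_norm_le (c := fun k => 2 * ‖k‖)
    (isOpen_phaseRegion j) (by fun_prop) (fun τ hτ k hk => ?_)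
    (fun k hk => hl.intervalIntegrable_momentum hk le_rfl hb)
    fun τ hτ k hk => norm_momentum_le (hl.norm_lt_sq hk (hpos τ hτ))
  exact (differentiableAt_momentum differentiableAt_id (differentiableAt_const _)
    (hl.norm_lt_sq hk (hpos τ hτ))).differentiableWithinAt

theorem integral_momentum_of_far (hl : IsLongRangePart Z μ j l) (hj : 1 ≤ j)
    (hk : k ∈ phaseRegion j) {X ξ : ℝ} (hX : 0 < X) (hξ : X ≤ ξ)
    (htail : Real.exp (-X) < tailRadius Z j)
    (hfar : ∀ τ ≥ Real.sinh X, l τ = -Z / √(1 + τ ^ 2)) :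
    ∫ τ in Real.sinh X..Real.sinh ξ, momentum k (l τ) = normalPhase Z k ξ - normalPhase Z k X := by
  have hpos := Real.sinh_pos_iff.2 hX
  have hprim : ∀ τ ∈ uIcc (Real.sinh X) (Real.sinh ξ),
      HasDerivAt (fun τ : ℝ => normalPhase Z k (Real.arsinh τ)) (momentum k (l τ)) τ := by
    intro τ hτ
    rw [uIcc_of_le (Real.sinh_le_sinh.2 hξ)] at hτ
    have hXτ : X ≤ Real.arsinh τ := by
      rw [← Real.arsinh_sinh X]
      exact Real.arsinh_le_arsinh.2 hτ.1
    have hmem : Complex.exp (-(Real.arsinh τ)) ∈ ball (0 : ℂ) (tailRadius Z j) := by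
      rw [mem_ball_zero_iff, Complex.norm_exp, Complex.neg_re, Complex.ofReal_re]
      exact (Real.exp_le_exp.2 (neg_le_neg hXτ)).trans_lt htail
    refine ((hasDerivAt_normalPhase hj hk hmem).comp_ofReal.scomp τ
      (Real.hasDerivAt_arsinh τ)).congr_deriv ?_
    have hroot : (√(1 + τ ^ 2) : ℂ) ≠ 0 := by
      exact_mod_cast (Real.sqrt_pos.2 (by positivity)).ne'
    rw [← Complex.ofReal_cosh, Real.cosh_arsinh, hfar τ hτ.1, Complex.real_smul]
    push_cast
    rw [inv_mul_cancel_left₀ hroot]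
  simpa only [Real.arsinh_sinh] using intervalIntegral.integral_eq_sub_of_hasDerivAt hprim
    (hl.intervalIntegrable_momentum hk hpos.le (hpos.trans_le (Real.sinh_le_sinh.2 hξ)).le)

theorem exists_localPhase_eq (hl : IsLongRangePart Z μ j l) (hj : 1 ≤ j) :
    ∃ (X : ℝ) (d : ℂ → ℂ), DifferentiableOn ℂ d (phaseRegion j) ∧
      ∀ k ∈ phaseRegion j, ∀ ξ : ℝ, X < ξ → localPhase l ξ k = d k + normalPhase Z k ξ := by
  obtain ⟨R, hR⟩ := hl.eq_far
  have hexp : ∀ᶠ X : ℝ in atTop, Real.exp (-X) < tailRadius Z j :=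
    (Real.tendsto_exp_atBot.comp tendsto_neg_atTop_atBot).eventually_lt_const (tailRadius_pos hj)
  have hsinh : ∀ᶠ X : ℝ in atTop, R < Real.sinh X :=
    (tendsto_atTop_mono' _ ((eventually_ge_atTop 0).mono fun x hx => Real.self_le_sinh_iff.2 hx)
      tendsto_id).eventually_gt_atTop R
  obtain ⟨X, hX, hXR, htail⟩ := ((eventually_gt_atTop 0).and (hsinh.and hexp)).exists
  have hpos := (Real.sinh_pos_iff.2 hX).le
  refine ⟨X, fun k => (∫ τ in (0 : ℝ)..Real.sinh X, momentum k (l τ)) - normalPhase Z k X,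
    (hl.differentiableOn_integral_momentum hpos).fun_sub
      (differentiableOn_normalPhase_param hj ?_), fun k hk ξ hξ => ?_⟩
  · rwa [mem_ball_zero_iff, Complex.norm_exp, Complex.neg_re, Complex.ofReal_re]
  · rw [localPhase_eq_integral, ← intervalIntegral.integral_add_adjacent_intervals
      (hl.intervalIntegrable_momentum hk le_rfl hpos)
      (hl.intervalIntegrable_momentum hk hpos (hpos.trans (Real.sinh_le_sinh.2 hξ.le))),
      hl.integral_momentum_of_far hj hk hX hξ.le htail fun τ hτ => hR τ (hXR.trans_le hτ)]
    ring

end IsLongRangePart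

end LocalPhase

/-- `c k` is the analytic, odd additive constant by which the phase `φ(·, k)` differs, for large
`ξ`, from its normal form. -/
structure IsPhaseConstant (Z : ℝ) (φ : ℝ → ℂ → ℂ) (c : ℂ → ℂ) : Prop where
  differentiableAt : ∀ k ≠ 0, DifferentiableAt ℂ c k
  odd : ∀ k ≠ 0, c (-k) = -c k
  eventually_eq : ∀ k ≠ 0, ∀ᶠ ξ : ℝ in atTop, φ ξ k = c k + normalPhase Z k ξ

namespace IsGlobalPhase

variable {Z : ℝ} {μ : ℂ} {φ : ℝ → ℂ → ℂ}

theorem exists_level_constant (hφ : IsGlobalPhase Z μ φ) {j : ℕ} (hj : 1 ≤ j) :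
    ∃ d : ℂ → ℂ, DifferentiableOn ℂ d (phaseRegion j) ∧
      ∀ k ∈ phaseRegion j, ∀ᶠ ξ : ℝ in atTop, φ ξ k = d k + normalPhase Z k ξ := by
  obtain ⟨l, g, R, hl, hg, hlocal⟩ := hφ.eq_local j hj
  obtain ⟨X, d, hd, hnormal⟩ := hl.exists_localPhase_eq hj
  refine ⟨fun k => d k + g k, hd.fun_add hg.differentiableOn, fun k hk => ?_⟩
  filter_upwards [eventually_gt_atTop R, eventually_gt_atTop X] with ξ hξR hξX
  rw [hlocal ξ hξR k hk, hnormal k hk ξ hξX]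
  ring

theorem exists_isPhaseConstant (hφ : IsGlobalPhase Z μ φ) : ∃ c, IsPhaseConstant Z φ c := by
  choose! d hd heq using fun j : ℕ => hφ.exists_level_constant (j := j)
  choose! J hJ hmem using fun k : ℂ => exists_mem_phaseRegion (k := k)
  have hglue : ∀ j, 1 ≤ j → ∀ k ∈ phaseRegion j, d (J k) k = d j k := fun j hj k hk => by
    have hk0 := ne_zero_of_mem_phaseRegion hk
    obtain ⟨ξ, h₁, h₂⟩ := ((heq j hj k hk).and (heq _ (hJ k hk0) k (hmem k hk0))).exists
    exact add_right_cancel (h₂.symm.trans h₁)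
  refine ⟨fun k => d (J k) k, ⟨fun k hk => ?_, fun k hk => ?_, fun k hk =>
    heq _ (hJ k hk) k (hmem k hk)⟩⟩
  · have hnhds := (isOpen_phaseRegion _).mem_nhds (hmem k hk)
    exact ((hd _ (hJ k hk)).differentiableAt hnhds).congr_of_eventuallyEq
      (eventually_of_mem hnhds (hglue _ (hJ k hk)))
  · have hk' := neg_ne_zero.2 hk
    obtain ⟨ξ, h₁, h₂⟩ := ((heq _ (hJ k hk) k (hmem k hk)).and
      (heq _ (hJ _ hk') _ (hmem _ hk'))).exists
    rw [hφ.odd ξ k hk, h₁, normalPhase_neg] at h₂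
    linear_combination -h₂

end IsGlobalPhase

/-! ### The phase and the radial equation on the slit plane -/

section Continuation

theorem add_one_mem_slitPlane {x : ℂ} (hx : x ∈ Complex.slitPlane) :
    x + 1 ∈ Complex.slitPlane := by
  rw [Complex.mem_slitPlane_iff, Complex.add_re, Complex.add_im, Complex.one_re, Complex.one_im,
    add_zero] at *
  exact hx.imp_left fun h => by linarith

/-- The complement of a disc about `0` in the slit plane, on which the phase is continued. -/
def slitExterior (R : ℝ) : Set ℂ := {x | x ∈ Complex.slitPlane ∧ R < ‖x‖}

variable {R : ℝ}

theorem isOpen_slitExterior (R : ℝ) : IsOpen (slitExterior R) :=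
  Complex.isOpen_slitPlane.inter (isOpen_lt continuous_const continuous_norm)

theorem slitExterior_eq_image_exp (hR : 0 < R) : slitExterior R =
    Complex.exp '' ({ζ | Real.log R < ζ.re} ∩ ({ζ | -Real.pi < ζ.im} ∩ {ζ | ζ.im < Real.pi})) := by
  ext x
  constructor
  · rintro ⟨hx, hRx⟩
    refine ⟨Complex.log x, ⟨?_, Complex.neg_pi_lt_log_im x, ?_⟩,
      Complex.exp_log (Complex.slitPlane_ne_zero hx)⟩
    · change Real.log R < (Complex.log x).re
      rw [Complex.log_re]
      exact Real.log_lt_log hR hRx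
    · change (Complex.log x).im < Real.pi
      rw [Complex.log_im]
      exact (Complex.arg_le_pi x).lt_of_ne (Complex.mem_slitPlane_iff_arg.1 hx).1
  · rintro ⟨ζ, ⟨hre : _ < ζ.re, hlower : _ < ζ.im, hupper : ζ.im < _⟩, rfl⟩
    constructor
    · rw [Complex.mem_slitPlane_iff_arg, ← Complex.log_im, Complex.log_exp hlower hupper.le]
      exact ⟨hupper.ne, Complex.exp_ne_zero ζ⟩
    · rw [Complex.norm_exp]
      exact (Real.log_lt_iff_lt_exp hR).1 hre

theorem isPreconnected_slitExterior (hR : 0 < R) : IsPreconnected (slitExterior R) := by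
  rw [slitExterior_eq_image_exp hR]
  exact (((convex_halfSpace_re_gt _).inter ((convex_halfSpace_im_gt _).inter
    (convex_halfSpace_im_lt _))).isPreconnected).image _ Complex.continuous_exp.continuousOn

theorem eqOn_slitExterior_of_forall_ofReal (hR : 0 < R) {f g : ℂ → ℂ}
    (hf : AnalyticOnNhd ℂ f (slitExterior R)) (hg : AnalyticOnNhd ℂ g (slitExterior R))
    (h : ∀ x : ℝ, R < x → f x = g x) : EqOn f g (slitExterior R) := by
  have hmem : ((R + 1 : ℝ) : ℂ) ∈ slitExterior R := by
    refine ⟨Complex.ofReal_mem_slitPlane.2 (by linarith), ?_⟩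
    rw [Complex.norm_real, Real.norm_of_nonneg (by linarith)]
    linarith
  have hreal : Tendsto (fun t : ℝ => (t : ℂ)) (𝓝[>] (R + 1)) (𝓝[≠] ((R + 1 : ℝ) : ℂ)) :=
    (Complex.continuous_ofReal.continuousWithinAt).tendsto_nhdsWithin fun t ht =>
      Complex.ofReal_injective.ne (ne_of_gt ht)
  refine hf.eqOn_of_preconnected_of_frequently_eq hg (isPreconnected_slitExterior hR) hmem
    (hreal.frequently (Eventually.frequently ?_))
  filter_upwards [self_mem_nhdsWithin] with t ht
  exact h t ((lt_add_one R).trans ht)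

variable {Z : ℝ} {k : ℂ} {φ : ℝ → ℂ → ℂ} {c : ℂ → ℂ}

theorem exists_analyticOnNhd_normalPhase_log (Z : ℝ) (hk : k ≠ 0) :
    ∃ R > 0, AnalyticOnNhd ℂ (fun x => normalPhase Z k (Complex.log (x + 1)))
      (slitExterior R) := by
  obtain ⟨j, hj, hkj⟩ := exists_mem_phaseRegion hk
  have hδ := tailRadius_pos (Z := Z) hj
  refine ⟨1 + (tailRadius Z j)⁻¹, by positivity, DifferentiableOn.analyticOnNhd
    (fun x hx => DifferentiableAt.differentiableWithinAt ?_) (isOpen_slitExterior _)⟩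
  have hslit := add_one_mem_slitPlane hx.1
  have hfar : (tailRadius Z j)⁻¹ < ‖x + 1‖ := by
    have htri := norm_sub_le (x + 1) 1
    rw [add_sub_cancel_right, norm_one] at htri
    linarith [hx.2]
  have hmem : Complex.exp (-Complex.log (x + 1)) ∈ ball (0 : ℂ) (tailRadius Z j) := by
    rw [Complex.exp_neg, Complex.exp_log (Complex.slitPlane_ne_zero hslit), mem_ball_zero_iff,
      norm_inv]
    exact inv_lt_of_inv_lt₀ hδ hfar
  have hlog : DifferentiableAt ℂ (fun y => Complex.log (y + 1)) x :=
    ((Complex.hasDerivAt_log hslit).comp_add_const x 1).differentiableAt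
  exact DifferentiableAt.fun_comp' x (hasDerivAt_normalPhase hj hkj hmem).differentiableAt hlog

theorem IsPhaseConstant.isPhaseContinuation (hc : IsPhaseConstant Z φ c) :
    IsPhaseContinuation φ fun x k => c k + normalPhase Z k (Complex.log (x + 1)) := by
  intro k hk
  obtain ⟨X, hX⟩ := eventually_atTop.1 (hc.eventually_eq k hk)
  obtain ⟨R, hR, han⟩ := exists_analyticOnNhd_normalPhase_log Z hk
  refine ⟨max R (Real.exp X), lt_max_of_lt_left hR, fun x hx =>
    analyticAt_const.fun_add (han x ⟨hx.1, (le_max_left _ _).trans_lt hx.2⟩), fun x hx => ?_⟩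
  have hXx : Real.exp X < x := (le_max_right _ _).trans_lt hx
  have hpos : 0 < x + 1 := by linarith [Real.exp_pos X]
  have hlog : X ≤ Real.log (x + 1) := (Real.le_log_iff_exp_le hpos).2 (by linarith)
  rw [hX _ hlog, Complex.ofReal_log hpos.le, Complex.ofReal_add, Complex.ofReal_one]

theorem IsPhaseContinuation.exists_eqOn_slitExterior {Φ Ψ : ℂ → ℂ → ℂ}
    (hΦ : IsPhaseContinuation φ Φ) (hΨ : IsPhaseContinuation φ Ψ) (hk : k ≠ 0) :
    ∃ R : ℝ, EqOn (Φ · k) (Ψ · k) (slitExterior R) := by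
  obtain ⟨R₁, hR₁, han₁, heq₁⟩ := hΦ k hk
  obtain ⟨R₂, -, han₂, heq₂⟩ := hΨ k hk
  refine ⟨max R₁ R₂, eqOn_slitExterior_of_forall_ofReal (lt_max_of_lt_left hR₁)
    (fun x hx => han₁ x ⟨hx.1, (le_max_left _ _).trans_lt hx.2⟩)
    (fun x hx => han₂ x ⟨hx.1, (le_max_right _ _).trans_lt hx.2⟩) fun x hx => ?_⟩
  rw [max_lt_iff] at hx
  exact (heq₁ x hx.1).trans (heq₂ x hx.2).symm

end Continuation

section LeadingPhase

/-- The part of the phase that does not decay at infinity, in the variable `x = exp ξ - 1`. -/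
noncomputable def leadingPhase (Z : ℝ) (k x : ℂ) : ℂ :=
  k * (x + 1) / 2 + Z / (2 * k) * Complex.log (x + 1)

variable {Z : ℝ} {k : ℂ}

theorem leadingPhase_neg (Z : ℝ) (k x : ℂ) : leadingPhase Z (-k) x = -leadingPhase Z k x := by
  rw [leadingPhase, leadingPhase, mul_neg, div_neg]
  ring

theorem tendsto_inv_add_one_cobounded :
    Tendsto (fun x : ℂ => (x + 1)⁻¹) (Bornology.cobounded ℂ) (𝓝 0) :=
  tendsto_inv₀_cobounded.comp (by simp)

theorem tendsto_normalPhase_log_sub_leadingPhase (hk : k ≠ 0) :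
    Tendsto (fun x => normalPhase Z k (Complex.log (x + 1)) - leadingPhase Z k x)
      (Bornology.cobounded ℂ) (𝓝 0) := by
  obtain ⟨j, hj, hkj⟩ := exists_mem_phaseRegion hk
  have htail : Tendsto (fun x : ℂ => phaseTail Z k (x + 1)⁻¹) (Bornology.cobounded ℂ) (𝓝 0) := by
    have hcont := (hasDerivAt_phaseTail (Z := Z) hj hkj
      (mem_ball_self (tailRadius_pos hj))).continuousAt
    simpa only [phaseTail_zero] using! hcont.tendsto.comp tendsto_inv_add_one_cobounded
  have hsum := (tendsto_inv_add_one_cobounded.const_mul (-(k / 2))).add htail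
  rw [mul_zero, add_zero] at hsum
  refine hsum.congr' ?_
  filter_upwards [(finite_singleton (-1 : ℂ)).isBounded] with x (hx : x ≠ -1)
  have hx' : x + 1 ≠ 0 := fun h => hx (eq_neg_of_add_eq_zero_left h)
  rw [normalPhase, leadingPhase, Complex.sinh, Complex.exp_neg, Complex.exp_log hx']
  ring

end LeadingPhase

section Systems

/-- The pair `(f, f₁)` solves the linear system `f' = ω f₁`, `f₁' = q f` on `U`. Second order
equations in Sturm–Liouville form take this shape in every coordinate, with `f₁` the
quasi-derivative, and the Wronskian `f g₁ - f₁ g` does not depend on the coordinate. -/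
structure IsSystemSolution (ω q : ℂ → ℂ) (U : Set ℂ) (f f₁ : ℂ → ℂ) : Prop where
  hasDerivAt_fst : ∀ z ∈ U, HasDerivAt f (ω z * f₁ z) z
  hasDerivAt_snd : ∀ z ∈ U, HasDerivAt f₁ (q z * f z) z

namespace IsSystemSolution

variable {ω q : ℂ → ℂ} {U : Set ℂ} {f f₁ g g₁ : ℂ → ℂ} {z w : ℂ}

theorem congr {ω' q' : ℂ → ℂ} (hf : IsSystemSolution ω q U f f₁) (hω : EqOn ω ω' U)
    (hq : EqOn q q' U) : IsSystemSolution ω' q' U f f₁ where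
  hasDerivAt_fst z hz := hω hz ▸ hf.hasDerivAt_fst z hz
  hasDerivAt_snd z hz := hq hz ▸ hf.hasDerivAt_snd z hz

theorem comp {V : Set ℂ} {ζ ζ' : ℂ → ℂ} (hf : IsSystemSolution ω q V f f₁)
    (hζ : ∀ z ∈ U, HasDerivAt ζ (ζ' z) z) (hmaps : MapsTo ζ U V) :
    IsSystemSolution (fun z => ω (ζ z) * ζ' z) (fun z => q (ζ z) * ζ' z) U
      (fun z => f (ζ z)) (fun z => f₁ (ζ z)) where
  hasDerivAt_fst z hz :=
    ((hf.hasDerivAt_fst _ (hmaps hz)).comp z (hζ z hz)).congr_deriv (by ring)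
  hasDerivAt_snd z hz :=
    ((hf.hasDerivAt_snd _ (hmaps hz)).comp z (hζ z hz)).congr_deriv (by ring)

theorem wronskian_eq (hU : IsOpen U) (hconn : IsPreconnected U)
    (hf : IsSystemSolution ω q U f f₁) (hg : IsSystemSolution ω q U g g₁) (hz : z ∈ U)
    (hw : w ∈ U) : f z * g₁ z - f₁ z * g z = f w * g₁ w - f₁ w * g w := by
  have hderiv : ∀ y ∈ U, HasDerivAt (fun y => f y * g₁ y - f₁ y * g y) 0 y := fun y hy =>
    (((hf.hasDerivAt_fst y hy).fun_mul (hg.hasDerivAt_snd y hy)).fun_sub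
      ((hf.hasDerivAt_snd y hy).fun_mul (hg.hasDerivAt_fst y hy))).congr_deriv (by ring)
  exact hU.is_const_of_deriv_eq_zero hconn
    (fun y hy => (hderiv y hy).differentiableAt.differentiableWithinAt)
    (fun y hy => (hderiv y hy).deriv) hz hw

theorem eq_combination (hU : IsOpen U) (hconn : IsPreconnected U) {c c₁ s s₁ : ℂ → ℂ}
    (hf : IsSystemSolution ω q U f f₁) (hc : IsSystemSolution ω q U c c₁)
    (hs : IsSystemSolution ω q U s s₁) (hw : w ∈ U) (hcs : c w * s₁ w - c₁ w * s w = 1)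
    (hz : z ∈ U) :
    f z = (f w * s₁ w - f₁ w * s w) * c z + (f₁ w * c w - f w * c₁ w) * s z := by
  have hfs := hf.wronskian_eq hU hconn hs hz hw
  have hfc := hf.wronskian_eq hU hconn hc hz hw
  have hunit := hc.wronskian_eq hU hconn hs hz hw
  linear_combination c z * hfs - s z * hfc - f z * (hunit + hcs)

end IsSystemSolution

end Systems

section RadialSolutions

variable {Z : ℝ} {μ k : ℂ} {u v u₁ : ℂ → ℂ} {x y : ℂ}

theorem isOpen_radialDomain : IsOpen radialDomain :=
  Complex.isOpen_slitPlane.preimage (by fun_prop)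

theorem isPreconnected_radialDomain : IsPreconnected radialDomain := by
  have himage : radialDomain = (fun x => x - 1) '' Complex.slitPlane := by
    ext x
    exact ⟨fun hx => ⟨x + 1, hx, add_sub_cancel_right x 1⟩, by
      rintro ⟨y, hy, rfl⟩
      rwa [radialDomain, mem_ofPred_eq, sub_add_cancel]⟩
  rw [himage]
  exact (Complex.starConvex_one_slitPlane.isPathConnected
    Complex.one_mem_slitPlane).isConnected.isPreconnected.image _ (by fun_prop)

theorem zero_mem_radialDomain : (0 : ℂ) ∈ radialDomain := by
  rw [radialDomain, mem_ofPred_eq, zero_add]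
  exact Complex.one_mem_slitPlane

theorem IsRadialSolution.isSystemSolution (hu : IsRadialSolution Z μ k u) :
    IsSystemSolution (fun x => (x + 1)⁻¹) (fun x => -radialPotential Z μ k x) radialDomain u
      (fun x => (x + 1) * deriv u x) where
  hasDerivAt_fst x hx := (hu.analytic x hx).differentiableAt.hasDerivAt.congr_deriv
    (inv_mul_cancel_left₀ (Complex.slitPlane_ne_zero hx) _).symm
  hasDerivAt_snd x hx := by
    have hdiff : DifferentiableAt ℂ (fun y => (y + 1) * deriv u y) x :=
      DifferentiableAt.fun_mul (by fun_prop) (hu.analytic x hx).deriv.differentiableAt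
    exact hdiff.hasDerivAt.congr_deriv (by linear_combination hu.ode x hx)

theorem IsSystemSolution.isRadialSolution
    (hu : IsSystemSolution (fun x => (x + 1)⁻¹) (fun x => -radialPotential Z μ k x) radialDomain
      u u₁) : IsRadialSolution Z μ k u where
  analytic := DifferentiableOn.analyticOnNhd
    (fun x hx => (hu.hasDerivAt_fst x hx).differentiableAt.differentiableWithinAt)
    isOpen_radialDomain
  ode x hx := by
    have hquasi : (fun y => (y + 1) * deriv u y) =ᶠ[𝓝 x] u₁ := by
      filter_upwards [isOpen_radialDomain.mem_nhds hx] with y hy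
      rw [(hu.hasDerivAt_fst y hy).deriv, mul_inv_cancel_left₀ (Complex.slitPlane_ne_zero hy)]
    rw [hquasi.deriv_eq, (hu.hasDerivAt_snd x hx).deriv]
    ring

theorem IsRadialSolution.wronskian_eq (hu : IsRadialSolution Z μ k u)
    (hv : IsRadialSolution Z μ k v) (hx : x ∈ radialDomain) (hy : y ∈ radialDomain) :
    wronskian u v x = wronskian u v y := by
  have hconst := hu.isSystemSolution.wronskian_eq isOpen_radialDomain
    isPreconnected_radialDomain hv.isSystemSolution hx hy
  rw [wronskian, wronskian]
  linear_combination hconst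

end RadialSolutions

section FundamentalSystem

/-- The potential of the equation `v'' + q v = 0` in the variable `ξ = log (x + 1)`. -/
noncomputable def hyperbolicPotential (Z : ℝ) (μ k ξ : ℂ) : ℂ :=
  k ^ 2 * Complex.cosh ξ ^ 2 + Z * Complex.cosh ξ - μ

/-- The solution of the equation in the variable `ξ` with `v(0) = a` and `v'(0) = b`. -/
noncomputable def hyperbolicSolution (Z : ℝ) (μ a b : ℂ) : ℂ → ℂ → ℂ :=
  picardSum (hyperbolicPotential Z μ) a b

/-- The solution of the radial equation with `u(0) = a` and `u'(0) = b`. -/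
noncomputable def radialSolution (Z : ℝ) (μ a b k x : ℂ) : ℂ :=
  hyperbolicSolution Z μ a b k (Complex.log (x + 1))

variable {Z : ℝ} {μ a b k : ℂ} {u : ℂ → ℂ} {x : ℂ}

theorem isEntireFamily_hyperbolicPotential (Z : ℝ) (μ : ℂ) :
    IsEntireFamily (hyperbolicPotential Z μ) :=
  IsEntireFamily.of_uncurry (by unfold hyperbolicPotential; fun_prop)

theorem isEntireFamily_hyperbolicSolution (Z : ℝ) (μ a b : ℂ) :
    IsEntireFamily (hyperbolicSolution Z μ a b) :=
  isEntireFamily_picardSum (isEntireFamily_hyperbolicPotential Z μ) a b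

theorem hyperbolicSolution_zero : hyperbolicSolution Z μ a b k 0 = a :=
  picardSum_zero ..

theorem deriv_hyperbolicSolution_zero : deriv (hyperbolicSolution Z μ a b k) 0 = b :=
  deriv_picardSum_zero (isEntireFamily_hyperbolicPotential Z μ) k

theorem isSystemSolution_hyperbolicSolution :
    IsSystemSolution (fun _ => 1) (fun ξ => -hyperbolicPotential Z μ k ξ) univ
      (hyperbolicSolution Z μ a b k) (deriv (hyperbolicSolution Z μ a b k)) where
  hasDerivAt_fst z _ := ((isEntireFamily_hyperbolicSolution Z μ a b).differentiable k
    z).hasDerivAt.congr_deriv (one_mul _).symm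
  hasDerivAt_snd z _ := by
    have hdiff := ((isEntireFamily_hyperbolicSolution Z μ a b).differentiable k).analyticAt z
    refine hdiff.deriv.differentiableAt.hasDerivAt.congr_deriv ?_
    rw [neg_mul]
    exact deriv_deriv_picardSum (isEntireFamily_hyperbolicPotential Z μ) k z

theorem hyperbolicSolution_wronskian (z : ℂ) :
    hyperbolicSolution Z μ 1 0 k z * deriv (hyperbolicSolution Z μ 0 1 k) z -
      deriv (hyperbolicSolution Z μ 1 0 k) z * hyperbolicSolution Z μ 0 1 k z = 1 := by
  rw [isSystemSolution_hyperbolicSolution.wronskian_eq isOpen_univ isPreconnected_univ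
    isSystemSolution_hyperbolicSolution (mem_univ z) (mem_univ 0)]
  simp only [hyperbolicSolution_zero, deriv_hyperbolicSolution_zero, mul_one, mul_zero, sub_zero]

theorem hyperbolicPotential_log (hx : x + 1 ≠ 0) :
    hyperbolicPotential Z μ k (Complex.log (x + 1)) = (x + 1) * radialPotential Z μ k x := by
  have hcosh : Complex.cosh (Complex.log (x + 1)) = ((x + 1) + (x + 1)⁻¹) / 2 := by
    rw [Complex.cosh, Complex.exp_neg, Complex.exp_log hx]
  rw [hyperbolicPotential, hcosh, radialPotential]
  field_simp
  ring

theorem isSystemSolution_radialSolution :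
    IsSystemSolution (fun x => (x + 1)⁻¹) (fun x => -radialPotential Z μ k x) radialDomain
      (radialSolution Z μ a b k)
      (fun x => deriv (hyperbolicSolution Z μ a b k) (Complex.log (x + 1))) := by
  refine (isSystemSolution_hyperbolicSolution.comp
    (fun x (hx : x + 1 ∈ _) => (Complex.hasDerivAt_log hx).comp_add_const x 1)
    (mapsTo_univ _ _)).congr (fun x _ => one_mul _) fun x hx => ?_
  have hx' : x + 1 ≠ 0 := Complex.slitPlane_ne_zero hx
  simp only [hyperbolicPotential_log hx']
  field_simp

theorem isRadialSolution_radialSolution : IsRadialSolution Z μ k (radialSolution Z μ a b k) :=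
  isSystemSolution_radialSolution.isRadialSolution

theorem radialSolution_zero : radialSolution Z μ a b k 0 = a := by
  rw [radialSolution, zero_add, Complex.log_one, hyperbolicSolution_zero]

theorem deriv_radialSolution_zero : deriv (radialSolution Z μ a b k) 0 = b := by
  rw [(isSystemSolution_radialSolution.hasDerivAt_fst 0 zero_mem_radialDomain).deriv, zero_add,
    Complex.log_one, deriv_hyperbolicSolution_zero, inv_one, one_mul]

theorem IsRadialSolution.eq_combination (hu : IsRadialSolution Z μ k u) (hx : x ∈ radialDomain) :
    u x = u 0 * radialSolution Z μ 1 0 k x + deriv u 0 * radialSolution Z μ 0 1 k x := by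
  have hcomb := hu.isSystemSolution.eq_combination isOpen_radialDomain isPreconnected_radialDomain
    isRadialSolution_radialSolution.isSystemSolution
    isRadialSolution_radialSolution.isSystemSolution zero_mem_radialDomain
    (c := radialSolution Z μ 1 0 k) (s := radialSolution Z μ 0 1 k)
    (by simp only [radialSolution_zero, deriv_radialSolution_zero]; norm_num) hx
  simpa [radialSolution_zero, deriv_radialSolution_zero] using hcomb

theorem radialSolution_eq_combination (hx : x ∈ radialDomain) :
    radialSolution Z μ a b k x =
      a * radialSolution Z μ 1 0 k x + b * radialSolution Z μ 0 1 k x := by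
  rw [isRadialSolution_radialSolution.eq_combination hx, radialSolution_zero,
    deriv_radialSolution_zero]

theorem IsRadialSolution.eq_radialSolution (hu : IsRadialSolution Z μ k u)
    (hx : x ∈ radialDomain) : u x = radialSolution Z μ (u 0) (deriv u 0) k x :=
  (hu.eq_combination hx).trans (radialSolution_eq_combination hx).symm

end FundamentalSystem

/-! ### Asymptotics along rays -/

section LHopital

variable {g g' e e' : ℝ → ℂ} {a L : ℂ}

theorem tendsto_atTop_of_tendsto_deriv {f f' : ℝ → ℝ} {c : ℝ} (hc : 0 < c)
    (hf : ∀ᶠ t in atTop, HasDerivAt f (f' t) t) (hf' : Tendsto f' atTop (𝓝 c)) :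
    Tendsto f atTop atTop := by
  obtain ⟨T, hT⟩ := eventually_atTop.1 (hf.and (hf'.eventually (lt_mem_nhds (half_lt_self hc))))
  have hlower : ∀ t ≥ T, c / 2 * (t + -T) + f T ≤ f t := fun t ht => by
    have hslope := (convex_Ici T).mul_sub_le_image_sub_of_le_deriv (f := f) (C := c / 2)
      (fun s hs => (hT s hs).1.continuousAt.continuousWithinAt)
      (fun s hs => (hT s (interior_subset hs)).1.differentiableAt.differentiableWithinAt)
      (fun s hs => (hT s (interior_subset hs)).1.deriv ▸ (hT s (interior_subset hs)).2.le)
      T self_mem_Ici t ht ht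
    linarith
  exact tendsto_atTop_mono' _ ((eventually_ge_atTop T).mono hlower)
    (tendsto_atTop_add_const_right _ _
      ((tendsto_atTop_add_const_right _ (-T) tendsto_id).const_mul_atTop (half_pos hc)))

theorem hasDerivAt_re {f : ℝ → ℂ} {f' : ℂ} {t : ℝ} (hf : HasDerivAt f f' t) :
    HasDerivAt (fun t => (f t).re) f'.re t :=
  Complex.reCLM.hasFDerivAt.comp_hasDerivAt t hf

theorem norm_sub_mul_exp_le {T t ε : ℝ} (hε : 0 ≤ ε) (hTt : T ≤ t)
    (hg : ∀ s ≥ T, HasDerivAt g (g' s) s) (he : ∀ s ≥ T, HasDerivAt e (e' s) s)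
    (hle : ∀ s ≥ T, ‖g' s * Complex.exp (-e s) - e' s * L‖ ≤ ε * (e' s).re) :
    ‖g t - L * Complex.exp (e t)‖ ≤
      ‖g T - L * Complex.exp (e T)‖ + ε * Real.exp (e t).re := by
  have hdiff : ∀ s ≥ T, HasDerivAt (fun s => g s - L * Complex.exp (e s))
      ((g' s * Complex.exp (-e s) - e' s * L) * Complex.exp (e s)) s := fun s hs => by
    refine ((hg s hs).fun_sub ((he s hs).cexp.const_mul L)).congr_deriv ?_
    rw [sub_mul, mul_assoc (g' s), ← Complex.exp_add, neg_add_cancel, Complex.exp_zero]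
    ring
  have hbound : ∀ s ≥ T, HasDerivAt (fun s => ‖g T - L * Complex.exp (e T)‖ +
      ε * Real.exp (e s).re) (ε * (Real.exp (e s).re * (e' s).re)) s := fun s hs =>
    ((hasDerivAt_re (he s hs)).exp.const_mul ε).const_add _
  refine image_norm_le_of_norm_deriv_right_le_deriv_boundary'
    (B := fun s => ‖g T - L * Complex.exp (e T)‖ + ε * Real.exp (e s).re)
    (B' := fun s => ε * (Real.exp (e s).re * (e' s).re))
    (fun s hs => (hdiff s hs.1).continuousAt.continuousWithinAt)
    (fun s hs => (hdiff s hs.1).hasDerivWithinAt) (le_add_of_nonneg_right (by positivity))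
    (fun s hs => (hbound s hs.1).continuousAt.continuousWithinAt)
    (fun s hs => (hbound s hs.1).hasDerivWithinAt) (fun s hs => ?_) (right_mem_Icc.2 hTt)
  rw [norm_mul, Complex.norm_exp]
  calc _ ≤ ε * (e' s).re * Real.exp (e s).re := by gcongr; exact hle s hs.1
    _ = _ := by ring

/-- L'Hôpital's rule for `g / exp e`, which needs a growing exponential because the mean value
theorem is not available for complex-valued functions. -/
theorem tendsto_mul_exp_neg (ha : 0 < a.re) (hg : ∀ᶠ t in atTop, HasDerivAt g (g' t) t)
    (he : ∀ᶠ t in atTop, HasDerivAt e (e' t) t) (he' : Tendsto e' atTop (𝓝 a))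
    (hlim : Tendsto (fun t => g' t * Complex.exp (-e t)) atTop (𝓝 (a * L))) :
    Tendsto (fun t => g t * Complex.exp (-e t)) atTop (𝓝 L) := by
  have hre : Tendsto (fun t => (e' t).re) atTop (𝓝 a.re) :=
    (Complex.continuous_re.tendsto a).comp he'
  have hdecay : Tendsto (fun t => Real.exp (-(e t).re)) atTop (𝓝 0) :=
    Real.tendsto_exp_neg_atTop_nhds_zero.comp
      (tendsto_atTop_of_tendsto_deriv ha (he.mono fun t => hasDerivAt_re) hre)
  have herror : Tendsto (fun t => ‖g' t * Complex.exp (-e t) - e' t * L‖) atTop (𝓝 0) := by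
    simpa only [sub_self, norm_zero] using (hlim.sub (he'.mul_const L)).norm
  rw [Metric.tendsto_atTop']
  intro ε hε
  have hsmall : ∀ᶠ t in atTop, ‖g' t * Complex.exp (-e t) - e' t * L‖ < ε / 2 * (e' t).re :=
    herror.eventually_lt (hre.const_mul _) (by positivity)
  obtain ⟨T, hT⟩ := eventually_atTop.1 (hg.and (he.and hsmall))
  have hconst : ∀ᶠ t in atTop,
      ‖g T - L * Complex.exp (e T)‖ * Real.exp (-(e t).re) < ε / 2 := by
    refine (hdecay.const_mul _).eventually (gt_mem_nhds ?_)
    rw [mul_zero]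
    exact half_pos hε
  obtain ⟨T', hT'⟩ := eventually_atTop.1 hconst
  refine ⟨max T T', fun t ht => ?_⟩
  have hbound := norm_sub_mul_exp_le (L := L) (half_pos hε).le ((le_max_left _ _).trans ht.le)
    (fun s hs => (hT s hs).1) (fun s hs => (hT s hs).2.1) (fun s hs => (hT s hs).2.2.le)
  have hcancel : g t * Complex.exp (-e t) - L =
      (g t - L * Complex.exp (e t)) * Complex.exp (-e t) := by
    rw [sub_mul, mul_assoc L, ← Complex.exp_add, add_neg_cancel, Complex.exp_zero, mul_one]
  rw [dist_eq_norm, hcancel, norm_mul, Complex.norm_exp, Complex.neg_re]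
  calc _ ≤ (‖g T - L * Complex.exp (e T)‖ + ε / 2 * Real.exp (e t).re) *
        Real.exp (-(e t).re) := by gcongr
    _ = ‖g T - L * Complex.exp (e T)‖ * Real.exp (-(e t).re) + ε / 2 := by
        rw [add_mul, mul_assoc (ε / 2), ← Real.exp_add, add_neg_cancel, Real.exp_zero, mul_one]
    _ < ε := by linarith [hT' t ((le_max_right _ _).trans ht.le)]

end LHopital

section Rays

/-- The point at distance `t` from the origin on the ray of argument `γ`. -/
noncomputable def rayPoint (γ t : ℝ) : ℂ := Complex.exp (Complex.I * γ) * t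

variable {γ t : ℝ}

theorem rayPoint_zero (t : ℝ) : rayPoint 0 t = t := by
  rw [rayPoint, Complex.ofReal_zero, mul_zero, Complex.exp_zero, one_mul]

theorem hasDerivAt_rayPoint (γ t : ℝ) :
    HasDerivAt (rayPoint γ) (Complex.exp (Complex.I * γ)) t :=
  (Complex.ofRealCLM.hasDerivAt.const_mul _).congr_deriv (mul_one _)

theorem norm_rayPoint (ht : 0 < t) : ‖rayPoint γ t‖ = t := by
  rw [rayPoint, norm_mul, mul_comm Complex.I, Complex.norm_exp_ofReal_mul_I, one_mul,
    Complex.norm_real, Real.norm_of_nonneg ht.le]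

theorem tendsto_rayPoint (γ : ℝ) : Tendsto (rayPoint γ) atTop (Bornology.cobounded ℂ) := by
  rw [← tendsto_norm_atTop_iff_cobounded]
  exact tendsto_id.congr' ((eventually_gt_atTop 0).mono fun t ht => (norm_rayPoint ht).symm)

theorem log_exp_I_mul (hγ : γ ∈ Ioo (-Real.pi) Real.pi) :
    Complex.log (Complex.exp (Complex.I * γ)) = Complex.I * γ :=
  Complex.log_exp (by simpa using hγ.1) (by simpa using hγ.2.le)

theorem exp_I_mul_mem_slitPlane (hγ : γ ∈ Ioo (-Real.pi) Real.pi) :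
    Complex.exp (Complex.I * γ) ∈ Complex.slitPlane := by
  rw [Complex.mem_slitPlane_iff_arg, ← Complex.log_im, log_exp_I_mul hγ, Complex.I_mul_im,
    Complex.ofReal_re]
  exact ⟨hγ.2.ne, Complex.exp_ne_zero _⟩

theorem rayPoint_mem_slitPlane (hγ : γ ∈ Ioo (-Real.pi) Real.pi) (ht : 0 < t) :
    rayPoint γ t ∈ Complex.slitPlane := by
  have hunit := exp_I_mul_mem_slitPlane hγ
  rw [Complex.mem_slitPlane_iff] at hunit ⊢
  rw [rayPoint, Complex.re_mul_ofReal, Complex.im_mul_ofReal]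
  exact hunit.imp (fun hre => by positivity) fun him => by positivity

theorem rayPoint_mem_radialDomain (hγ : γ ∈ Ioo (-Real.pi) Real.pi) (ht : 0 < t) :
    rayPoint γ t ∈ radialDomain :=
  add_one_mem_slitPlane (rayPoint_mem_slitPlane hγ ht)

theorem tendsto_log_rayPoint (hγ : γ ∈ Ioo (-Real.pi) Real.pi) :
    Tendsto (fun t : ℝ => Complex.log (rayPoint γ t + 1) - Real.log t) atTop
      (𝓝 (Complex.I * γ)) := by
  have hdirection : Tendsto (fun t : ℝ => Complex.exp (Complex.I * γ) + (t⁻¹ : ℝ)) atTop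
      (𝓝 (Complex.exp (Complex.I * γ))) := by
    simpa using! ((Complex.continuous_ofReal.tendsto 0).comp tendsto_inv_atTop_zero).const_add
      (Complex.exp (Complex.I * γ))
  have hlog := (continuousAt_clog (exp_I_mul_mem_slitPlane hγ)).tendsto.comp hdirection
  rw [log_exp_I_mul hγ] at hlog
  refine hlog.congr' ?_
  filter_upwards [eventually_gt_atTop 0] with t ht
  have hfactor : rayPoint γ t + 1 = t * (Complex.exp (Complex.I * γ) + (t⁻¹ : ℝ)) := by
    rw [rayPoint, Complex.ofReal_inv, mul_add,
      mul_inv_cancel₀ (Complex.ofReal_ne_zero.2 ht.ne'), mul_comm]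
  have hne := Complex.slitPlane_ne_zero (rayPoint_mem_radialDomain hγ ht)
  rw [hfactor] at hne
  rw [hfactor, Complex.log_ofReal_mul ht (right_ne_zero_of_mul hne), add_sub_cancel_left]
  rfl

theorem im_exp_mul_exp (κ : ℂ) (γ : ℝ) : (Complex.exp κ * Complex.exp (Complex.I * γ)).im =
    Real.exp κ.re * Real.sin (κ.im + γ) := by
  rw [← Complex.exp_add, Complex.exp_im]
  simp

theorem im_exp_mul_exp_pos {κ : ℂ} (hκγ : κ.im + γ ∈ Ioo 0 Real.pi) :
    0 < (Complex.exp κ * Complex.exp (Complex.I * γ)).im := by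
  rw [im_exp_mul_exp]
  exact mul_pos (Real.exp_pos _) (Real.sin_pos_of_mem_Ioo hκγ)

end Rays

section JostLimit

/-- The inverse of the leading behaviour `(x + 1)^{-1/2} exp (I * leadingPhase Z p x)` of a
solution at infinity. -/
noncomputable def jostFactor (Z : ℝ) (p x : ℂ) : ℂ :=
  Complex.exp (Complex.log (x + 1) / 2 - Complex.I * leadingPhase Z p x)

/-- `u` is asymptotic to `n * (x + 1)^{-1/2} exp (I * leadingPhase Z p x)` along the ray of
argument `γ`. -/
def HasJostLimit (Z : ℝ) (p : ℂ) (γ : ℝ) (u : ℂ → ℂ) (n : ℂ) : Prop :=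
  Tendsto (fun t => u (rayPoint γ t) * jostFactor Z p (rayPoint γ t)) atTop (𝓝 n)

variable {Z : ℝ} {μ p k n L : ℂ} {γ : ℝ} {u s : ℂ → ℂ} {g g' : ℝ → ℂ} {x : ℂ}

theorem jostFactor_ne_zero : jostFactor Z p x ≠ 0 := Complex.exp_ne_zero _

theorem jostFactor_neg : jostFactor Z (-p) x =
    Complex.exp (2 * Complex.I * leadingPhase Z p x) * jostFactor Z p x := by
  rw [jostFactor, jostFactor, leadingPhase_neg, ← Complex.exp_add]
  ring_nf

theorem exp_mul_jostFactor_sq (hx : x + 1 ≠ 0) :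
    Complex.exp (2 * Complex.I * leadingPhase Z p x) * jostFactor Z p x ^ 2 = x + 1 := by
  rw [sq, ← mul_assoc, ← jostFactor_neg, jostFactor, jostFactor, leadingPhase_neg,
    ← Complex.exp_add]
  ring_nf
  rw [Complex.exp_log (by rwa [add_comm]), add_comm]

theorem hasDerivAt_leadingPhase (hx : x ∈ radialDomain) :
    HasDerivAt (leadingPhase Z p) (p / 2 + Z / (2 * p) * (x + 1)⁻¹) x := by
  have hlog := (Complex.hasDerivAt_log hx).comp_add_const x 1
  refine (((((hasDerivAt_id x).add_const 1).const_mul p).div_const 2).fun_add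
    (hlog.const_mul (Z / (2 * p)))).congr_deriv ?_
  rw [mul_one]

theorem tendsto_mul_exp_leadingPhase (hγ : γ ∈ Ioo (-Real.pi) Real.pi)
    (hp : 0 < (p * Complex.exp (Complex.I * γ)).im)
    (hg : ∀ᶠ t in atTop, HasDerivAt g (g' t) t)
    (hlim : Tendsto (fun t => g' t * Complex.exp (2 * Complex.I * leadingPhase Z p (rayPoint γ t)))
      atTop (𝓝 (-(Complex.I * (p * Complex.exp (Complex.I * γ))) * L))) :
    Tendsto (fun t => g t * Complex.exp (2 * Complex.I * leadingPhase Z p (rayPoint γ t))) atTop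
      (𝓝 L) := by
  have hderiv : ∀ᶠ t in atTop, HasDerivAt
      (fun t => -(2 * Complex.I * leadingPhase Z p (rayPoint γ t)))
      (-(2 * Complex.I * ((p / 2 + Z / (2 * p) * (rayPoint γ t + 1)⁻¹) *
        Complex.exp (Complex.I * γ)))) t := by
    filter_upwards [eventually_gt_atTop 0] with t ht
    exact (((hasDerivAt_leadingPhase (rayPoint_mem_radialDomain hγ ht)).scomp t
      (hasDerivAt_rayPoint γ t)).const_mul (2 * Complex.I)).fun_neg.congr_deriv
        (by rw [smul_eq_mul]; ring)
  have hslope := (((((tendsto_inv_add_one_cobounded.comp (tendsto_rayPoint γ)).const_mul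
    (Z / (2 * p))).const_add (p / 2)).mul_const (Complex.exp (Complex.I * γ))).const_mul
      (2 * Complex.I)).neg
  refine (tendsto_mul_exp_neg (a := -(Complex.I * (p * Complex.exp (Complex.I * γ)))) ?_ hg hderiv
    (hslope.trans_eq ?_) ?_).congr fun t => by rw [neg_neg]
  · rwa [Complex.neg_re, Complex.I_mul_re, neg_neg]
  · congr 1
    ring
  · simpa only [neg_neg] using hlim

theorem IsRadialSolution.hasDerivAt_div (hu : IsRadialSolution Z μ k u)
    (hs : IsRadialSolution Z μ k s) (hx : x ∈ radialDomain) (hux : u x ≠ 0) :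
    HasDerivAt (fun x => s x / u x) (wronskian u s 0 / ((x + 1) * u x ^ 2)) x := by
  have hx' : x + 1 ≠ 0 := Complex.slitPlane_ne_zero hx
  refine ((hs.analytic x hx).differentiableAt.hasDerivAt.fun_div
    (hu.analytic x hx).differentiableAt.hasDerivAt hux).congr_deriv ?_
  rw [hu.wronskian_eq hs zero_mem_radialDomain hx, wronskian, mul_div_mul_left _ _ hx']
  ring

theorem ne_zero_of_im_mul_pos {p q : ℂ} (hp : 0 < (p * q).im) : p ≠ 0 := by
  rintro rfl
  rw [zero_mul, Complex.zero_im] at hp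
  exact hp.false

theorem HasJostLimit.tendsto_deriv_div_mul_exp (hγ : γ ∈ Ioo (-Real.pi) Real.pi) (hn : n ≠ 0)
    (hlim : HasJostLimit Z p γ u n) (w : ℂ) :
    Tendsto (fun t => w / ((rayPoint γ t + 1) * u (rayPoint γ t) ^ 2) *
      Complex.exp (2 * Complex.I * leadingPhase Z p (rayPoint γ t))) atTop (𝓝 (w / n ^ 2)) := by
  refine (((hlim.pow 2).inv₀ (pow_ne_zero 2 hn)).const_mul w).congr' ?_
  filter_upwards [hlim.eventually_ne hn, eventually_gt_atTop 0] with t hut ht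
  have hu : u (rayPoint γ t) ≠ 0 := left_ne_zero_of_mul hut
  have hfactor : jostFactor Z p (rayPoint γ t) ≠ 0 := jostFactor_ne_zero
  rw [← exp_mul_jostFactor_sq (Z := Z) (p := p)
    (Complex.slitPlane_ne_zero (rayPoint_mem_radialDomain hγ ht))]
  field_simp

theorem HasJostLimit.of_wronskian (hu : IsRadialSolution Z μ k u) (hs : IsRadialSolution Z μ k s)
    (hγ : γ ∈ Ioo (-Real.pi) Real.pi) (hp : 0 < (p * Complex.exp (Complex.I * γ)).im)
    (hn : n ≠ 0) (hlim : HasJostLimit Z p γ u n) :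
    HasJostLimit Z (-p) γ s (wronskian u s 0 / (-(Complex.I * p) * n)) := by
  have hp₀ : p ≠ 0 := ne_zero_of_im_mul_pos hp
  have hu₀ : ∀ᶠ t in atTop, u (rayPoint γ t) ≠ 0 :=
    (hlim.eventually_ne hn).mono fun t ht => left_ne_zero_of_mul ht
  have hderiv : ∀ᶠ t in atTop, HasDerivAt (fun t => s (rayPoint γ t) / u (rayPoint γ t))
      (Complex.exp (Complex.I * γ) *
        (wronskian u s 0 / ((rayPoint γ t + 1) * u (rayPoint γ t) ^ 2))) t := by
    filter_upwards [hu₀, eventually_gt_atTop 0] with t hut ht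
    exact (hu.hasDerivAt_div hs (rayPoint_mem_radialDomain hγ ht) hut).scomp t
      (hasDerivAt_rayPoint γ t)
  have hslope := (hlim.tendsto_deriv_div_mul_exp hγ hn (wronskian u s 0)).const_mul
    (Complex.exp (Complex.I * γ))
  have hrate : Complex.exp (Complex.I * γ) * (wronskian u s 0 / n ^ 2) =
      -(Complex.I * (p * Complex.exp (Complex.I * γ))) *
        (wronskian u s 0 / (-(Complex.I * p) * n ^ 2)) := by
    field_simp
  rw [hrate] at hslope
  have hquotient := (tendsto_mul_exp_leadingPhase hγ hp hderiv
    (hslope.congr fun t => (mul_assoc _ _ _).symm)).mul hlim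
  have hvalue : wronskian u s 0 / (-(Complex.I * p) * n ^ 2) * n =
      wronskian u s 0 / (-(Complex.I * p) * n) := by
    field_simp
  rw [hvalue] at hquotient
  refine Tendsto.congr' ?_ hquotient
  filter_upwards [hu₀] with t hut
  rw [jostFactor_neg]
  field_simp

theorem HasJostLimit.neg_zero (hγ : γ ∈ Ioo (-Real.pi) Real.pi)
    (hp : 0 < (p * Complex.exp (Complex.I * γ)).im) (hlim : HasJostLimit Z p γ u n) :
    HasJostLimit Z (-p) γ u 0 := by
  have hdecay := tendsto_mul_exp_leadingPhase (Z := Z) (g := fun _ => 1) (g' := fun _ => 0)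
    (L := 0) hγ hp (.of_forall fun t => hasDerivAt_const t 1)
    (by simp only [zero_mul, mul_zero]; exact tendsto_const_nhds)
  have hproduct := hdecay.mul hlim
  rw [zero_mul] at hproduct
  refine hproduct.congr fun t => ?_
  rw [jostFactor_neg, one_mul]
  ring

theorem HasJostLimit.eq_initial_values (hu : IsRadialSolution Z μ k u)
    (hs : IsRadialSolution Z μ k s) (hγ : γ ∈ Ioo (-Real.pi) Real.pi)
    (hp : 0 < (p * Complex.exp (Complex.I * γ)).im) (hn : n ≠ 0)
    (hulim : HasJostLimit Z p γ u n) (hslim : HasJostLimit Z p γ s n) :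
    u 0 = s 0 ∧ deriv u 0 = deriv s 0 := by
  have hwronskian : wronskian u s 0 = 0 :=
    (div_eq_zero_iff.1 (tendsto_nhds_unique (hulim.of_wronskian hu hs hγ hp hn)
      (hslim.neg_zero hγ hp))).resolve_right
        (mul_ne_zero (neg_ne_zero.2 (mul_ne_zero Complex.I_ne_zero (ne_zero_of_im_mul_pos hp))) hn)
  rw [wronskian, zero_add, one_mul] at hwronskian
  have hproportional : ∀ a b : ℂ, (∀ x ∈ radialDomain, a * s x = b * u x) → a = b :=
    fun a b hab => by
    refine mul_right_cancel₀ hn (tendsto_nhds_unique_of_eventuallyEq (hslim.const_mul a)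
      (hulim.const_mul b) ?_)
    filter_upwards [eventually_gt_atTop 0] with t ht
    rw [← mul_assoc, ← mul_assoc, hab _ (rayPoint_mem_radialDomain hγ ht)]
  constructor
  · refine hproportional _ _ fun x hx => ?_
    rw [hu.eq_combination hx, hs.eq_combination hx]
    linear_combination radialSolution Z μ 0 1 k x * hwronskian
  · refine hproportional _ _ fun x hx => ?_
    rw [hu.eq_combination hx, hs.eq_combination hx]
    linear_combination -radialSolution Z μ 1 0 k x * hwronskian

end JostLimit

/-! ### Jost solutions -/

section JostEquation

/-- The exponent `Z / (2 k)` of the power of `x + 1` in the Jost asymptotics, in the coordinate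
`κ = log k`. -/
noncomputable def jostExponent (Z : ℝ) (κ : ℂ) : ℂ := Z / (2 * Complex.exp κ)

/-- The weight `p` of the equation `(p m')' + p V m = 0` for the amplitude `m` of a Jost solution
in the variable `z = exp κ * (x + 1)`. -/
noncomputable def jostWeight (Z : ℝ) (κ z : ℂ) : ℂ :=
  Complex.exp (Complex.I * z + 2 * Complex.I * jostExponent Z κ * upperLog z)

/-- The short range potential `V` of the equation `(p m')' + p V m = 0` for the amplitude of a Jost
solution. -/
noncomputable def jostRemainder (Z : ℝ) (μ κ z : ℂ) : ℂ :=
  (Complex.exp κ ^ 2 / 2 - μ + 1 / 4 - jostExponent Z κ ^ 2 - Complex.I * jostExponent Z κ) / z ^ 2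
    + Z * Complex.exp κ / 2 / z ^ 3 + Complex.exp κ ^ 4 / 4 / z ^ 4

/-- A bound for the exponent and the remainder of the Jost equation. -/
noncomputable def jostBound (Z : ℝ) (μ κ : ℂ) : ℝ :=
  ‖jostExponent Z κ‖ + 4 * (‖Complex.exp κ ^ 2 / 2 - μ + 1 / 4 - jostExponent Z κ ^ 2 -
    Complex.I * jostExponent Z κ‖ + ‖Z * Complex.exp κ / 2‖ + ‖Complex.exp κ ^ 4 / 4‖)

variable {Z : ℝ} {μ κ z w : ℂ} {R B : ℝ} {i : ℕ}

@[fun_prop]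
theorem differentiable_jostExponent : Differentiable ℂ (jostExponent Z) := by
  unfold jostExponent
  exact (differentiable_const _).fun_div (by fun_prop) fun κ =>
    mul_ne_zero two_ne_zero (Complex.exp_ne_zero κ)

theorem continuous_jostBound : Continuous (jostBound Z μ) := by
  have hexponent := (differentiable_jostExponent (Z := Z)).continuous
  unfold jostBound
  fun_prop

theorem norm_jostWeight_add_mul_I_le (hz : 0 < height z) (ha : 8 * ‖jostExponent Z κ‖ ≤ height z)
    {s : ℝ} (hs : 0 ≤ s) :
    ‖jostWeight Z κ (z + s * Complex.I)‖ ≤ ‖jostWeight Z κ z‖ * Real.exp (-(1 / 2) * s) := by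
  have hsplit : jostWeight Z κ (z + s * Complex.I) = jostWeight Z κ z * Complex.exp (-s +
      2 * Complex.I * jostExponent Z κ * (upperLog (z + s * Complex.I) - upperLog z)) := by
    rw [jostWeight, jostWeight, ← Complex.exp_add]
    congr 1
    linear_combination (s : ℂ) * Complex.I_mul_I
  have hpower : (2 * Complex.I * jostExponent Z κ *
      (upperLog (z + s * Complex.I) - upperLog z)).re ≤ 1 / 2 * s := by
    refine (Complex.re_le_norm _).trans ?_
    rw [norm_mul, norm_mul, norm_mul, Complex.norm_two, Complex.norm_I, mul_one]
    calc _ ≤ 2 * ‖jostExponent Z κ‖ * (2 / height z * s) := by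
          gcongr
          exact norm_upperLog_add_mul_I_sub_le hz hs
      _ = 8 * ‖jostExponent Z κ‖ / height z * (1 / 2 * s) := by ring
      _ ≤ 1 * (1 / 2 * s) := by
          gcongr
          exact (div_le_one hz).2 ha
      _ = 1 / 2 * s := one_mul _
  rw [hsplit, norm_mul, Complex.norm_exp, Complex.add_re, Complex.neg_re, Complex.ofReal_re]
  gcongr
  linarith

theorem hasDerivAt_jostWeight (hz : 0 < height z) : HasDerivAt (jostWeight Z κ)
    (jostWeight Z κ z * (Complex.I + 2 * Complex.I * jostExponent Z κ / z)) z := by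
  refine (((hasDerivAt_id z).const_mul Complex.I).fun_add
    ((hasDerivAt_upperLog hz).const_mul (2 * Complex.I * jostExponent Z κ))).cexp.congr_deriv ?_
  rw [mul_one, div_eq_mul_inv]
  rfl

theorem norm_div_pow_le (hz : 2 ≤ height z) (hi : 2 ≤ i) :
    ‖w / z ^ i‖ ≤ ‖w‖ * (4 / height z ^ 2) := by
  have hnorm := height_le_two_mul_norm z
  have hz₁ : 1 ≤ ‖z‖ := by linarith
  rw [norm_div, norm_pow, div_eq_mul_inv]
  gcongr
  rw [inv_eq_one_div, div_le_div_iff₀ (pow_pos (one_pos.trans_le hz₁) i)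
    (pow_pos (two_pos.trans_le hz) 2), one_mul]
  calc height z ^ 2 ≤ (2 * ‖z‖) ^ 2 := by gcongr
    _ = 4 * ‖z‖ ^ 2 := by ring
    _ ≤ 4 * ‖z‖ ^ i := by gcongr

theorem norm_jostRemainder_le (hz : 2 ≤ height z) :
    ‖jostRemainder Z μ κ z‖ ≤ jostBound Z μ κ / height z ^ 2 := by
  refine (norm_add₃_le.trans (add_le_add_three (norm_div_pow_le hz le_rfl)
    (norm_div_pow_le hz (by norm_num)) (norm_div_pow_le hz (by norm_num)))).trans ?_
  rw [← add_mul, ← add_mul, mul_div_assoc', jostBound]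
  gcongr
  linarith [norm_nonneg (jostExponent Z κ)]

theorem isVolterraPair_jost (hB : jostBound Z μ κ ≤ B) :
    IsVolterraPair (8 * B + 2) B (jostWeight Z κ) (jostRemainder Z μ κ) := by
  have hexponent : ‖jostExponent Z κ‖ ≤ B := (le_add_of_nonneg_right (by positivity)).trans hB
  have hB₀ : 0 ≤ B := (norm_nonneg _).trans hexponent
  have hheight : ∀ z ∈ aboveWedge (8 * B + 2), 8 * B + 2 < height z := fun z hz => hz
  refine ⟨by positivity, hB₀, by linarith, fun z hz => ?_, fun z _ => Complex.exp_ne_zero _,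
    fun z hz s hs => ?_, fun z hz => ?_, fun z hz => ?_⟩
  · exact (hasDerivAt_jostWeight
      (by linarith [hheight z hz])).differentiableAt.differentiableWithinAt
  · exact norm_jostWeight_add_mul_I_le (by linarith [hheight z hz])
      (by linarith [hheight z hz]) hs
  · have hz₀ : z ≠ 0 := ne_zero_of_height_pos (by linarith [hheight z hz])
    unfold jostRemainder
    exact DifferentiableAt.differentiableWithinAt (by fun_prop (disch := positivity))
  · exact (norm_jostRemainder_le (by linarith [hheight z hz])).trans (by gcongr)

theorem exists_isVolterraPair_jost (Z : ℝ) (μ κ₀ : ℂ) : ∃ R B, ∀ κ ∈ ball κ₀ 1,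
    IsVolterraPair R B (jostWeight Z κ) (jostRemainder Z μ κ) := by
  obtain ⟨B, hB⟩ := (isCompact_closedBall κ₀ 1).bddAbove_image
    (continuous_jostBound (Z := Z) (μ := μ)).continuousOn
  exact ⟨8 * B + 2, B, fun κ hκ =>
    isVolterraPair_jost (hB (mem_image_of_mem _ (ball_subset_closedBall hκ)))⟩

end JostEquation

section JostWave

/-- The exponential and power factors of the Jost solution. -/
noncomputable def jostPrefactor (Z : ℝ) (κ z : ℂ) : ℂ :=
  Complex.exp (Complex.I * z / 2 + (Complex.I * jostExponent Z κ - 1 / 2) * (upperLog z - κ))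

/-- The Jost solution in the variable `z = exp κ * (x + 1)`. -/
noncomputable def jostWave (Z : ℝ) (μ κ z : ℂ) : ℂ :=
  jostPrefactor Z κ z * jostAmplitude (jostWeight Z κ) (jostRemainder Z μ κ) z

/-- The logarithmic derivative `z d/dz` of `jostWave Z μ κ`. -/
noncomputable def jostWaveDeriv (Z : ℝ) (μ κ z : ℂ) : ℂ :=
  jostPrefactor Z κ z * ((Complex.I * z / 2 + Complex.I * jostExponent Z κ - 1 / 2) *
    jostAmplitude (jostWeight Z κ) (jostRemainder Z μ κ) z +
      z * deriv (jostAmplitude (jostWeight Z κ) (jostRemainder Z μ κ)) z)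

/-- The Wronskian of the Jost solution with `hyperbolicSolution Z μ a b (exp κ)`, evaluated at
`z`. -/
noncomputable def jostConnection (Z : ℝ) (μ a b κ z : ℂ) : ℂ :=
  jostWave Z μ κ z * deriv (hyperbolicSolution Z μ a b (Complex.exp κ)) (upperLog z - κ) -
    jostWaveDeriv Z μ κ z * hyperbolicSolution Z μ a b (Complex.exp κ) (upperLog z - κ)

variable {Z : ℝ} {μ a b κ κ₀ z w x : ℂ} {R B γ : ℝ}

theorem hyperbolicPotential_upperLog (hz : z ≠ 0) :
    hyperbolicPotential Z μ (Complex.exp κ) (upperLog z - κ) =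
      z ^ 2 / 4 + jostExponent Z κ * z + Complex.exp κ ^ 2 / 2 - μ +
        Z * Complex.exp κ / 2 / z + Complex.exp κ ^ 4 / 4 / z ^ 2 := by
  have hp := Complex.exp_ne_zero κ
  have hcosh : Complex.cosh (upperLog z - κ) = (z / Complex.exp κ + Complex.exp κ / z) / 2 := by
    rw [Complex.cosh, neg_sub, Complex.exp_sub, Complex.exp_sub, exp_upperLog hz]
  rw [hyperbolicPotential, hcosh, jostExponent]
  field_simp
  ring

theorem hasDerivAt_jostPrefactor (hz : 0 < height z) : HasDerivAt (jostPrefactor Z κ)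
    (jostPrefactor Z κ z * (Complex.I / 2 + (Complex.I * jostExponent Z κ - 1 / 2) / z)) z := by
  refine ((((hasDerivAt_id z).const_mul Complex.I).div_const 2).fun_add
    (((hasDerivAt_upperLog hz).sub_const κ).const_mul
      (Complex.I * jostExponent Z κ - 1 / 2))).cexp.congr_deriv ?_
  rw [mul_one, div_eq_mul_inv _ z]
  rfl

theorem isSystemSolution_jostWave
    (h : IsVolterraPair R B (jostWeight Z κ) (jostRemainder Z μ κ)) :
    IsSystemSolution (fun z => z⁻¹)
      (fun z => -hyperbolicPotential Z μ (Complex.exp κ) (upperLog z - κ) * z⁻¹) (aboveWedge R)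
      (jostWave Z μ κ) (jostWaveDeriv Z μ κ) := by
  have hamplitude : ∀ z ∈ aboveWedge R,
      HasDerivAt (jostAmplitude (jostWeight Z κ) (jostRemainder Z μ κ))
        (deriv (jostAmplitude (jostWeight Z κ) (jostRemainder Z μ κ)) z) z := fun z hz =>
    (h.differentiableOn_jostAmplitude.differentiableAt
      ((isOpen_aboveWedge R).mem_nhds hz)).hasDerivAt
  constructor <;> intro z hz
  · have hz₀ : z ≠ 0 := ne_zero_of_height_pos (h.height_pos hz)
    refine ((hasDerivAt_jostPrefactor (h.height_pos hz)).fun_mul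
      (hamplitude z hz)).congr_deriv ?_
    rw [jostWaveDeriv]
    field_simp
    ring
  · have hz₀ : z ≠ 0 := ne_zero_of_height_pos (h.height_pos hz)
    have hweight := (hasDerivAt_jostWeight (Z := Z) (κ := κ) (h.height_pos hz)).deriv
    have hderiv₂ := ((h.differentiableOn_jostAmplitude.deriv
      (isOpen_aboveWedge R)).differentiableAt ((isOpen_aboveWedge R).mem_nhds hz)).hasDerivAt
    rw [h.deriv_deriv_jostAmplitude hz, hweight,
      mul_div_cancel_left₀ _ (h.weight_ne_zero z hz)] at hderiv₂
    have hid := hasDerivAt_id z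
    refine ((hasDerivAt_jostPrefactor (h.height_pos hz)).fun_mul
      ((((((hid.const_mul Complex.I).div_const 2).add_const
        (Complex.I * jostExponent Z κ)).sub_const (1 / 2)).fun_mul
          (hamplitude z hz)).fun_add (hid.fun_mul hderiv₂))).congr_deriv ?_
    rw [hyperbolicPotential_upperLog hz₀, jostWave, jostRemainder]
    simp only [id]
    field_simp
    ring_nf
    simp only [Complex.I_sq]
    ring

theorem isSystemSolution_hyperbolicSolution_upperLog (hR : 0 ≤ R) :
    IsSystemSolution (fun z => z⁻¹)
      (fun z => -hyperbolicPotential Z μ (Complex.exp κ) (upperLog z - κ) * z⁻¹) (aboveWedge R)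
      (fun z => hyperbolicSolution Z μ a b (Complex.exp κ) (upperLog z - κ))
      (fun z => deriv (hyperbolicSolution Z μ a b (Complex.exp κ)) (upperLog z - κ)) :=
  (isSystemSolution_hyperbolicSolution.comp
    (fun _ hz => (hasDerivAt_upperLog (hR.trans_lt hz)).sub_const κ) (mapsTo_univ _ _)).congr
      (fun _ _ => one_mul _) (fun _ _ => rfl)

theorem isPreconnected_aboveWedge (R : ℝ) : IsPreconnected (aboveWedge R) := by
  have hunion : aboveWedge R = {z | R < z.im + z.re} ∪ {z | R < z.im - z.re} := by
    ext z
    change R < z.im + |z.re| ↔ R < z.im + z.re ∨ R < z.im - z.re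
    rw [← sub_lt_iff_lt_add', lt_abs, sub_lt_iff_lt_add', sub_lt_iff_lt_add', ← sub_eq_add_neg]
  rw [hunion]
  exact IsPreconnected.union ((R + 1 : ℝ) * Complex.I) (by simp) (by simp)
    (convex_halfSpace_gt (f := fun z : ℂ => z.im + z.re)
      (Complex.imLm + Complex.reLm).isLinear R).isPreconnected
    (convex_halfSpace_gt (f := fun z : ℂ => z.im - z.re)
      (Complex.imLm - Complex.reLm).isLinear R).isPreconnected

theorem jostConnection_eq (h : IsVolterraPair R B (jostWeight Z κ) (jostRemainder Z μ κ))
    (hz : z ∈ aboveWedge R) (hw : w ∈ aboveWedge R) :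
    jostConnection Z μ a b κ z = jostConnection Z μ a b κ w :=
  (isSystemSolution_jostWave h).wronskian_eq (isOpen_aboveWedge R) (isPreconnected_aboveWedge R)
    (isSystemSolution_hyperbolicSolution_upperLog h.pos.le) hz hw

theorem jostWave_eq_combination
    (h : IsVolterraPair R B (jostWeight Z κ) (jostRemainder Z μ κ)) (hw : w ∈ aboveWedge R)
    (hz : z ∈ aboveWedge R) : jostWave Z μ κ z =
      jostConnection Z μ 0 1 κ w *
        hyperbolicSolution Z μ 1 0 (Complex.exp κ) (upperLog z - κ) +
      -jostConnection Z μ 1 0 κ w *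
        hyperbolicSolution Z μ 0 1 (Complex.exp κ) (upperLog z - κ) := by
  rw [(isSystemSolution_jostWave h).eq_combination (isOpen_aboveWedge R)
    (isPreconnected_aboveWedge R) (isSystemSolution_hyperbolicSolution_upperLog h.pos.le)
    (isSystemSolution_hyperbolicSolution_upperLog h.pos.le) hw
    (hyperbolicSolution_wronskian (upperLog w - κ)) hz, jostConnection, jostConnection]
  ring

theorem jostWave_mul_jostFactor
    (hz : upperLog (Complex.exp κ * (x + 1)) = κ + Complex.log (x + 1)) :
    jostWave Z μ κ (Complex.exp κ * (x + 1)) * jostFactor Z (Complex.exp κ) x =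
      jostAmplitude (jostWeight Z κ) (jostRemainder Z μ κ) (Complex.exp κ * (x + 1)) := by
  have hcancel :
      jostPrefactor Z κ (Complex.exp κ * (x + 1)) * jostFactor Z (Complex.exp κ) x = 1 := by
    rw [jostPrefactor, jostFactor, ← Complex.exp_add, hz, leadingPhase, jostExponent,
      Complex.exp_eq_one_iff]
    exact ⟨0, by push_cast; ring⟩
  rw [jostWave, mul_right_comm, hcancel, one_mul]

theorem differentiableAt_jostAmplitude_param
    (h : ∀ κ ∈ ball κ₀ 1, IsVolterraPair R B (jostWeight Z κ) (jostRemainder Z μ κ))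
    (hz : z ∈ aboveWedge R) :
    DifferentiableAt ℂ
      (fun κ => jostAmplitude (jostWeight Z κ) (jostRemainder Z μ κ) z) κ₀ ∧
    DifferentiableAt ℂ
      (fun κ => deriv (jostAmplitude (jostWeight Z κ) (jostRemainder Z μ κ)) z) κ₀ := by
  obtain ⟨ε, hε, hball⟩ := Metric.isOpen_iff.1 (isOpen_aboveWedge R) z hz
  have hz' : ball z (min ε 1) ⊆ aboveWedge R := (ball_subset_ball (min_le_left _ _)).trans hball
  have hκ : ball κ₀ (min ε 1) ⊆ ball κ₀ 1 := ball_subset_ball (min_le_right _ _)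
  have hweight : ∀ y ∈ aboveWedge R, DifferentiableOn ℂ (jostWeight Z · y) (ball κ₀ 1) :=
    fun y _ => by unfold jostWeight; fun_prop
  have hremainder : ∀ y ∈ aboveWedge R,
      DifferentiableOn ℂ (jostRemainder Z μ · y) (ball κ₀ 1) :=
    fun y _ => by unfold jostRemainder; fun_prop
  exact differentiableAt_comp_moving_point (ψ := fun _ => z) (lt_min hε one_pos)
    (fun y hy => (IsVolterraPair.differentiableOn_jostAmplitude_param isOpen_ball h hweight
      hremainder (hz' hy)).mono hκ)
    (fun κ hκ' => (h κ (hκ hκ')).differentiableOn_jostAmplitude.mono hz')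
    (fun κ hκ' y hy => (h κ (hκ hκ')).norm_jostAmplitude_le (hz' hy))
    (.of_forall fun _ => differentiableAt_const _)

theorem differentiableAt_jostConnection
    (h : ∀ κ ∈ ball κ₀ 1, IsVolterraPair R B (jostWeight Z κ) (jostRemainder Z μ κ))
    (hz : z ∈ aboveWedge R) :
    DifferentiableAt ℂ (fun κ => jostConnection Z μ a b κ z) κ₀ := by
  obtain ⟨hamplitude, hamplitude'⟩ := differentiableAt_jostAmplitude_param h hz
  obtain ⟨hsolution, hsolution'⟩ :=
    (isEntireFamily_hyperbolicSolution Z μ a b).differentiableAt_comp Complex.differentiable_exp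
      (by fun_prop : Differentiable ℂ fun κ => upperLog z - κ) κ₀
  have hprefactor : DifferentiableAt ℂ (fun κ => jostPrefactor Z κ z) κ₀ := by
    unfold jostPrefactor
    fun_prop
  unfold jostConnection jostWave jostWaveDeriv
  fun_prop

end JostWave

section JostFamily

variable {Z : ℝ} {μ κ w z : ℂ} {R B γ : ℝ}

theorem sub_two_mul_norm_le_height_add (z w : ℂ) : height z - 2 * ‖w‖ ≤ height (z + w) := by
  have hre := abs_sub_abs_le_abs_add z.re w.re
  rw [height, height, Complex.add_re, Complex.add_im]
  linarith [neg_abs_le w.im, Complex.abs_re_le_norm w, Complex.abs_im_le_norm w]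

theorem norm_le_height (hz : 0 ≤ z.im) : ‖z‖ ≤ height z := by
  have hnorm := Complex.norm_le_abs_re_add_abs_im z
  rwa [abs_of_nonneg hz, add_comm] at hnorm

theorem tendsto_height_rayPoint (hκγ : κ.im + γ ∈ Icc 0 Real.pi) :
    Tendsto (fun t => height (Complex.exp κ * (rayPoint γ t + 1))) atTop atTop := by
  have hlower : ∀ᶠ t in atTop, Real.exp κ.re * t + -(2 * Real.exp κ.re) ≤
      height (Complex.exp κ * (rayPoint γ t + 1)) := by
    filter_upwards [eventually_gt_atTop 0] with t ht
    have him : 0 ≤ (Complex.exp κ * rayPoint γ t).im := by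
      rw [rayPoint, ← mul_assoc, Complex.im_mul_ofReal, im_exp_mul_exp]
      exact mul_nonneg (mul_nonneg (Real.exp_pos _).le
        (Real.sin_nonneg_of_mem_Icc hκγ)) ht.le
    have hnorm := norm_le_height him
    rw [norm_mul, norm_rayPoint ht, Complex.norm_exp] at hnorm
    have hshift := sub_two_mul_norm_le_height_add (Complex.exp κ * rayPoint γ t) (Complex.exp κ)
    rw [Complex.norm_exp] at hshift
    rw [mul_add, mul_one]
    linarith
  exact tendsto_atTop_mono' _ hlower (tendsto_atTop_add_const_right _ _
    (tendsto_id.const_mul_atTop (Real.exp_pos _)))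

theorem eventually_upperLog_rayPoint (hγ : γ ∈ Ioo (-Real.pi) Real.pi)
    (hκγ : κ.im + γ ∈ Icc 0 Real.pi) :
    ∀ᶠ t in atTop, upperLog (Complex.exp κ * (rayPoint γ t + 1)) =
      κ + Complex.log (rayPoint γ t + 1) := by
  have harg : Tendsto (fun t => (Complex.log (rayPoint γ t + 1)).im) atTop (𝓝 γ) := by
    simpa [Function.comp_def] using
      (Complex.continuous_im.tendsto _).comp (tendsto_log_rayPoint hγ)
  have hpi := Real.pi_pos
  have hnear : Ioo (γ - Real.pi / 2) (γ + Real.pi / 2) ∈ 𝓝 γ :=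
    Ioo_mem_nhds (sub_lt_self γ (half_pos hpi)) (lt_add_of_pos_right γ (half_pos hpi))
  filter_upwards [eventually_gt_atTop 0, harg.eventually hnear] with t ht hbranch
  have hexp : Complex.exp κ * (rayPoint γ t + 1) =
      Complex.exp (κ + Complex.log (rayPoint γ t + 1)) := by
    rw [Complex.exp_add,
      Complex.exp_log (Complex.slitPlane_ne_zero (rayPoint_mem_radialDomain hγ ht))]
  rw [hexp, upperLog_exp] <;> rw [Complex.add_im]
  · linarith [hκγ.1, hbranch.1]
  · linarith [hκγ.2, hbranch.2]

theorem hasJostLimit_jostConnection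
    (h : IsVolterraPair R B (jostWeight Z κ) (jostRemainder Z μ κ)) (hw : w ∈ aboveWedge R)
    (hγ : γ ∈ Ioo (-Real.pi) Real.pi) (hκγ : κ.im + γ ∈ Icc 0 Real.pi) :
    HasJostLimit Z (Complex.exp κ) γ
      (radialSolution Z μ (jostConnection Z μ 0 1 κ w) (-jostConnection Z μ 1 0 κ w)
        (Complex.exp κ)) 1 := by
  have hheight := tendsto_height_rayPoint (γ := γ) hκγ
  have hamplitude : Tendsto (fun t => jostAmplitude (jostWeight Z κ) (jostRemainder Z μ κ)
      (Complex.exp κ * (rayPoint γ t + 1))) atTop (𝓝 1) := by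
    rw [tendsto_iff_norm_sub_tendsto_zero]
    exact squeeze_zero' (.of_forall fun t => norm_nonneg _)
      ((hheight.eventually_gt_atTop R).mono fun t ht => h.norm_jostAmplitude_sub_one_le ht)
      ((tendsto_const_nhds (x := 4 * B)).div_atTop hheight)
  refine hamplitude.congr' ?_
  filter_upwards [eventually_gt_atTop 0, hheight.eventually_gt_atTop R,
    eventually_upperLog_rayPoint hγ hκγ] with t ht hz hlog
  rw [← jostWave_mul_jostFactor hlog, jostWave_eq_combination h hw hz, hlog, add_sub_cancel_left,
    radialSolution_eq_combination (rayPoint_mem_radialDomain hγ ht)]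
  rfl

/-- The solutions with initial values `A κ` and `B κ` at `x = 0`, in the coordinate `κ = log k`, are
entire in `κ` and behave like `N κ * (x + 1)^{-1/2} exp (I * leadingPhase Z (exp κ) x)` along all
rays on which this does not grow. -/
structure IsJostFamily (Z : ℝ) (μ : ℂ) (N A B : ℂ → ℂ) : Prop where
  differentiable_value : Differentiable ℂ A
  differentiable_deriv : Differentiable ℂ B
  hasJostLimit : ∀ (κ : ℂ) (γ : ℝ), γ ∈ Ioo (-Real.pi) Real.pi → κ.im + γ ∈ Icc 0 Real.pi →
    HasJostLimit Z (Complex.exp κ) γ (radialSolution Z μ (A κ) (B κ) (Complex.exp κ)) (N κ)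

theorem exists_isJostFamily_one (Z : ℝ) (μ : ℂ) : ∃ A B, IsJostFamily Z μ (fun _ => 1) A B := by
  choose R B hpair using exists_isVolterraPair_jost Z μ
  have hself : ∀ κ, IsVolterraPair (R κ) (B κ) (jostWeight Z κ) (jostRemainder Z μ κ) :=
    fun κ => hpair κ κ (mem_ball_self one_pos)
  obtain ⟨w, hw⟩ : ∃ w : ℝ → ℂ, ∀ r r', r ≤ r' → w r' ∈ aboveWedge r :=
    ⟨fun r => (r + 1 : ℝ) * Complex.I, fun r r' hr => by
      simpa [aboveWedge, height] using hr.trans_lt (lt_add_one r')⟩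
  have hentire : ∀ a b, Differentiable ℂ fun κ => jostConnection Z μ a b κ (w (R κ)) :=
    fun a b κ₀ => by
    refine (differentiableAt_jostConnection (a := a) (b := b) (hpair κ₀)
      (hw _ _ le_rfl)).congr_of_eventuallyEq ?_
    filter_upwards [ball_mem_nhds κ₀ one_pos] with κ hκ
    rcases le_total (R κ) (R κ₀) with hR | hR
    · exact jostConnection_eq (hself κ) (hw _ _ le_rfl) (hw _ _ hR)
    · exact jostConnection_eq (hpair κ₀ κ hκ) (hw _ _ hR) (hw _ _ le_rfl)
  exact ⟨_, _, hentire 0 1, (hentire 1 0).fun_neg, fun κ γ hγ hκγ =>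
    hasJostLimit_jostConnection (hself κ) (hw _ _ le_rfl) hγ hκγ⟩

end JostFamily

/-! ### Jost functions -/

section PhaseNormalisation

variable {Z : ℝ} {μ : ℂ} {φ : ℝ → ℂ → ℂ} {c u : ℂ → ℂ} {k p σ n : ℂ} {γ : ℝ}

theorem isRadialSolution_sign_mul (hσ : σ = 1 ∨ σ = -1) :
    IsRadialSolution Z μ (σ * k) u ↔ IsRadialSolution Z μ k u := by
  have hpotential : radialPotential Z μ (σ * k) = radialPotential Z μ k := by
    funext x
    rw [radialPotential, radialPotential, mul_pow, sq_eq_one_iff.2 hσ, one_mul]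
  exact ⟨fun hu => ⟨hu.analytic, hpotential ▸ hu.ode⟩,
    fun hu => ⟨hu.analytic, hpotential ▸ hu.ode⟩⟩

theorem IsPhaseConstant.sign_mul (hc : IsPhaseConstant Z φ c) (hσ : σ = 1 ∨ σ = -1) (hk : k ≠ 0)
    (ξ : ℂ) : σ * (c (σ * k) + normalPhase Z (σ * k) ξ) = c k + normalPhase Z k ξ := by
  rcases hσ with rfl | rfl
  · simp only [one_mul]
  · rw [neg_one_mul k, hc.odd k hk, normalPhase_neg]
    ring

theorem ofReal_sqrt_eq_exp {y : ℝ} (hy : 0 < y) :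
    (√y : ℂ) = Complex.exp ((Real.log y : ℝ) / 2) := by
  rw [← Real.exp_log (Real.sqrt_pos.2 hy), Real.log_sqrt hy.le]
  push_cast
  rfl

/-- Any logarithm `w` asymptotic to `log (x + 1)` along the ray may replace it in the
normalisation. -/
theorem hasJostLimit_iff_tendsto (hp : p ≠ 0) {w : ℝ → ℂ}
    (hw : Tendsto (fun t => Complex.log (rayPoint γ t + 1) - w t) atTop (𝓝 0)) :
    HasJostLimit Z p γ u n ↔ Tendsto (fun t => u (rayPoint γ t) * Complex.exp (w t / 2 -
      Complex.I * normalPhase Z p (Complex.log (rayPoint γ t + 1)))) atTop (𝓝 n) := by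
  have hphase := (tendsto_normalPhase_log_sub_leadingPhase (Z := Z) hp).comp (tendsto_rayPoint γ)
  have hquotient := ((hw.div_const 2).add (hphase.const_mul Complex.I)).cexp
  simp only [zero_div, mul_zero, add_zero, Complex.exp_zero] at hquotient
  refine ((Asymptotics.IsEquivalent.refl (u := fun t => u (rayPoint γ t))).mul
    (Asymptotics.isEquivalent_of_tendsto_one (hquotient.congr fun t => ?_))).tendsto_nhds_iff
  rw [Pi.div_apply, jostFactor, ← Complex.exp_sub, Function.comp_apply]
  ring_nf

theorem tendsto_iff_hasJostLimit_zero (hc : IsPhaseConstant Z φ c) (hσ : σ = 1 ∨ σ = -1)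
    (hk : k ≠ 0) :
    Tendsto (fun x : ℝ => (√(x + 1) : ℂ) *
        Complex.exp (-(σ * Complex.I * φ (Real.log (x + 1)) (σ * k))) * u x) atTop (𝓝 1) ↔
      HasJostLimit Z k 0 u (Complex.exp (Complex.I * c k)) := by
  have hσk : σ * k ≠ 0 := by rcases hσ with rfl | rfl <;> simpa using hk
  have hlog : ∀ x : ℝ, 0 ≤ x → Complex.log (x + 1) = Real.log (x + 1) := fun x hx => by
    rw [Complex.ofReal_log (by positivity), Complex.ofReal_add, Complex.ofReal_one]
  have hlog_lim : Tendsto (fun x : ℝ => Complex.log (rayPoint 0 x + 1) - Real.log (x + 1)) atTop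
      (𝓝 0) := tendsto_const_nhds.congr' (by
    filter_upwards [eventually_ge_atTop 0] with x hx
    rw [rayPoint_zero, hlog x hx, sub_self])
  have hlog_atTop : Tendsto (fun x : ℝ => Real.log (x + 1)) atTop atTop :=
    Real.tendsto_log_atTop.comp (tendsto_atTop_add_const_right _ _ tendsto_id)
  rw [hasJostLimit_iff_tendsto hk hlog_lim,
    ← tendsto_const_smul_iff₀ (Complex.exp_ne_zero (Complex.I * c k)), smul_eq_mul, mul_one]
  refine tendsto_congr' ?_
  filter_upwards [eventually_ge_atTop 0, hlog_atTop.eventually (hc.eventually_eq _ hσk)]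
    with x hx hφ
  rw [smul_eq_mul, hφ, rayPoint_zero, hlog x hx, ofReal_sqrt_eq_exp (by positivity),
    mul_right_comm σ, hc.sign_mul hσ hk, mul_comm (u x), ← mul_assoc, ← Complex.exp_add,
    ← Complex.exp_add]
  ring_nf

theorem HasJostLimit.tendsto_phaseContinuation (hc : IsPhaseConstant Z φ c)
    (hσ : σ = 1 ∨ σ = -1) (hp : p ≠ 0) (hγ : γ ∈ Ioo (-Real.pi) Real.pi) {Φ : ℂ → ℂ → ℂ}
    (hΦ : IsPhaseContinuation φ Φ) (hu : HasJostLimit Z (-p) γ u n) :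
    Tendsto (fun t : ℝ => Complex.exp (Complex.I * γ / 2) * (√t : ℂ) *
      Complex.exp (σ * Complex.I * Φ (rayPoint γ t) (σ * p)) * u (rayPoint γ t)) atTop
      (𝓝 (Complex.exp (Complex.I * c p) * n)) := by
  have hσp : σ * p ≠ 0 := by rcases hσ with rfl | rfl <;> simpa using hp
  obtain ⟨R, hR⟩ := hΦ.exists_eqOn_slitExterior hc.isPhaseContinuation hσp
  have hlog : Tendsto (fun t : ℝ => Complex.log (rayPoint γ t + 1) -
      (Real.log t + Complex.I * γ)) atTop (𝓝 0) := by
    simpa only [sub_sub, sub_self] using (tendsto_log_rayPoint hγ).sub_const (Complex.I * γ)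
  refine (((hasJostLimit_iff_tendsto (neg_ne_zero.2 hp) hlog).1 hu).const_mul _).congr' ?_
  filter_upwards [eventually_gt_atTop 0, eventually_gt_atTop R] with t ht htR
  have hΦt : σ * Complex.I * Φ (rayPoint γ t) (σ * p) =
      Complex.I * (c p + normalPhase Z p (Complex.log (rayPoint γ t + 1))) := by
    have hΦR : Φ (rayPoint γ t) (σ * p) = _ :=
      hR ⟨rayPoint_mem_slitPlane hγ ht, by rwa [norm_rayPoint ht]⟩
    rw [hΦR, ← hc.sign_mul hσ hp]
    ring
  rw [hΦt, normalPhase_neg, ofReal_sqrt_eq_exp ht, mul_comm (u _), ← mul_assoc,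
    ← Complex.exp_add, ← Complex.exp_add, ← Complex.exp_add]
  ring_nf

end PhaseNormalisation

section JostFunction

theorem isOpen_jostDomain (α β : ℝ) : IsOpen (jostDomain α β) :=
  (isOpen_lt continuous_const Complex.continuous_im).inter
    (isOpen_lt Complex.continuous_im continuous_const)

theorem isPreconnected_jostDomain (α β : ℝ) : IsPreconnected (jostDomain α β) :=
  ((convex_halfSpace_im_gt (-β)).inter (convex_halfSpace_im_lt (Real.pi + α))).isPreconnected

variable {Z : ℝ} {μ σ : ℂ} {φ : ℝ → ℂ → ℂ} {N A B c : ℂ → ℂ} {α β : ℝ} {v : ℂ → ℂ → ℂ}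
  {κ x : ℂ} {s : ℂ → ℂ}

theorem IsJostFamily.mul {M : ℂ → ℂ} (hM : Differentiable ℂ M) (hAB : IsJostFamily Z μ N A B) :
    IsJostFamily Z μ (fun κ => M κ * N κ) (fun κ => M κ * A κ) fun κ => M κ * B κ where
  differentiable_value := hM.fun_mul hAB.differentiable_value
  differentiable_deriv := hM.fun_mul hAB.differentiable_deriv
  hasJostLimit κ γ hγ hκγ := by
    refine ((hAB.hasJostLimit κ γ hγ hκγ).const_mul (M κ)).congr' ?_
    filter_upwards [eventually_gt_atTop 0] with t ht
    have hmem := rayPoint_mem_radialDomain hγ ht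
    rw [radialSolution_eq_combination hmem, radialSolution_eq_combination (a := M κ * A κ) hmem]
    ring

/-- The amplitude that turns the leading phase into the phase with constant `c`. -/
noncomputable def phaseAmplitude (c : ℂ → ℂ) (κ : ℂ) : ℂ :=
  Complex.exp (Complex.I * c (Complex.exp κ))

theorem IsPhaseConstant.exists_isJostFamily (hc : IsPhaseConstant Z φ c) (μ : ℂ) :
    ∃ A B, IsJostFamily Z μ (phaseAmplitude c) A B := by
  obtain ⟨A, B, hAB⟩ := exists_isJostFamily_one Z μ
  have hentire : Differentiable ℂ (phaseAmplitude c) := fun κ =>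
    (((hc.differentiableAt _ (Complex.exp_ne_zero κ)).comp κ
      Complex.differentiableAt_exp).const_mul _).cexp
  exact ⟨_, _, by simpa only [mul_one] using hAB.mul hentire⟩

theorem IsJostFamily.isJostSolution (hAB : IsJostFamily Z μ (phaseAmplitude c) A B)
    (hc : IsPhaseConstant Z φ c) (hσ : σ = 1 ∨ σ = -1) (α β : ℝ) :
    IsJostSolution Z μ φ α β σ fun κ => radialSolution Z μ (A κ) (B κ) (Complex.exp κ) where
  solution κ _ := (isRadialSolution_sign_mul hσ).2 isRadialSolution_radialSolution
  analytic x hx := by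
    have hr : ∀ a b, Differentiable ℂ fun κ => radialSolution Z μ a b (Complex.exp κ) x :=
      fun a b => ((isEntireFamily_hyperbolicSolution Z μ a b).differentiable_param _).comp
        Complex.differentiable_exp
    have hcombination : (fun κ => radialSolution Z μ (A κ) (B κ) (Complex.exp κ) x) = fun κ =>
        A κ * radialSolution Z μ 1 0 (Complex.exp κ) x +
          B κ * radialSolution Z μ 0 1 (Complex.exp κ) x :=
      funext fun κ => radialSolution_eq_combination hx
    rw [hcombination]
    exact ((hAB.differentiable_value.fun_mul (hr 1 0)).fun_add
      (hAB.differentiable_deriv.fun_mul (hr 0 1))).differentiableOn.analyticOnNhd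
        (isOpen_jostDomain α β)
  asymptotics κ _ h₀ hπ := (tendsto_iff_hasJostLimit_zero hc hσ (Complex.exp_ne_zero κ)).2
    (hAB.hasJostLimit κ 0 ⟨neg_lt_zero.2 Real.pi_pos, Real.pi_pos⟩ (by simpa using ⟨h₀, hπ⟩))

/-- Where `0 < Im κ < π` the Jost solution decays, so its asymptotics determine it; the identity
theorem in `κ` does the rest. -/
theorem IsJostSolution.eq_radialSolution (hv : IsJostSolution Z μ φ α β σ v)
    (hAB : IsJostFamily Z μ (phaseAmplitude c) A B) (hc : IsPhaseConstant Z φ c)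
    (hσ : σ = 1 ∨ σ = -1) (hα : 0 ≤ α) (hβ : 0 ≤ β) (hκ : κ ∈ jostDomain α β)
    (hx : x ∈ radialDomain) : v κ x = radialSolution Z μ (A κ) (B κ) (Complex.exp κ) x := by
  have hpi := Real.pi_pos
  have hupper : ∀ κ : ℂ, κ.im ∈ Ioo 0 Real.pi →
      v κ x = radialSolution Z μ (A κ) (B κ) (Complex.exp κ) x := fun κ hκ => by
    have hmem : κ ∈ jostDomain α β := ⟨by linarith [hκ.1], by linarith [hκ.2]⟩
    have hsolution := (isRadialSolution_sign_mul hσ).1 (hv.solution κ hmem)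
    have hvlim := (tendsto_iff_hasJostLimit_zero hc hσ (Complex.exp_ne_zero κ)).1
      (hv.asymptotics κ hmem hκ.1.le hκ.2.le)
    have hwlim := hAB.hasJostLimit κ 0 ⟨neg_lt_zero.2 hpi, hpi⟩
      (by simpa using ⟨hκ.1.le, hκ.2.le⟩)
    obtain ⟨hvalue, hderiv⟩ := hvlim.eq_initial_values hsolution isRadialSolution_radialSolution
      ⟨neg_lt_zero.2 hpi, hpi⟩ (im_exp_mul_exp_pos (by simpa using hκ)) (Complex.exp_ne_zero _)
      hwlim
    rw [hsolution.eq_radialSolution hx, hvalue, hderiv, radialSolution_zero,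
      deriv_radialSolution_zero]
  have hcenter : (Real.pi / 2 * Complex.I).im = Real.pi / 2 := by simp
  refine (hv.analytic x hx).eqOn_of_preconnected_of_eventuallyEq
    ((hAB.isJostSolution hc hσ α β).analytic x hx) (isPreconnected_jostDomain α β)
    (z₀ := Real.pi / 2 * Complex.I) ⟨by linarith, by linarith⟩ ?_ hκ
  exact (Complex.continuous_im.continuousAt.eventually_mem
    (Ioo_mem_nhds (by linarith) (by linarith))).mono hupper

theorem IsJostSolution.wronskian_eq_neg (hv : IsJostSolution Z μ φ α β σ v)
    (hAB : IsJostFamily Z μ (phaseAmplitude c) A B) (hc : IsPhaseConstant Z φ c)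
    (hσ : σ = 1 ∨ σ = -1) (hα : 0 ≤ α) (hβ : 0 ≤ β) (hκ : κ ∈ jostDomain α β)
    (hs : IsRegularSolution Z μ (σ * Complex.exp κ) s) (hx : x ∈ radialDomain) :
    wronskian (v κ) s x = -B κ := by
  have hv₀ : v κ =ᶠ[𝓝 0] radialSolution Z μ (A κ) (B κ) (Complex.exp κ) :=
    eventually_of_mem (isOpen_radialDomain.mem_nhds zero_mem_radialDomain) fun x hx =>
      hv.eq_radialSolution hAB hc hσ hα hβ hκ hx
  rw [(hv.solution κ hκ).wronskian_eq hs.solution hx zero_mem_radialDomain, wronskian,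
    hs.value_zero, hs.deriv_zero, hv₀.deriv_eq, deriv_radialSolution_zero]
  ring

theorem IsJostSolution.tendsto_wronskian (hv : IsJostSolution Z μ φ α β σ v)
    (hAB : IsJostFamily Z μ (phaseAmplitude c) A B) (hc : IsPhaseConstant Z φ c)
    (hσ : σ = 1 ∨ σ = -1) (hα : 0 ≤ α) (hβ : 0 ≤ β) (hκ : κ ∈ jostDomain α β)
    {Φ : ℂ → ℂ → ℂ} (hΦ : IsPhaseContinuation φ Φ)
    (hs : IsRadialSolution Z μ (σ * Complex.exp κ) s) {γ : ℝ}
    (hγ : γ ∈ Ioo (-Real.pi) Real.pi) (hκγ : κ.im + γ ∈ Ioo 0 Real.pi) :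
    Tendsto (fun x : ℝ => -σ * (Complex.I * (σ * Complex.exp κ)) *
      (Complex.exp (Complex.I * γ / 2) * (√x : ℂ) * Complex.exp (σ * Complex.I *
        Φ (Complex.exp (Complex.I * γ) * x) (σ * Complex.exp κ)) *
          s (Complex.exp (Complex.I * γ) * x))) atTop (𝓝 (wronskian (v κ) s 0)) := by
  have hp := Complex.exp_ne_zero κ
  have hvlim : HasJostLimit Z (Complex.exp κ) γ (v κ) (phaseAmplitude c κ) := by
    refine (hAB.hasJostLimit κ γ hγ (Ioo_subset_Icc_self hκγ)).congr' ?_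
    filter_upwards [eventually_gt_atTop 0] with t ht
    rw [hv.eq_radialSolution hAB hc hσ hα hβ hκ (rayPoint_mem_radialDomain hγ ht)]
  have hslim := hvlim.of_wronskian (hv.solution κ hκ) hs hγ (im_exp_mul_exp_pos hκγ)
    (Complex.exp_ne_zero _)
  have hvalue : -σ * (Complex.I * (σ * Complex.exp κ)) * (phaseAmplitude c κ *
      (wronskian (v κ) s 0 / (-(Complex.I * Complex.exp κ) * phaseAmplitude c κ))) =
      wronskian (v κ) s 0 := by
    have hI := Complex.I_ne_zero
    have hn : phaseAmplitude c κ ≠ 0 := Complex.exp_ne_zero _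
    rcases hσ with rfl | rfl <;> field_simp
  rw [← hvalue]
  exact (hslim.tendsto_phaseContinuation hc hσ hp hγ hΦ).const_mul _

end JostFunction

end TwoCenters

theorem corollary4p10 (Z : ℝ) (μ : ℂ) (φ : ℝ → ℂ → ℂ) (hφ : TwoCenters.IsGlobalPhase Z μ φ)
    (α β : ℝ) (hα₀ : 0 ≤ α) (hα : α < Real.pi) (hβ₀ : 0 ≤ β) (hβ : β < Real.pi) :
    -- the objects exist
    (∃ Φ : ℂ → ℂ → ℂ, TwoCenters.IsPhaseContinuation φ Φ) ∧
    (∃ v₀ : ℂ → ℂ → ℂ, ∀ k : ℂ, k ≠ 0 → TwoCenters.IsRegularSolution Z μ k (v₀ k)) ∧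
    (∀ σ : ℂ, σ = 1 ∨ σ = -1 →
      ∃ v : ℂ → ℂ → ℂ, TwoCenters.IsJostSolution Z μ φ α β σ v) ∧
    -- the Jost functions are analytic and given by the limit formula
    ∀ Φ : ℂ → ℂ → ℂ, TwoCenters.IsPhaseContinuation φ Φ →
    ∀ v₀ : ℂ → ℂ → ℂ, (∀ k : ℂ, k ≠ 0 → TwoCenters.IsRegularSolution Z μ k (v₀ k)) →
    ∀ σ : ℂ, σ = 1 ∨ σ = -1 →
    ∀ v : ℂ → ℂ → ℂ, TwoCenters.IsJostSolution Z μ φ α β σ v →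
    ∃ f : ℂ → ℂ,
      (∀ κ ∈ TwoCenters.jostDomain α β, ∀ x ∈ TwoCenters.radialDomain,
        TwoCenters.wronskian (v κ) (v₀ (σ * Complex.exp κ)) x = f κ) ∧
      AnalyticOnNhd ℂ f (TwoCenters.jostDomain α β) ∧
      ∀ κ ∈ TwoCenters.jostDomain α β, ∀ γ : ℝ, -α < γ → γ < β →
        0 < κ.im + γ → κ.im + γ < Real.pi →
        Filter.Tendsto
          (fun x : ℝ => -σ * (Complex.I * (σ * Complex.exp κ)) *
            (Complex.exp (Complex.I * γ / 2) * (√x : ℂ)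
              * Complex.exp (σ * Complex.I
                  * Φ (Complex.exp (Complex.I * γ) * x) (σ * Complex.exp κ))
              * v₀ (σ * Complex.exp κ) (Complex.exp (Complex.I * γ) * x)))
          Filter.atTop (nhds (f κ)) := by
  obtain ⟨c, hc⟩ := hφ.exists_isPhaseConstant
  obtain ⟨A, B, hAB⟩ := hc.exists_isJostFamily μ
  refine ⟨⟨_, hc.isPhaseContinuation⟩, ⟨TwoCenters.radialSolution Z μ 1 0, fun k _ =>
    ⟨TwoCenters.isRadialSolution_radialSolution, TwoCenters.radialSolution_zero,
      TwoCenters.deriv_radialSolution_zero⟩⟩,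
    fun σ hσ => ⟨_, hAB.isJostSolution hc hσ α β⟩, fun Φ hΦ v₀ hv₀ σ hσ v hv => ?_⟩
  have hregular : ∀ κ, TwoCenters.IsRegularSolution Z μ (σ * Complex.exp κ)
      (v₀ (σ * Complex.exp κ)) := fun κ =>
    hv₀ _ (mul_ne_zero (by rcases hσ with rfl | rfl <;> norm_num) (Complex.exp_ne_zero κ))
  refine ⟨fun κ => -B κ, fun κ hκ x hx =>
    hv.wronskian_eq_neg hAB hc hσ hα₀ hβ₀ hκ (hregular κ) hx,
    hAB.differentiable_deriv.fun_neg.differentiableOn.analyticOnNhd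
      (TwoCenters.isOpen_jostDomain α β), fun κ hκ γ hαγ hγβ hpos hlt => ?_⟩
  have hlimit := hv.tendsto_wronskian hAB hc hσ hα₀ hβ₀ hκ hΦ (hregular κ).solution
    (γ := γ) ⟨by linarith, by linarith⟩ ⟨hpos, hlt⟩
  rwa [hv.wronskian_eq_neg hAB hc hσ hα₀ hβ₀ hκ (hregular κ)
    TwoCenters.zero_mem_radialDomain] at hlimit
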